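/- Let $A,B\in\mathbb R$. On the Schwartz space $\mathcal D=\mathcal S(\mathbb R^2)\subset\mathcal H=L^2(\mathbb R^2)$ let $x_1,x_2$ be the position operators and $p_j=-i\,\partial/\partial x_j$. For $\theta,\tilde\theta\in\mathbb R$ put $$\hat x_1=x_1-\tfrac12\theta p_2,\quad \hat x_2=x_2+\tfrac12\theta p_1,\quad \hat p_1=p_1+\tfrac12\tilde\theta x_2,\quad \hat p_2=p_2-\tfrac12\tilde\theta x_1,$$ $$\hat H=\tfrac12(\hat p_1^2+\hat x_1^2)+\tfrac12(\hat p_2^2+\hat x_2^2)+i\left[A(\hat x_1+\hat x_2)+B(\hat p_1+\hat p_2)\right],$$ $X_j=x_j+iA_j$, $P_j=p_j+iB_j$ with $A_1=A+\frac12\theta B$, $A_2=A-\frac12\theta B$, $B_1=B-\frac12\tilde\theta A$, $B_2=B+\frac12\tilde\theta A$, and $$a_1=\tfrac12(X_1+iP_1+iX_2-P_2),\quad a_2=\tfrac12(-iX_1+P_1-X_2-iP_2),$$ $$b_1=\tfrac12(X_1-iP_1-iX_2-P_2),\quad b_2=\tfrac12(iX_1+P_1-X_2+iP_2),\qquad N_j=b_ja_j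 .$$ Write $F\equiv G$ if $F-G$ is a polynomial in $\theta,\tilde\theta$, with operators on $\mathcal S(\mathbb R^2)$ as coefficients, all of whose monomials have degree at least $2$. All adjoints are taken in $L^2(\mathbb R^2)$, of operators with domain $\mathcal S(\mathbb R^2)$. (1) With $\epsilon_{12}=-\epsilon_{21}=1$, $\epsilon_{jj}=0$: $[\hat x_j,\hat p_k]\equiv i\delta_{jk}$, $[\hat x_j,\hat x_k]\equiv i\theta\epsilon_{jk}$, $[\hat p_j,\hat p_k]\equiv i\tilde\theta\epsilon_{jk}$, and $$\hat H\equiv\tfrac12(p_1^2+x_1^2)+\tfrac12(p_2^2+x_2^2)+i[A(x_1+x_2)+B(p_1+p_2)]+\tfrac12(\theta+\tilde\theta)(p_1x_2-p_2x_1)+i\left[\tfrac{A\theta}2(p_1-p_2)-\tfrac{B\tilde\theta}2(x_1-x_2)\right],$$ $$\hat H\equiv(N_1+N_2+1)+\tfrac12(\theta+\tilde\theta)(N_1-N_2)+(A^2+B^2).$$ Now fix any $\theta,\tilde\theta\in\mathbb R$ and let $$k_1=A(1-\tfrac{\tilde\theta}2)(i-1)+B(\tfrac\theta2-1)(i+1),\qquad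 k_2=A(1+\tfrac{\tilde\theta}2)(1-i)+B(\tfrac\theta2+1)(i+1),$$ $\alpha_1=\frac{k_1+ik_2}2$, $\alpha_2=\frac{k_1-ik_2}{2i}$. (2) $(a_j,b_j)_{j=1,2}$ are $\mathcal D$-pseudo-bosonic: $\mathcal D$ is dense in $\mathcal H$ and stable under $a_j,b_j,a_j^\dagger,b_j^\dagger$, and on $\mathcal D$ one has $[a_j,b_k]=\delta_{jk}$, $[a_j,a_k]=[b_j,b_k]=0$. If $k_j\neq0$ then $b_j\ne a_j^\dagger$ on $\mathcal D$. The functions $\varphi_{0,0}=Ne^{-\frac12(x_1^2+x_2^2)-\alpha_1x_1-\alpha_2x_2}$ and $\Psi_{0,0}=N'e^{-\frac12(x_1^2+x_2^2)+\alpha_1x_1+\alpha_2x_2}$ ($N,N'\in\mathbb C$) belong to $\mathcal D$ and satisfy $a_j\varphi_{0,0}=0=b_j^\dagger\Psi_{0,0}$, and so all the vectors $$\varphi_{n_1,n_2}=\frac{b_1^{n_1}b_2^{n_2}\varphi_{0,0}}{\sqrt{n_1!\,n_2!}},\qquad \Psi_{n_1,n_2}=\frac{(a_1^\dagger)^{n_1}(a_2^\dagger)^{n_2}\Psi_{0,0}}{\sqrt{n_1!\,n_2!}}$$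 belong to $\mathcal D$. (3) Let $c_j=\frac1{\sqrt2}(x_j+ip_j)$, $c_g=\frac1{\sqrt2}(c_1+ic_2)$, $c_d=\frac{-i}{\sqrt2}(c_1-ic_2)$. On $\mathcal D$, which is stable under $c_g,c_d,c_g^\dagger,c_d^\dagger$, one has $[c_g,c_g^\dagger]=[c_d,c_d^\dagger]=1$, and the other commutators vanish. The function $\chi_{0,0}=\pi^{-1/2}e^{-\frac12(x_1^2+x_2^2)}$ belongs to $\mathcal D$ and is annihilated by $c_g$ and $c_d$, and the vectors $\chi_{n_1,n_2}=\frac1{\sqrt{n_1!\,n_2!}}(c_g^\dagger)^{n_1}(c_d^\dagger)^{n_2}\chi_{0,0}$, $n_j\ge0$, form an orthonormal basis of $\mathcal H$. (4) The operator $-\frac12(k_1c_g^\dagger+k_2c_d^\dagger+\overline{k_1}c_g+\overline{k_2}c_d)$ with domain $\mathcal D$ has a self-adjoint closure. Let $$T=\exp\left\{-\tfrac12\left(k_1c_g^\dagger+k_2c_d^\dagger+\overline{k_1}\,c_g+\overline{k_2}\,c_d\right)\right\}$$ be the exponential of this closure in the sense of the functional calculus of self-adjoint operators. Then $T$ is self-adjoint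 and injective, it is unbounded if $(A,B)\neq(0,0)$, and $\chi_{n_1,n_2}\in D(T)\cap D(T^{-1})$ for all $n_1,n_2$. One can choose $N,N'$ with $\langle\varphi_{0,0},\Psi_{0,0}\rangle=1$ such that, for all $n_1,n_2\ge0$, $$\varphi_{n_1,n_2}=T\chi_{n_1,n_2},\qquad\Psi_{n_1,n_2}=T^{-1}\chi_{n_1,n_2};$$ for every other choice of $N,N'$ with $\langle\varphi_{0,0},\Psi_{0,0}\rangle=1$ there is a constant $c\neq0$ with $\varphi_{n_1,n_2}=c\,T\chi_{n_1,n_2}$ and $\Psi_{n_1,n_2}=\overline c^{\,-1}T^{-1}\chi_{n_1,n_2}$ for all $n_1,n_2$. (5) For every choice of $N,N'$ with $\langle\varphi_{0,0},\Psi_{0,0}\rangle=1$ the families $\mathcal F_\varphi=\{\varphi_{n_1,n_2}\}$ and $\mathcal F_\Psi=\{\Psi_{n_1,n_2}\}$ are biorthonormal, and they are $\mathcal G$-quasi bases for $\mathcal G=D(T)\cap D(T^{-1})$: $\mathcal G$ is dense in $\mathcal H$, it contains all $\varphi_{n_1,n_2}$ and $\Psi_{n_1,n_2}$, and for all $f,g\in\mathcal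 G$ $$\langle f,g\rangle=\sum_{n_1,n_2\ge0}\langle f,\varphi_{n_1,n_2}\rangle\langle\Psi_{n_1,n_2},g\rangle=\sum_{n_1,n_2\ge0}\langle f,\Psi_{n_1,n_2}\rangle\langle\varphi_{n_1,n_2},g\rangle .$$ -/

import Mathlib

open MeasureTheory Complex
open scoped SchwartzMap ComplexConjugate InnerProductSpace

noncomputable section

namespace NCPB

/-! ### Pseudo-bosons on a general Hilbert space -/

section General

variable {H : Type*} [NormedAddCommGroup H] [InnerProductSpace ℂ H] [CompleteSpace H]

open Classical in
/-- The value `A f` of a partially defined operator (and `0` outside of its domain). It is only used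
on vectors that the surrounding statements show to be in the domain. -/
def ev (A : H →ₗ.[ℂ] H) (f : H) : H :=
  if h : f ∈ A.domain then A ⟨f, h⟩ else 0

/-- `D ⊆ D(A)` and `A D ⊆ D`. -/
def Stable (A : H →ₗ.[ℂ] H) (D : Submodule ℂ H) : Prop :=
  D ≤ A.domain ∧ ∀ f ∈ D, ev A f ∈ D

/-- Two-mode `D`-pseudo-bosonic operators: `D` is dense, it is stable under `a_j`, `b_j` and their
adjoints, and on `D` one has `[a_j, b_k] = δ_{jk}` while the other commutators vanish. -/
structure IsPseudoBosonic (D : Submodule ℂ H) (a b : Fin 2 → H →ₗ.[ℂ] H) : Prop where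
  dense : Dense (D : Set H)
  stable_a : ∀ j, Stable (a j) D
  stable_b : ∀ j, Stable (b j) D
  stable_a_adjoint : ∀ j, Stable (a j).adjoint D
  stable_b_adjoint : ∀ j, Stable (b j).adjoint D
  comm_ab : ∀ j k, ∀ f ∈ D,
    ev (a j) (ev (b k) f) - ev (b k) (ev (a j) f) = if j = k then f else 0
  comm_aa : ∀ j k, ∀ f ∈ D, ev (a j) (ev (a k) f) - ev (a k) (ev (a j) f) = 0
  comm_bb : ∀ j k, ∀ f ∈ D, ev (b j) (ev (b k) f) - ev (b k) (ev (b j) f) = 0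

/-- `(n₁! n₂!)^{-1/2} A₁^{n₁} A₂^{n₂} v`. -/
def ladder (A : Fin 2 → H →ₗ.[ℂ] H) (v : H) (n : ℕ × ℕ) : H :=
  (((Real.sqrt (n.1.factorial * n.2.factorial))⁻¹ : ℝ) : ℂ) •
    (ev (A 0))^[n.1] ((ev (A 1))^[n.2] v)

/-- `φ` and `Ψ` are `G`-quasi bases: `G` is dense, contains all the `φ_n` and `Ψ_n`, and
`⟨f, g⟩ = ∑ ⟨f, φ_n⟩ ⟨Ψ_n, g⟩ = ∑ ⟨f, Ψ_n⟩ ⟨φ_n, g⟩` for all `f, g ∈ G`. -/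
structure IsQuasiBases {ι : Type*} (G : Submodule ℂ H) (φ Ψ : ι → H) : Prop where
  dense : Dense (G : Set H)
  mem_left : ∀ n, φ n ∈ G
  mem_right : ∀ n, Ψ n ∈ G
  hasSum_left : ∀ f ∈ G, ∀ g ∈ G, HasSum (fun n => ⟪f, φ n⟫_ℂ * ⟪Ψ n, g⟫_ℂ) ⟪f, g⟫_ℂ
  hasSum_right : ∀ f ∈ G, ∀ g ∈ G, HasSum (fun n => ⟪f, Ψ n⟫_ℂ * ⟪φ n, g⟫_ℂ) ⟪f, g⟫_ℂ

/-- `A = U⁻¹ M_g U`, where `M_g` is the operator of multiplication by the real function `g` on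
`L²(μ)`, with its maximal domain. -/
def IsMultiplication {X : Type*} [MeasurableSpace X] {μ : Measure X}
    (U : H ≃ₗᵢ[ℂ] Lp ℂ 2 μ) (g : X → ℝ) (A : H →ₗ.[ℂ] H) : Prop :=
  ∀ h k : H, (h, k) ∈ A.graph ↔ (U k : X → ℂ) =ᵐ[μ] fun x => (g x : ℂ) * (U h : X → ℂ) x

/-- `T = exp K` in the sense of the functional calculus of self-adjoint operators: in a spectral
representation in which `K` is multiplication by the real measurable function `g`, the operator `T`
is multiplication by `exp ∘ g`. -/
def IsExp (K T : H →ₗ.[ℂ] H) : Prop :=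
  ∃ (X : Type) (_ : MeasurableSpace X) (μ : Measure X) (U : H ≃ₗᵢ[ℂ] Lp ℂ 2 μ) (g : X → ℝ),
    Measurable g ∧ IsMultiplication U g K ∧ IsMultiplication U (fun x => Real.exp (g x)) T

end General

/-! ### Operators on `𝓢(ℝ²)` and `L²(ℝ²)` -/

/-- The plane `ℝ²`; the two coordinates are indexed by `0` and `1`. -/
abbrev Plane := EuclideanSpace ℝ (Fin 2)

/-- The Hilbert space `L²(ℝ²)`. -/
abbrev Hil := Lp ℂ 2 (volume : Measure Plane)

/-- The algebra of continuous linear operators on `𝓢(ℝ²)`. -/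
abbrev SOp := 𝓢(Plane, ℂ) →L[ℂ] 𝓢(Plane, ℂ)

/-- The inclusion of `𝓢(ℝ²)` in `L²(ℝ²)`. -/
def incl : 𝓢(Plane, ℂ) →ₗ[ℂ] Hil := (SchwartzMap.toLpCLM ℂ ℂ 2 volume).toLinearMap

theorem incl_injective : Function.Injective incl := SchwartzMap.injective_toLp 2 volume

/-- `𝓢(ℝ²)` as a subspace of `L²(ℝ²)`. -/
def schwartzD : Submodule ℂ Hil := LinearMap.range incl

/-- An operator on `𝓢(ℝ²)`, as an operator on `L²(ℝ²)` with domain `𝓢(ℝ²)`. -/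
def toPMap (A : SOp) : Hil →ₗ.[ℂ] Hil where
  domain := schwartzD
  toFun := incl ∘ₗ A.toLinearMap ∘ₗ (LinearEquiv.ofInjective incl incl_injective).symm.toLinearMap

/-- The position operators `x_j`. -/
def x (j : Fin 2) : SOp := SchwartzMap.smulLeftCLM ℂ (fun v : Plane => ((v j : ℝ) : ℂ))

/-- The momentum operators `p_j = -i ∂/∂x_j`. -/
def p (j : Fin 2) : SOp :=
  (-I) • LineDeriv.lineDerivOpCLM ℂ 𝓢(Plane, ℂ) (EuclideanSpace.single j (1 : ℝ))

/-! ### The noncommutative model; `s` and `t` stand for `θ` and `θ̃` -/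

/-- The operators `x̂_j`. -/
def xHat (s : ℝ) : Fin 2 → SOp :=
  ![x 0 - ((s / 2 : ℝ) : ℂ) • p 1, x 1 + ((s / 2 : ℝ) : ℂ) • p 0]

/-- The operators `p̂_j`. -/
def pHat (t : ℝ) : Fin 2 → SOp :=
  ![p 0 + ((t / 2 : ℝ) : ℂ) • x 1, p 1 - ((t / 2 : ℝ) : ℂ) • x 0]

/-- The antisymmetric symbol. -/
def eps (j k : Fin 2) : ℂ := ((k : ℕ) : ℂ) - ((j : ℕ) : ℂ)

/-- The Hamiltonian `Ĥ` in terms of the operators `x̂_j`, `p̂_j`. -/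
def hHat (A B s t : ℝ) : SOp :=
  (1 / 2 : ℂ) • (pHat t 0 ^ 2 + xHat s 0 ^ 2) + (1 / 2 : ℂ) • (pHat t 1 ^ 2 + xHat s 1 ^ 2)
    + I • ((A : ℂ) • (xHat s 0 + xHat s 1) + (B : ℂ) • (pHat t 0 + pHat t 1))

/-- The Hamiltonian `Ĥ` truncated to first order in `θ` and `θ̃`. -/
def hTrunc (A B s t : ℝ) : SOp :=
  (1 / 2 : ℂ) • (p 0 ^ 2 + x 0 ^ 2) + (1 / 2 : ℂ) • (p 1 ^ 2 + x 1 ^ 2)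
    + I • ((A : ℂ) • (x 0 + x 1) + (B : ℂ) • (p 0 + p 1))
    + (((s + t) / 2 : ℝ) : ℂ) • (p 0 * x 1 - p 1 * x 0)
    + I • (((A * s / 2 : ℝ) : ℂ) • (p 0 - p 1) - ((B * t / 2 : ℝ) : ℂ) • (x 0 - x 1))

/-- Equality up to terms of order at least two in `(θ, θ̃)`: the difference is a polynomial in
`θ, θ̃`, with operators on `𝓢(ℝ²)` as coefficients, all of whose monomials have degree at least
two. -/
def EqModQuadratic (F G : ℝ → ℝ → SOp) : Prop :=
  ∃ R : (ℕ × ℕ) →₀ SOp, (∀ i ∈ R.support, 2 ≤ i.1 + i.2) ∧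
    ∀ s t : ℝ, F s t - G s t = R.sum fun i r => ((s ^ i.1 * t ^ i.2 : ℝ) : ℂ) • r

/-- The operators `X_j = x_j + i A_j`. -/
def X (A B s : ℝ) : Fin 2 → SOp :=
  ![x 0 + (I * ((A + s * B / 2 : ℝ) : ℂ)) • 1, x 1 + (I * ((A - s * B / 2 : ℝ) : ℂ)) • 1]

/-- The operators `P_j = p_j + i B_j`. -/
def P (A B t : ℝ) : Fin 2 → SOp :=
  ![p 0 + (I * ((B - t * A / 2 : ℝ) : ℂ)) • 1, p 1 + (I * ((B + t * A / 2 : ℝ) : ℂ)) • 1]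

/-- The pseudo-bosonic operators `a_1, a_2`, on `𝓢(ℝ²)`. -/
def aS (A B s t : ℝ) : Fin 2 → SOp :=
  ![(1 / 2 : ℂ) • (X A B s 0 + I • P A B t 0 + I • X A B s 1 - P A B t 1),
    (1 / 2 : ℂ) • (-(I • X A B s 0) + P A B t 0 - X A B s 1 - I • P A B t 1)]

/-- The pseudo-bosonic operators `b_1, b_2`, on `𝓢(ℝ²)`. -/
def bS (A B s t : ℝ) : Fin 2 → SOp :=
  ![(1 / 2 : ℂ) • (X A B s 0 - I • P A B t 0 - I • X A B s 1 - P A B t 1),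
    (1 / 2 : ℂ) • (I • X A B s 0 + P A B t 0 - X A B s 1 + I • P A B t 1)]

/-- The number-like operators `N_j = b_j a_j`, on `𝓢(ℝ²)`. -/
def N (A B s t : ℝ) (j : Fin 2) : SOp := bS A B s t j * aS A B s t j

/-- `(N_1 + N_2 + 1) + ½ (θ + θ̃) (N_1 - N_2) + (A² + B²)`. -/
def hNumber (A B s t : ℝ) : SOp :=
  (N A B s t 0 + N A B s t 1 + 1) + (((s + t) / 2 : ℝ) : ℂ) • (N A B s t 0 - N A B s t 1)
    + ((A ^ 2 + B ^ 2 : ℝ) : ℂ) • 1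

/-- `a_1, a_2` as operators on `L²(ℝ²)`. -/
def a (A B s t : ℝ) (j : Fin 2) : Hil →ₗ.[ℂ] Hil := toPMap (aS A B s t j)

/-- `b_1, b_2` as operators on `L²(ℝ²)`. -/
def b (A B s t : ℝ) (j : Fin 2) : Hil →ₗ.[ℂ] Hil := toPMap (bS A B s t j)

/-- The constants `k_1, k_2`. -/
def kc (A B s t : ℝ) : Fin 2 → ℂ :=
  ![A * (1 - t / 2) * (I - 1) + B * (s / 2 - 1) * (I + 1),
    A * (1 + t / 2) * (1 - I) + B * (s / 2 + 1) * (I + 1)]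

/-- The constants `α_1, α_2`. -/
def alpha (A B s t : ℝ) : Fin 2 → ℂ :=
  ![(kc A B s t 0 + I * kc A B s t 1) / 2, (kc A B s t 0 - I * kc A B s t 1) / (2 * I)]

/-- The function `exp(-½(x_1² + x_2²) - β_1 x_1 - β_2 x_2)`. -/
def gaussFun (β : Fin 2 → ℂ) (v : Plane) : ℂ :=
  cexp (-(1 / 2) * ((v 0 : ℂ) ^ 2 + (v 1 : ℂ) ^ 2) - β 0 * (v 0 : ℂ) - β 1 * (v 1 : ℂ))

theorem memLp_gaussFun (β : Fin 2 → ℂ) : MemLp (gaussFun β) 2 (volume : Measure Plane) := by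
  have hc : Continuous (gaussFun β) := by unfold gaussFun; fun_prop
  rw [memLp_two_iff_integrable_sq_norm hc.aestronglyMeasurable]
  have h := (GaussianFourier.integrable_cexp_neg_mul_sq_norm_add (b := 1) (by simp) (-2)
    (!₂[(β 0).re, (β 1).re] : Plane)).norm
  refine h.congr (Filter.Eventually.of_forall fun v => ?_)
  simp only [gaussFun, Complex.norm_exp, ← Real.exp_nat_mul]
  congr 1
  have h1 : ‖v‖ ^ 2 = v 0 ^ 2 + v 1 ^ 2 := by
    simp [EuclideanSpace.norm_sq_eq, Fin.sum_univ_two]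
  have h2 : ⟪(!₂[(β 0).re, (β 1).re] : Plane), v⟫_ℝ = v 0 * (β 0).re + v 1 * (β 1).re := by
    simp [PiLp.inner_apply, Fin.sum_univ_two]
  rw [h2]
  norm_cast
  rw [h1]
  simp [-Complex.ofReal_pow]
  ring

/-- The same function as an element of `L²(ℝ²)`. -/
def gauss (β : Fin 2 → ℂ) : Hil := (memLp_gaussFun β).toLp (gaussFun β)

/-- The vacuum `φ_{0,0} = M exp(-½(x_1² + x_2²) - α_1 x_1 - α_2 x_2)`. -/
def phi0 (A B s t : ℝ) (M : ℂ) : Hil := M • gauss (alpha A B s t)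

/-- The vacuum `Ψ_{0,0} = M' exp(-½(x_1² + x_2²) + α_1 x_1 + α_2 x_2)`. -/
def psi0 (A B s t : ℝ) (M' : ℂ) : Hil := M' • gauss (-alpha A B s t)

/-- `φ_{n_1,n_2} = (n_1! n_2!)^{-1/2} b_1^{n_1} b_2^{n_2} φ_{0,0}`. -/
def phi (A B s t : ℝ) (M : ℂ) : ℕ × ℕ → Hil := ladder (b A B s t) (phi0 A B s t M)

/-- `Ψ_{n_1,n_2} = (n_1! n_2!)^{-1/2} (a_1†)^{n_1} (a_2†)^{n_2} Ψ_{0,0}`. -/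
def psi (A B s t : ℝ) (M' : ℂ) : ℕ × ℕ → Hil :=
  ladder (fun j => (a A B s t j).adjoint) (psi0 A B s t M')

/-! ### The bosonic operators `c_g`, `c_d` and the exponent of `T` -/

/-- `c_j = (x_j + i p_j) / √2`, on `𝓢(ℝ²)`. -/
def cS (j : Fin 2) : SOp := ((1 / Real.sqrt 2 : ℝ) : ℂ) • (x j + I • p j)

/-- `c_g = (c_1 + i c_2) / √2` and `c_d = -i (c_1 - i c_2) / √2`, in this order. -/
def cgd : Fin 2 → Hil →ₗ.[ℂ] Hil :=
  ![toPMap (((1 / Real.sqrt 2 : ℝ) : ℂ) • (cS 0 + I • cS 1)),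
    toPMap ((-I * ((1 / Real.sqrt 2 : ℝ) : ℂ)) • (cS 0 - I • cS 1))]

/-- The normalized vacuum `χ_{0,0}` of the two-dimensional harmonic oscillator. -/
def chi0 : Hil := ((1 / Real.sqrt Real.pi : ℝ) : ℂ) • gauss 0

/-- `χ_{n_1,n_2} = (n_1! n_2!)^{-1/2} (c_g†)^{n_1} (c_d†)^{n_2} χ_{0,0}`. -/
def chi : ℕ × ℕ → Hil := ladder (fun j => (cgd j).adjoint) chi0

/-- The exponent `-½ (k_1 c_g† + k_2 c_d† + conj(k_1) c_g + conj(k_2) c_d)`; as the operators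
`c_g`, `c_d` have domain `𝓢(ℝ²)`, so has the sum. -/
def exponent (A B s t : ℝ) : Hil →ₗ.[ℂ] Hil :=
  (-(1 / 2) : ℂ) • (kc A B s t 0 • (cgd 0).adjoint + kc A B s t 1 • (cgd 1).adjoint
    + conj (kc A B s t 0) • cgd 0 + conj (kc A B s t 1) • cgd 1)

end NCPB

end

/-! Everything rests on one fact: the pseudo-bosons are scalar shifts of the bosons `c_g`, `c_d`. In
fact `a_j = c_j + k_j/2` and `b_j = c_j† - conj(k_j)/2` (`aS_eq`, `bS_eq`), so the commutation
relations and the formal adjoints are inherited from the bosonic ones. Let `K` be the closure of the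
exponent. On Schwartz functions it is `-(Re α · x + Im α · p)` (`expS_alpha`). Its commutator with
`c_j†` is the scalar `-conj(k_j)/2`, so conjugation by `exp(τ K)` formally turns `c_j†` into `c_j† -
τ conj(k_j)/2`, which is `b_j` at `τ = 1` and `a_j†` at `τ = -1`.

Formal manipulation of the unbounded operator `exp K` is avoided by means of curves. If `f' = K f`
in `L²`, then in a spectral representation, where `K` is multiplication by `g`, one has `f τ = exp(τ
g) f 0`. Hence `T` maps `f τ` to `f (τ + 1)` (`IsExp.mem_graph_of_hasDerivAt`). Explicit solutions
are Gaussians whose linear exponent moves with `τ`, times a scalar factor (`gaussCurve`), and what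
the transported creation operators make of them (`ladderCurve`). After normalization, the curve
through `χ_n` at time `0` passes through a multiple of `φ_n` at time `1` and of `Ψ_n` at time `-1`.
So `φ_n` and `Ψ_n` are multiples of `T χ_n` and `T⁻¹ χ_n`. Symmetry of `T` and orthonormality of `χ`
give biorthonormality, and Parseval's identity for `χ`, with `T` moved across the inner product,
gives the quasi-basis expansions.

Three analytic facts support this. A quadratic phase followed by the Fourier transform makes `K`
multiplication by a real linear form, and Schwartz functions form a core
(`exists_isMultiplication_expS`, `isMultiplication_closure`). The oscillator states are complete,
because a vector orthogonal to them has, after multiplication by the Gaussian, a vanishing Fourier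
transform (`eq_zero_of_orthogonal_oscSpan`). Finally `T` is unbounded because it stretches Gaussians
centred far out in phase space by arbitrarily large factors (`IsExp.not_bounded`). -/

noncomputable section

namespace NCPB

/-! ### Multiplication operators -/

section Multiplication

variable {X : Type*}

/-- `F ∘ g`, cut off to the set where `|g| ≤ n`. -/
def cut (g : X → ℝ) (n : ℕ) (F : ℝ → ℝ) (x : X) : ℂ :=
  open Classical in if |g x| ≤ n then (F (g x) : ℂ) else 0

theorem exists_bound_cut (g : X → ℝ) (n : ℕ) {F : ℝ → ℝ} (hF : Continuous F) :
    ∃ C, ∀ x, ‖cut g n F x‖ ≤ C := by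
  obtain ⟨C, hC⟩ := (isCompact_Icc (a := -(n : ℝ)) (b := n)).exists_bound_of_continuousOn
    hF.continuousOn
  refine ⟨max C 0, fun x => ?_⟩
  unfold cut
  split_ifs with h
  · rw [norm_real]
    exact (hC _ (abs_le.mp h)).trans (le_max_left _ _)
  · simp

variable [MeasurableSpace X] {μ : Measure X}

theorem memLp_mul_of_bound {m : X → ℂ} (hm : Measurable m) {C : ℝ} (hC : ∀ x, ‖m x‖ ≤ C)
    (f : Lp ℂ 2 μ) : MemLp (fun x => m x * f x) 2 μ := by
  refine (Lp.memLp f).of_le_mul (c := C)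
    (hm.aestronglyMeasurable.mul (Lp.aestronglyMeasurable f)) (Filter.Eventually.of_forall fun x => ?_)
  rw [norm_mul]
  exact mul_le_mul_of_nonneg_right (hC x) (norm_nonneg _)

/-- Multiplication by a bounded measurable function, as a bounded operator on `L²(μ)`. -/
def mulOp (m : X → ℂ) (hm : Measurable m) (C : ℝ) (hC : ∀ x, ‖m x‖ ≤ C) :
    Lp ℂ 2 μ →L[ℂ] Lp ℂ 2 μ :=
  LinearMap.mkContinuous
    { toFun := fun f => (memLp_mul_of_bound hm hC f).toLp _
      map_add' := fun f h => by
        refine Lp.ext ?_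
        filter_upwards [MemLp.coeFn_toLp (memLp_mul_of_bound hm hC (f + h)), Lp.coeFn_add f h,
          Lp.coeFn_add ((memLp_mul_of_bound hm hC f).toLp _)
            ((memLp_mul_of_bound hm hC h).toLp _),
          MemLp.coeFn_toLp (memLp_mul_of_bound hm hC f),
          MemLp.coeFn_toLp (memLp_mul_of_bound hm hC h)] with x h1 h2 h3 h4 h5
        rw [h1, h3, Pi.add_apply, h4, h5, h2, Pi.add_apply, mul_add]
      map_smul' := fun c f => by
        refine Lp.ext ?_
        filter_upwards [MemLp.coeFn_toLp (memLp_mul_of_bound hm hC (c • f)), Lp.coeFn_smul c f,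
          Lp.coeFn_smul c ((memLp_mul_of_bound hm hC f).toLp _),
          MemLp.coeFn_toLp (memLp_mul_of_bound hm hC f)] with x h1 h2 h3 h4
        simp only [RingHom.id_apply]
        rw [h1, h3, Pi.smul_apply, h4, h2, Pi.smul_apply, smul_eq_mul, smul_eq_mul]
        ring } C fun f => by
    refine Lp.norm_le_mul_norm_of_ae_le_mul ?_
    filter_upwards [MemLp.coeFn_toLp (memLp_mul_of_bound hm hC f)] with x h1
    change ‖((memLp_mul_of_bound hm hC f).toLp _ : X → ℂ) x‖ ≤ _
    rw [h1, norm_mul]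
    exact mul_le_mul_of_nonneg_right (hC x) (norm_nonneg _)

theorem coeFn_mulOp {m : X → ℂ} (hm : Measurable m) {C : ℝ} (hC : ∀ x, ‖m x‖ ≤ C)
    (f : Lp ℂ 2 μ) : mulOp m hm C hC f =ᵐ[μ] fun x => m x * f x :=
  MemLp.coeFn_toLp (memLp_mul_of_bound hm hC f)

theorem inner_eq_of_ae {f f' h h' : Lp ℂ 2 μ}
    (H : ∀ᵐ x ∂μ, conj (f x) * h x = conj (f' x) * h' x) :
    ⟪f, h⟫_ℂ = ⟪f', h'⟫_ℂ := by
  rw [L2.inner_def, L2.inner_def]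
  refine integral_congr_ae ?_
  filter_upwards [H] with x hx
  simpa [mul_comm] using hx

theorem measurable_cut {g : X → ℝ} (hg : Measurable g) (n : ℕ) {F : ℝ → ℝ} (hF : Continuous F) :
    Measurable (cut g n F) := by
  classical
  unfold cut
  refine Measurable.ite (measurableSet_le hg.abs measurable_const) ?_ measurable_const
  exact measurable_ofReal.comp (hF.measurable.comp hg)

/-- Multiplication by `cut g n F`. -/
def cutOp {g : X → ℝ} (hg : Measurable g) (n : ℕ) {F : ℝ → ℝ} (hF : Continuous F) :
    Lp ℂ 2 μ →L[ℂ] Lp ℂ 2 μ :=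
  mulOp (cut g n F) (measurable_cut hg n hF) _ (exists_bound_cut g n hF).choose_spec

theorem coeFn_cutOp {g : X → ℝ} (hg : Measurable g) (n : ℕ) {F : ℝ → ℝ} (hF : Continuous F)
    (f : Lp ℂ 2 μ) : cutOp hg n hF f =ᵐ[μ] fun x => cut g n F x * f x :=
  coeFn_mulOp _ _ f

/-- On `|g| ≤ n` the multiplier is bounded, so the derivative exists even in operator norm. For `|h|
n < 1` the estimate `|exp y - 1 - y| ≤ y²` with `y = h g` bounds the remainder by `exp(|τ| n) n²
h²`. -/
theorem hasDerivAt_cutOp_exp {g : X → ℝ} (hg : Measurable g) (n : ℕ) (τ : ℝ) :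
    HasDerivAt
      (fun τ : ℝ => cutOp (μ := μ) hg n (F := fun y => Real.exp (τ * y)) (by fun_prop))
      (cutOp hg n (F := fun y => y * Real.exp (τ * y)) (by fun_prop)) τ := by
  rw [hasDerivAt_iff_isLittleO_nhds_zero]
  refine Asymptotics.IsBigO.trans_isLittleO (g := fun h : ℝ => h ^ 2) ?_ ?_
  · refine Asymptotics.IsBigO.of_bound (Real.exp (|τ| * n) * n ^ 2) ?_
    have : ∀ᶠ h : ℝ in nhds 0, |h| * n < 1 := by
      have hc : Continuous fun h : ℝ => |h| * n := by fun_prop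
      have := hc.tendsto 0
      simp only [abs_zero, zero_mul] at this
      exact this.eventually_lt_const one_pos
    filter_upwards [this] with h hh
    refine ContinuousLinearMap.opNorm_le_bound _ (by positivity) fun f => ?_
    refine Lp.norm_le_mul_norm_of_ae_le_mul ?_
    set A := cutOp (μ := μ) hg n (F := fun y => Real.exp ((τ + h) * y)) (by fun_prop)
    set B := cutOp (μ := μ) hg n (F := fun y => Real.exp (τ * y)) (by fun_prop)
    set D := cutOp (μ := μ) hg n (F := fun y => y * Real.exp (τ * y)) (by fun_prop)
    have e : (A - B - h • D) f = A f - B f - (h : ℂ) • D f := by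
      rw [sub_apply, sub_apply]
      rfl
    rw [e]
    filter_upwards [Lp.coeFn_sub (A f - B f) ((h : ℂ) • D f), Lp.coeFn_sub (A f) (B f),
      Lp.coeFn_smul (h : ℂ) (D f), coeFn_cutOp hg n (F := fun y => Real.exp ((τ + h) * y))
        (by fun_prop) f, coeFn_cutOp hg n (F := fun y => Real.exp (τ * y)) (by fun_prop) f,
      coeFn_cutOp hg n (F := fun y => y * Real.exp (τ * y)) (by fun_prop) f]
      with x h1 h2 h3 h4 h5 h6
    rw [h1, Pi.sub_apply, h2, Pi.sub_apply, h3, Pi.smul_apply, h4, h5, h6]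
    unfold cut
    split_ifs with hx
    · have hsm : |h * g x| ≤ 1 := by
        rw [abs_mul]
        exact (mul_le_mul_of_nonneg_left hx (abs_nonneg _)).trans hh.le
      have key := Real.abs_exp_sub_one_sub_id_le hsm
      have e2 : ((Real.exp ((τ + h) * g x) : ℝ) : ℂ) * f x - ((Real.exp (τ * g x) : ℝ) : ℂ) * f x
          - (h : ℂ) • (((g x * Real.exp (τ * g x) : ℝ) : ℂ) * f x)
          = ((Real.exp (τ * g x) * (Real.exp (h * g x) - 1 - h * g x) : ℝ) : ℂ) * f x := by
        rw [add_mul, Real.exp_add, smul_eq_mul]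
        push_cast
        ring
      rw [e2, norm_mul, norm_real, norm_mul, Real.norm_eq_abs, Real.norm_eq_abs, Real.norm_eq_abs,
        abs_of_pos (Real.exp_pos _)]
      refine mul_le_mul_of_nonneg_right ?_ (norm_nonneg _)
      have a1 : Real.exp (τ * g x) ≤ Real.exp (|τ| * n) := by
        refine Real.exp_le_exp.mpr ((le_abs_self _).trans ?_)
        rw [abs_mul]
        exact mul_le_mul_of_nonneg_left hx (abs_nonneg _)
      have a2 : (h * g x) ^ 2 ≤ n ^ 2 * |h ^ 2| := by
        rw [mul_pow, abs_of_nonneg (sq_nonneg h), mul_comm]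
        refine mul_le_mul_of_nonneg_right ?_ (sq_nonneg h)
        rw [← sq_abs]
        exact pow_le_pow_left₀ (abs_nonneg _) hx 2
      calc _ ≤ Real.exp (|τ| * n) * (n ^ 2 * |h ^ 2|) := by
            exact mul_le_mul a1 (key.trans a2) (abs_nonneg _) (Real.exp_pos _).le
        _ = _ := by ring
    · simp only [zero_mul, smul_zero, sub_zero, norm_zero]
      positivity
  · have := Asymptotics.isLittleO_pow_id (𝕜 := ℝ) (n := 2) (by norm_num)
    simpa using this

end Multiplication

/-! ### Unbounded multiplication operators: self-adjointness and the evolution equation. -/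

section Spectral

variable {H : Type*} [NormedAddCommGroup H] [InnerProductSpace ℂ H]
variable {X : Type*} [MeasurableSpace X] {μ : Measure X} {U : H ≃ₗᵢ[ℂ] Lp ℂ 2 μ} {g : X → ℝ}
  {A : H →ₗ.[ℂ] H}

theorem ae_eq_of_forall_cut {g : X → ℝ} {P : X → Prop}
    (h : ∀ n : ℕ, ∀ᵐ x ∂μ, |g x| ≤ n → P x) : ∀ᵐ x ∂μ, P x := by
  filter_upwards [ae_all_iff.mpr h] with x hx
  obtain ⟨n, hn⟩ := exists_nat_ge |g x|
  exact hx n hn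

theorem exists_isMultiplication (U : H ≃ₗᵢ[ℂ] Lp ℂ 2 μ) (g : X → ℝ) :
    ∃ A : H →ₗ.[ℂ] H, IsMultiplication U g A := by
  let G : Submodule ℂ (H × H) :=
    { carrier := {z | (U z.2 : X → ℂ) =ᵐ[μ] fun x => (g x : ℂ) * (U z.1 : X → ℂ) x}
      zero_mem' := by
        change (U 0 : X → ℂ) =ᵐ[μ] fun x => (g x : ℂ) * (U 0 : X → ℂ) x
        rw [map_zero]
        filter_upwards [Lp.coeFn_zero ℂ 2 μ] with x hx
        rw [hx, Pi.zero_apply, mul_zero]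
      add_mem' := fun {y z} hy hz => by
        change (U (y.2 + z.2) : X → ℂ) =ᵐ[μ] fun x => (g x : ℂ) * (U (y.1 + z.1) : X → ℂ) x
        rw [map_add, map_add]
        filter_upwards [hy, hz, Lp.coeFn_add (U y.1) (U z.1), Lp.coeFn_add (U y.2) (U z.2)]
          with x h1 h2 h3 h4
        rw [h3, h4, Pi.add_apply, Pi.add_apply, h1, h2, mul_add]
      smul_mem' := fun c z hz => by
        change (U (c • z.2) : X → ℂ) =ᵐ[μ] fun x => (g x : ℂ) * (U (c • z.1) : X → ℂ) x
        rw [map_smul, map_smul]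
        filter_upwards [hz, Lp.coeFn_smul c (U z.1), Lp.coeFn_smul c (U z.2)] with x h1 h2 h3
        rw [h2, h3, Pi.smul_apply, Pi.smul_apply, h1, smul_eq_mul, smul_eq_mul]
        ring }
  refine ⟨G.toLinearPMap, fun h k => ?_⟩
  rw [Submodule.toLinearPMap_graph_eq]
  · rfl
  · rintro ⟨h, k⟩ hz h0
    simp only at h0
    subst h0
    change (U k : X → ℂ) =ᵐ[μ] fun x => (g x : ℂ) * (U 0 : X → ℂ) x at hz
    rw [map_zero] at hz
    have : U k = 0 := by
      refine Lp.ext ?_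
      filter_upwards [hz, Lp.coeFn_zero ℂ 2 μ] with x h1 h2
      rw [h1, h2]
      simp
    simpa using this

/-- A solution of `f' = A f` satisfies `f τ = exp(τ A) f 0` in a spectral representation of `A`. -/
theorem IsMultiplication.ae_eq_exp_of_hasDerivAt (hg : Measurable g)
    (hA : IsMultiplication U g A) {f k : ℝ → H} (hf : ∀ τ, HasDerivAt f (k τ) τ)
    (hk : ∀ τ, (f τ, k τ) ∈ A.graph) (τ : ℝ) :
    (U (f τ) : X → ℂ) =ᵐ[μ] fun x => ((Real.exp (τ * g x) : ℝ) : ℂ) * (U (f 0) : X → ℂ) x := by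
  refine ae_eq_of_forall_cut (g := g) fun n => ?_
  let E : ℝ → Lp ℂ 2 μ →L[ℂ] Lp ℂ 2 μ := fun τ =>
    cutOp hg n (F := fun y => Real.exp (τ * y)) (by fun_prop)
  let D : ℝ → Lp ℂ 2 μ →L[ℂ] Lp ℂ 2 μ := fun τ =>
    cutOp hg n (F := fun y => y * Real.exp (τ * y)) (by fun_prop)
  have hE : ∀ τ w, E τ w =ᵐ[μ] fun x => cut g n (fun y => Real.exp (τ * y)) x * w x :=
    fun τ w => coeFn_cutOp hg n _ w
  have hD : ∀ τ w, D τ w =ᵐ[μ] fun x => cut g n (fun y => y * Real.exp (τ * y)) x * w x :=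
    fun τ w => coeFn_cutOp hg n _ w
  -- The integrating factor `exp(-τ g)`, truncated to `|g| ≤ n` so that it is a bounded operator,
  -- makes the solution constant: the two terms of the product rule cancel because `U (k τ) = g · U
  -- (f τ)`.
  have hderiv : ∀ τ, HasDerivAt (fun τ => E (-τ) (U (f τ))) 0 τ := by
    intro τ
    have h1 : HasDerivAt (fun τ => E (-τ)) (-D (-τ)) τ := by
      have := (hasDerivAt_cutOp_exp (μ := μ) hg n (-τ)).scomp τ (hasDerivAt_neg τ)
      rw [neg_smul, one_smul] at this
      exact this
    have h2 : HasDerivAt (fun τ => U (f τ)) (U (k τ)) τ :=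
      ((U.toContinuousLinearEquiv : H →L[ℂ] Lp ℂ 2 μ).restrictScalars ℝ).hasFDerivAt.comp_hasDerivAt
        τ (hf τ)
    have h1' : HasDerivAt (fun τ => (E (-τ)).restrictScalars ℝ) ((-D (-τ)).restrictScalars ℝ) τ :=
      (ContinuousLinearMap.restrictScalarsL ℂ (Lp ℂ 2 μ) (Lp ℂ 2 μ) ℝ ℝ).hasFDerivAt.comp_hasDerivAt
        τ h1
    have h3 := h1'.clm_apply h2
    have e : ((-D (-τ)).restrictScalars ℝ) (U (f τ)) + ((E (-τ)).restrictScalars ℝ) (U (k τ))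
        = 0 := by
      change -(D (-τ)) (U (f τ)) + E (-τ) (U (k τ)) = 0
      rw [neg_add_eq_zero]
      refine Lp.ext ?_
      filter_upwards [hD (-τ) (U (f τ)), hE (-τ) (U (k τ)), (hA _ _).mp (hk τ)] with x a1 a2 a3
      rw [a1, a2, a3]
      unfold cut
      split_ifs
      · push_cast
        ring
      · simp
    rw [e] at h3
    exact h3
  have hconst := is_const_of_deriv_eq_zero (fun τ => (hderiv τ).differentiableAt)
    (fun τ => (hderiv τ).deriv) τ 0
  have e1 := hE (-τ) (U (f τ))
  have e2 := hE (-0) (U (f 0))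
  rw [hconst] at e1
  filter_upwards [e1, e2] with x a1 a2 hx
  rw [a1] at a2
  simp only [cut, hx, if_true, neg_zero, zero_mul, Real.exp_zero, ofReal_one, one_mul] at a2
  rw [← a2, ← mul_assoc, ← ofReal_mul, ← Real.exp_add]
  simp

variable [CompleteSpace H]

/-- The truncation of `U y` to `|g| ≤ n` lies in the transported domain. If `y` is orthogonal to the
domain, the square of the norm of this truncation is its inner product with `U y`, hence zero, for
every `n`. -/
theorem IsMultiplication.dense (hg : Measurable g) (hA : IsMultiplication U g A) :
    Dense (A.domain : Set H) := by
  rw [Submodule.dense_iff_topologicalClosure_eq_top,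
    Submodule.topologicalClosure_eq_top_iff, Submodule.eq_bot_iff]
  intro y hy
  have key : ∀ n : ℕ, cutOp hg n (F := fun _ => 1) continuous_const (U y) = 0 := by
    intro n
    set w := cutOp hg n (F := fun _ => 1) continuous_const (U y) with hw
    have hmem : U.symm w ∈ A.domain := by
      refine LinearPMap.mem_domain_of_mem_graph
        (y := U.symm (cutOp hg n (F := fun y => y) continuous_id (U y))) ((hA _ _).mpr ?_)
      simp only [LinearIsometryEquiv.apply_symm_apply]
      filter_upwards [coeFn_cutOp hg n (F := fun y => y) continuous_id (U y),
        coeFn_cutOp hg n (F := fun _ => 1) continuous_const (U y)] with x h1 h2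
      rw [h1, h2]
      unfold cut
      split_ifs <;> simp
    have h0 := (Submodule.mem_orthogonal _ _).mp hy _ hmem
    rw [← U.inner_map_map, LinearIsometryEquiv.apply_symm_apply] at h0
    have : ⟪w, w⟫_ℂ = ⟪w, U y⟫_ℂ := by
      refine inner_eq_of_ae ?_
      filter_upwards [coeFn_cutOp hg n (F := fun _ => 1) continuous_const (U y)] with x h2
      rw [h2]
      unfold cut
      split_ifs <;> simp
    rw [h0] at this
    exact inner_self_eq_zero.mp this
  have : U y = 0 := by
    refine Lp.ext ?_
    refine ae_eq_of_forall_cut (g := g) fun n => ?_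
    have e := coeFn_cutOp hg n (F := fun _ => 1) continuous_const (U y)
    rw [key n] at e
    filter_upwards [e, Lp.coeFn_zero ℂ 2 μ] with x h1 h2 hx
    rw [h1] at h2
    rw [h1, ← one_mul (U y x)]
    simp [cut, hx]
  simpa using this

theorem IsMultiplication.isSelfAdjoint (hg : Measurable g) (hA : IsMultiplication U g A) :
    IsSelfAdjoint A := by
  rw [LinearPMap.isSelfAdjoint_def]
  refine LinearPMap.eq_of_eq_graph ?_
  rw [LinearPMap.adjoint_graph_eq_graph_adjoint (hA.dense hg)]
  ext ⟨y, z⟩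
  rw [Submodule.mem_adjoint_iff, hA]
  constructor
  · intro h
    refine ae_eq_of_forall_cut (g := g) fun n => ?_
    set E := cutOp (μ := μ) hg n (F := fun _ => 1) continuous_const
    set G := cutOp (μ := μ) hg n (F := fun y => y) continuous_id
    have hE := fun f => coeFn_cutOp (μ := μ) hg n (F := fun _ => 1) continuous_const f
    have hG := fun f => coeFn_cutOp (μ := μ) hg n (F := fun y => y) continuous_id f
    have key : G (U y) = E (U z) := by
      refine ext_inner_left ℂ fun w => ?_
      -- Testing the adjoint relation only on truncated vectors turns it into an identity between
      -- bounded self-adjoint multipliers, from which `U z = g · U y` is read off on each set `|g| ≤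
      -- n`.
      have := h (U.symm (E w)) (U.symm (G w)) ((hA _ _).mpr ?_)
      · rw [sub_eq_zero, ← U.inner_map_map, ← U.inner_map_map (U.symm (E w))] at this
        simp only [LinearIsometryEquiv.apply_symm_apply] at this
        calc ⟪w, G (U y)⟫_ℂ = ⟪G w, U y⟫_ℂ := by
              refine inner_eq_of_ae ?_
              filter_upwards [hG w, hG (U y)] with x h1 h2
              rw [h1, h2]
              unfold cut
              split_ifs
              · simp; ring
              · simp
          _ = ⟪E w, U z⟫_ℂ := this
          _ = ⟪w, E (U z)⟫_ℂ := by
              refine inner_eq_of_ae ?_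
              filter_upwards [hE w, hE (U z)] with x h1 h2
              rw [h1, h2]
              unfold cut
              split_ifs <;> simp
      · simp only [LinearIsometryEquiv.apply_symm_apply]
        filter_upwards [hE w, hG w] with x h1 h2
        rw [h1, h2]
        unfold cut
        split_ifs <;> simp
    have hE' := hE (U z)
    have hG' := hG (U y)
    change (E (U z) : X → ℂ) =ᵐ[μ] _ at hE'
    rw [← key] at hE'
    filter_upwards [hE', hG'] with x h1 h2 hx
    have := h1.symm.trans h2
    simpa [cut, hx] using this
  · intro hyz a c hac
    rw [hA] at hac
    rw [sub_eq_zero, ← U.inner_map_map, ← U.inner_map_map a]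
    refine inner_eq_of_ae ?_
    filter_upwards [hyz, hac] with x h1 h2
    rw [h1, h2]
    simp
    ring

end Spectral

/-! ### The position and momentum operators -/

theorem hasTemperateGrowth_coord (j : Fin 2) :
    Function.HasTemperateGrowth fun v : Plane => ((v j : ℝ) : ℂ) :=
  (ofRealCLM.comp (EuclideanSpace.proj j : Plane →L[ℝ] ℝ)).hasTemperateGrowth

theorem x_apply (j : Fin 2) (f : 𝓢(Plane, ℂ)) (v : Plane) : x j f v = (v j : ℂ) * f v := by
  rw [x, SchwartzMap.smulLeftCLM_apply_apply (hasTemperateGrowth_coord j), smul_eq_mul]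

theorem p_apply (j : Fin 2) (f : 𝓢(Plane, ℂ)) (v : Plane) :
    p j f v = -I * fderiv ℝ f v (EuclideanSpace.single j 1) := by
  simp only [p, smul_apply, LineDeriv.lineDerivOpCLM_apply,
    SchwartzMap.lineDerivOp_apply_eq_fderiv, smul_eq_mul]

theorem x_mul_comm (j k : Fin 2) : x j * x k = x k * x j := by
  ext f v
  simp only [mul_apply_eq_comp, x_apply]
  ring

theorem p_mul_comm (j k : Fin 2) : p j * p k = p k * p j := by
  ext f v
  have h2 : ContDiff ℝ 2 f := f.smooth 2
  have hd : DifferentiableAt ℝ (fderiv ℝ f) v :=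
    (h2.fderiv_right (m := 1) (by norm_num)).differentiable (by norm_num) v
  have key : ∀ j k, p j (p k f) v
      = -fderiv ℝ (fderiv ℝ f) v (EuclideanSpace.single j 1) (EuclideanSpace.single k 1) := by
    intro j k
    rw [p_apply]
    have e : (p k f : Plane → ℂ) = fun w => -I * fderiv ℝ f w (EuclideanSpace.single k 1) :=
      funext fun w => p_apply k f w
    have h : HasFDerivAt (fun w => -I * fderiv ℝ f w (EuclideanSpace.single k 1))
        (-I • ((ContinuousLinearMap.apply ℝ ℂ (EuclideanSpace.single k (1 : ℝ) : Plane)).comp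
          (fderiv ℝ (fderiv ℝ f) v))) v :=
      (((ContinuousLinearMap.apply ℝ ℂ
        (EuclideanSpace.single k (1 : ℝ) : Plane)).hasFDerivAt.comp v hd.hasFDerivAt).const_mul _)
    rw [e, h.fderiv]
    simp only [smul_apply, ContinuousLinearMap.comp_apply,
      ContinuousLinearMap.apply_apply, smul_eq_mul]
    rw [← mul_assoc]
    simp
  have hs : IsSymmSndFDerivAt ℝ f v := h2.contDiffAt.isSymmSndFDerivAt (by simp)
  rw [mul_apply_eq_comp, mul_apply_eq_comp, key, key, hs.eq]

theorem p_mul_x (j k : Fin 2) : p j * x k = x k * p j - (if j = k then I else 0) • 1 := by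
  ext f v
  have e : (x k f : Plane → ℂ) = fun w => ((w k : ℝ) : ℂ) * f w := funext fun w => x_apply k f w
  have h1 : HasFDerivAt (fun w : Plane => ((w k : ℝ) : ℂ))
      (ofRealCLM.comp (EuclideanSpace.proj k : Plane →L[ℝ] ℝ)) v :=
    (ofRealCLM.comp (EuclideanSpace.proj k : Plane →L[ℝ] ℝ)).hasFDerivAt
  have h := h1.mul (f.hasFDerivAt v)
  simp only [mul_apply_eq_comp, sub_apply, smul_apply,
    one_apply_eq_self, x_apply, p_apply]
  rw [e]
  erw [h.fderiv]
  by_cases hjk : j = k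
  · subst hjk
    simp
    ring
  · simp [hjk, Ne.symm hjk]
    ring

/-! ### The inclusion of Schwartz functions in `L²` -/

theorem coeFn_incl (f : 𝓢(Plane, ℂ)) : incl f =ᵐ[volume] f := SchwartzMap.coeFn_toLp f 2 volume

theorem inner_incl (f g : 𝓢(Plane, ℂ)) :
    ⟪incl f, incl g⟫_ℂ = ∫ v, conj (f v) * g v := by
  refine (SchwartzMap.inner_toL2_toL2_eq f g).trans ?_
  simp [mul_comm]

theorem incl_mem (f : 𝓢(Plane, ℂ)) : incl f ∈ schwartzD := LinearMap.mem_range_self _ _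

theorem dense_schwartzD : Dense (schwartzD : Set Hil) := by
  have := SchwartzMap.denseRange_toLpCLM (E := Plane) (F := ℂ) (p := 2) (μ := volume)
    (by simp)
  simpa [DenseRange, schwartzD, incl] using! this

/-- `A'` is a formal adjoint of `A` on Schwartz functions. -/
def FormalAdj (A A' : SOp) : Prop :=
  ∀ f g : 𝓢(Plane, ℂ), ⟪incl (A f), incl g⟫_ℂ = ⟪incl f, incl (A' g)⟫_ℂ

theorem FormalAdj.symm {A A' : SOp} (h : FormalAdj A A') : FormalAdj A' A := fun f g => by
  rw [← inner_conj_symm, ← h, inner_conj_symm]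

theorem FormalAdj.add {A A' B B' : SOp} (h : FormalAdj A A') (h' : FormalAdj B B') :
    FormalAdj (A + B) (A' + B') := fun f g => by
  simp only [add_apply, map_add, inner_add_left, inner_add_right, h f g, h' f g]

theorem FormalAdj.sub {A A' B B' : SOp} (h : FormalAdj A A') (h' : FormalAdj B B') :
    FormalAdj (A - B) (A' - B') := fun f g => by
  simp only [sub_apply, map_sub, inner_sub_left, inner_sub_right, h f g, h' f g]

theorem FormalAdj.smul {A A' : SOp} (c : ℂ) (h : FormalAdj A A') :
    FormalAdj (c • A) (conj c • A') := fun f g => by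
  simp only [smul_apply, map_smul, inner_smul_left, inner_smul_right, h f g]

theorem formalAdj_one : FormalAdj 1 1 := fun _ _ => rfl

theorem formalAdj_x (j : Fin 2) : FormalAdj (x j) (x j) := fun f g => by
  rw [inner_incl, inner_incl]
  refine integral_congr_ae (Filter.Eventually.of_forall fun v => ?_)
  simp only [x_apply, map_mul, conj_ofReal]
  ring

open scoped LineDeriv in
theorem formalAdj_p (j : Fin 2) : FormalAdj (p j) (p j) := fun f g => by
  rw [inner_incl, inner_incl]
  have h := SchwartzMap.integral_bilinear_lineDerivOp_right_eq_neg_left (μ := volume) f g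
    ((ContinuousLinearMap.mul ℝ ℂ).comp (conjCLE : ℂ →L[ℝ] ℂ)) (EuclideanSpace.single j (1 : ℝ))
  simp only [ContinuousLinearMap.comp_apply, ContinuousLinearMap.mul_apply',
    SchwartzMap.lineDerivOp_apply_eq_fderiv, ContinuousLinearEquiv.coe_coe, conjCLE_apply] at h
  simp only [p_apply, map_mul, map_neg, conj_I, neg_neg]
  calc _ = I * ∫ v, conj (fderiv ℝ f v (EuclideanSpace.single j 1)) * g v := by
        rw [← integral_const_mul]
        refine integral_congr_ae (Filter.Eventually.of_forall fun v => ?_)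
        simp only
        ring
    _ = -I * ∫ v, conj (f v) * fderiv ℝ g v (EuclideanSpace.single j 1) := by
        rw [h]
        ring
    _ = _ := by
        rw [← integral_const_mul]
        refine integral_congr_ae (Filter.Eventually.of_forall fun v => ?_)
        simp only
        ring

theorem toPMap_domain (A : SOp) : (toPMap A).domain = schwartzD := rfl

theorem toPMap_apply (A : SOp) (f : 𝓢(Plane, ℂ)) (h : incl f ∈ (toPMap A).domain) :
    toPMap A ⟨incl f, h⟩ = incl (A f) := by
  change incl (A ((LinearEquiv.ofInjective incl incl_injective).symm ⟨incl f, h⟩)) = _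
  congr 2
  rw [LinearEquiv.symm_apply_eq]
  rfl

theorem ev_of_mem_graph {H : Type*} [NormedAddCommGroup H] [InnerProductSpace ℂ H]
    {A : H →ₗ.[ℂ] H} {f g : H} (h : (f, g) ∈ A.graph) : ev A f = g := by
  have hd : f ∈ A.domain := LinearPMap.mem_domain_of_mem_graph h
  rw [ev, dif_pos hd]
  exact A.mem_graph_snd_inj (A.mem_graph ⟨f, hd⟩) h rfl

theorem mem_graph_toPMap (A : SOp) (f : 𝓢(Plane, ℂ)) :
    (incl f, incl (A f)) ∈ (toPMap A).graph := by
  rw [← toPMap_apply A f (incl_mem f)]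
  exact (toPMap A).mem_graph ⟨incl f, incl_mem f⟩

theorem ev_toPMap (A : SOp) (f : 𝓢(Plane, ℂ)) : ev (toPMap A) (incl f) = incl (A f) :=
  ev_of_mem_graph (mem_graph_toPMap A f)

theorem FormalAdj.mem_graph_adjoint {A A' : SOp} (h : FormalAdj A A') (f : 𝓢(Plane, ℂ)) :
    (incl f, incl (A' f)) ∈ (toPMap A).adjoint.graph := by
  rw [LinearPMap.adjoint_graph_eq_graph_adjoint (by exact dense_schwartzD),
    Submodule.mem_adjoint_iff]
  intro c d hcd
  obtain ⟨g, rfl⟩ : c ∈ schwartzD := LinearPMap.mem_domain_of_mem_graph hcd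
  obtain rfl : d = incl (A g) :=
    (toPMap A).mem_graph_snd_inj hcd (mem_graph_toPMap A g) rfl
  rw [sub_eq_zero]
  exact h g f

theorem FormalAdj.ev_adjoint {A A' : SOp} (h : FormalAdj A A') (f : 𝓢(Plane, ℂ)) :
    ev (toPMap A).adjoint (incl f) = incl (A' f) :=
  ev_of_mem_graph (h.mem_graph_adjoint f)

theorem FormalAdj.stable_adjoint {A A' : SOp} (h : FormalAdj A A') :
    Stable (toPMap A).adjoint schwartzD := by
  refine ⟨?_, ?_⟩
  · rintro _ ⟨f, rfl⟩
    exact LinearPMap.mem_domain_of_mem_graph (h.mem_graph_adjoint f)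
  · rintro _ ⟨f, rfl⟩
    rw [h.ev_adjoint]
    exact incl_mem _

/-! ### Gaussians are Schwartz functions -/

theorem norm_iteratedFDeriv_cexp (i : ℕ) (z : ℂ) :
    ‖iteratedFDeriv ℝ i cexp z‖ = ‖cexp z‖ := by
  have h : ContDiffAt ℂ (i : WithTop ℕ∞) cexp z := contDiff_exp.contDiffAt
  have e := h.restrictScalars_iteratedFDeriv (𝕜 := ℝ)
  rw [← e]
  simp only [Function.comp_apply]
  have : ‖(iteratedFDeriv ℂ i cexp z).restrictScalars ℝ‖ = ‖iteratedFDeriv ℂ i cexp z‖ := rfl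
  rw [this, norm_iteratedFDeriv_eq_norm_iteratedDeriv]
  have := iteratedDeriv_cexp_const_mul i 1
  simp only [one_mul, one_pow] at this
  rw [this]

/-- By the Faà di Bruno estimate, a derivative of `exp ∘ q` costs only a polynomial factor in front
of `|exp q|`. This serves both for Gaussians, where the exponential decays, and for phases, where it
has modulus one. -/
theorem exists_norm_iteratedFDeriv_cexp_comp_le {q : Plane → ℂ}
    (hq : Function.HasTemperateGrowth q) (n : ℕ) :
    ∃ (k : ℕ) (C : ℝ), 0 ≤ C ∧ ∀ v, ‖iteratedFDeriv ℝ n (fun v => cexp (q v)) v‖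
      ≤ C * (1 + ‖v‖) ^ k * ‖cexp (q v)‖ := by
  obtain ⟨k, C, hC, h⟩ := hq.norm_iteratedFDeriv_le_uniform n
  refine ⟨k * n, n.factorial * (1 + C) ^ n, by positivity, fun v => ?_⟩
  -- With `1 + C` in place of `C` the base `D` is at least `1`, so that `D ≤ D ^ i` for every `i ≥
  -- 1`.
  have := norm_iteratedFDeriv_comp_le (𝕜 := ℝ) (g := cexp) (f := q) (n := n) (N := n)
    ((contDiff_exp (𝕜 := ℂ)).restrict_scalars ℝ) (hq.1.of_le (by exact_mod_cast le_top)) le_rfl v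
    (C := ‖cexp (q v)‖) (D := (1 + C) * (1 + ‖v‖) ^ k)
    (fun i _ => (norm_iteratedFDeriv_cexp i _).le) (fun i hi hi' => ?_)
  · calc _ ≤ _ := this
      _ = _ := by
        rw [mul_pow, ← pow_mul]
        ring
  · calc _ ≤ C * (1 + ‖v‖) ^ k := h i hi' v
      _ ≤ (1 + C) * (1 + ‖v‖) ^ k := by gcongr; simp
      _ ≤ _ := by
        apply le_self_pow₀ (one_le_mul_of_one_le_of_one_le (by simp [hC]) (by simp [one_le_pow₀]))
        omega

theorem hasTemperateGrowth_cexp_mul_I {S : Plane → ℝ} (hS : Function.HasTemperateGrowth S) :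
    Function.HasTemperateGrowth fun v => cexp (S v * I) := by
  have hq : Function.HasTemperateGrowth fun v => (S v : ℂ) * I :=
    (Function.Complex.hasTemperateGrowth_ofReal.comp hS).mul (Function.HasTemperateGrowth.const I)
  refine ⟨((contDiff_exp (𝕜 := ℂ)).restrict_scalars ℝ).comp hq.1, fun n => ?_⟩
  obtain ⟨k, C, -, h⟩ := exists_norm_iteratedFDeriv_cexp_comp_le hq n
  refine ⟨k, C, fun v => ?_⟩
  simpa [norm_exp_ofReal_mul_I] using h v

theorem exists_one_add_pow_mul_exp_le (k : ℕ) (c : ℝ) : ∃ C : ℝ, 0 ≤ C ∧ ∀ r : ℝ, 0 ≤ r →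
    (1 + r) ^ k * Real.exp (c * r - r ^ 2 / 2) ≤ C * Real.exp (-(r ^ 2 / 4)) := by
  -- Since `(1 + r) ^ k ≤ exp(k r)`, completing the square in `(k + c) r - r² / 4` gives this
  -- constant.
  refine ⟨Real.exp ((k + c) ^ 2), (Real.exp_pos _).le, fun r hr => ?_⟩
  have h1 : (1 + r) ^ k ≤ Real.exp (k * r) := by
    rw [Real.exp_nat_mul, add_comm]
    exact pow_le_pow_left₀ (by positivity) (Real.add_one_le_exp r) k
  calc _ ≤ Real.exp (k * r) * Real.exp (c * r - r ^ 2 / 2) := by gcongr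
    _ = Real.exp (k * r + (c * r - r ^ 2 / 2)) := (Real.exp_add _ _).symm
    _ ≤ Real.exp ((k + c) ^ 2 + -(r ^ 2 / 4)) :=
        Real.exp_le_exp.mpr (by nlinarith [sq_nonneg (r / 2 - (k + c))])
    _ = _ := Real.exp_add _ _

/-- A bound for the real part of the linear form `β · v`. -/
def linBound (β : Fin 2 → ℂ) : ℝ := ‖β 0‖ + ‖β 1‖

theorem norm_lin_le (β : Fin 2 → ℂ) (v : Plane) :
    ‖β 0 * (v 0 : ℂ) + β 1 * (v 1 : ℂ)‖ ≤ linBound β * ‖v‖ := by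
  have h0 := EuclideanSpace.norm_eq v
  have h : ∀ j, ‖v j‖ ≤ ‖v‖ := fun j => PiLp.norm_apply_le v j
  calc _ ≤ ‖β 0‖ * ‖v 0‖ + ‖β 1‖ * ‖v 1‖ := by
        refine (norm_add_le _ _).trans ?_
        simp
    _ ≤ ‖β 0‖ * ‖v‖ + ‖β 1‖ * ‖v‖ := by gcongr <;> exact h _
    _ = _ := by rw [linBound]; ring

theorem norm_sq_plane (v : Plane) : ‖v‖ ^ 2 = v 0 ^ 2 + v 1 ^ 2 := by
  simp [EuclideanSpace.norm_sq_eq, Fin.sum_univ_two]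

theorem norm_gaussFun_le (β : Fin 2 → ℂ) (v : Plane) :
    ‖gaussFun β v‖ ≤ Real.exp (linBound β * ‖v‖ - ‖v‖ ^ 2 / 2) := by
  rw [gaussFun, norm_exp]
  refine Real.exp_le_exp.mpr ?_
  have h := (abs_re_le_norm _).trans (norm_lin_le β v)
  have h' := (abs_le.mp h).1
  have e : (-(1 / 2) * ((v 0 : ℂ) ^ 2 + (v 1 : ℂ) ^ 2) - β 0 * (v 0 : ℂ) - β 1 * (v 1 : ℂ)).re
      = -(‖v‖ ^ 2 / 2) - (β 0 * (v 0 : ℂ) + β 1 * (v 1 : ℂ)).re := by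
    rw [norm_sq_plane]
    have : -(1 / 2) * ((v 0 : ℂ) ^ 2 + (v 1 : ℂ) ^ 2) - β 0 * (v 0 : ℂ) - β 1 * (v 1 : ℂ)
      = ((-((v 0 ^ 2 + v 1 ^ 2) / 2) : ℝ) : ℂ) - (β 0 * (v 0 : ℂ) + β 1 * (v 1 : ℂ)) := by
      push_cast; ring
    rw [this, sub_re, ofReal_re]
  rw [e]
  linarith

theorem hasTemperateGrowth_gaussExponent (β : Fin 2 → ℂ) : Function.HasTemperateGrowth
    fun v : Plane =>
      -(1 / 2) * ((v 0 : ℂ) ^ 2 + (v 1 : ℂ) ^ 2) - β 0 * (v 0 : ℂ) - β 1 * (v 1 : ℂ) := by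
  have h := hasTemperateGrowth_coord
  exact (((Function.HasTemperateGrowth.const _).mul (((h 0).pow 2).add ((h 1).pow 2))).sub
    ((Function.HasTemperateGrowth.const _).mul (h 0))).sub
    ((Function.HasTemperateGrowth.const _).mul (h 1))

/-- The Gaussian `gaussFun β` as a Schwartz function. -/
def gS (β : Fin 2 → ℂ) : 𝓢(Plane, ℂ) where
  toFun := gaussFun β
  smooth' := ((contDiff_exp (𝕜 := ℂ)).restrict_scalars ℝ).comp (hasTemperateGrowth_gaussExponent β).1
  decay' k n := by
    obtain ⟨m, C, hC, h⟩ :=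
      exists_norm_iteratedFDeriv_cexp_comp_le (hasTemperateGrowth_gaussExponent β) n
    obtain ⟨C', hC', h'⟩ := exists_one_add_pow_mul_exp_le (k + m) (linBound β)
    refine ⟨C * C', fun v => ?_⟩
    have hk : ‖v‖ ^ k ≤ (1 + ‖v‖) ^ k := pow_le_pow_left₀ (norm_nonneg _) (by linarith) k
    calc ‖v‖ ^ k * ‖iteratedFDeriv ℝ n (gaussFun β) v‖
        ≤ (1 + ‖v‖) ^ k * (C * (1 + ‖v‖) ^ m * ‖gaussFun β v‖) := by
          gcongr
          exact h v
      _ ≤ (1 + ‖v‖) ^ k * (C * (1 + ‖v‖) ^ m * Real.exp (linBound β * ‖v‖ - ‖v‖ ^ 2 / 2)) := by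
          gcongr
          exact norm_gaussFun_le β v
      _ = C * ((1 + ‖v‖) ^ (k + m) * Real.exp (linBound β * ‖v‖ - ‖v‖ ^ 2 / 2)) := by
          rw [pow_add]; ring
      _ ≤ C * (C' * Real.exp (-(‖v‖ ^ 2 / 4))) :=
          mul_le_mul_of_nonneg_left (h' ‖v‖ (norm_nonneg v)) hC
      _ ≤ C * (C' * 1) := by
          gcongr
          exact Real.exp_le_one_iff.mpr (by nlinarith [sq_nonneg ‖v‖])
      _ = _ := by ring

theorem gS_apply (β : Fin 2 → ℂ) (v : Plane) : gS β v = gaussFun β v := rfl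

theorem incl_gS (β : Fin 2 → ℂ) : incl (gS β) = gauss β := by
  refine Lp.ext ?_
  filter_upwards [coeFn_incl (gS β), (memLp_gaussFun β).coeFn_toLp] with v h1 h2
  rw [h1, gauss, h2, gS_apply]

/-- On Gaussians the momentum acts as multiplication by an affine function. This is what later
allows derivatives of Gaussian curves to be handled by multiplication operators alone. -/
theorem p_gS (j : Fin 2) (β : Fin 2 → ℂ) : p j (gS β) = I • (x j (gS β) + β j • gS β) := by
  ext v
  have hc : ∀ k, HasFDerivAt (fun w : Plane => ((w k : ℝ) : ℂ))
      (ofRealCLM.comp (EuclideanSpace.proj k : Plane →L[ℝ] ℝ)) v := fun k =>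
    (ofRealCLM.comp (EuclideanSpace.proj k : Plane →L[ℝ] ℝ)).hasFDerivAt
  have h := (((((hc 0).pow 2).add ((hc 1).pow 2)).const_mul (-(1 / 2))).sub
    ((hc 0).const_mul (β 0))).sub ((hc 1).const_mul (β 1))
  have h' := h.cexp
  rw [p_apply]
  have e : (gS β : Plane → ℂ) = fun v : Plane => cexp
      (-(1 / 2) * ((v 0 : ℂ) ^ 2 + (v 1 : ℂ) ^ 2) - β 0 * (v 0 : ℂ) - β 1 * (v 1 : ℂ)) := rfl
  have h'' := h'.fderiv
  simp only [smul_apply, add_apply, x_apply]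
  rw [e]
  erw [h'']
  fin_cases j
  · simp
    ring
  · simp
    ring

/-! ### The model up to quadratic terms -/

theorem p_mul_x_self (j : Fin 2) : p j * x j = x j * p j - I • 1 := by simp [p_mul_x]

theorem p_mul_x_of_ne {j k : Fin 2} (h : j ≠ k) : p j * x k = x k * p j := by simp [p_mul_x, h]

theorem eqModQuadratic_monomial {i : ℕ × ℕ} (hi : 2 ≤ i.1 + i.2) (r : SOp) :
    EqModQuadratic (fun s t => ((s ^ i.1 * t ^ i.2 : ℝ) : ℂ) • r) 0 := by
  refine ⟨Finsupp.single i r, fun j hj => ?_, fun s t => ?_⟩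
  · obtain rfl := Finset.mem_singleton.mp (Finsupp.support_single_subset hj)
    exact hi
  · rw [Finsupp.sum_single_index (by simp)]
    simp

theorem EqModQuadratic.add {F G F' G' : ℝ → ℝ → SOp} (h : EqModQuadratic F G)
    (h' : EqModQuadratic F' G') : EqModQuadratic (F + F') (G + G') := by
  classical
  obtain ⟨R, hR, e⟩ := h
  obtain ⟨R', hR', e'⟩ := h'
  refine ⟨R + R', fun j hj => ?_, fun s t => ?_⟩
  · rcases Finset.mem_union.mp (Finsupp.support_add hj) with h | h
    exacts [hR j h, hR' j h]
  · rw [Finsupp.sum_add_index' (by simp) (by simp), ← e, ← e']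
    simp only [Pi.add_apply]
    abel

theorem eqModQuadratic_of_terms {F G : ℝ → ℝ → SOp} (r₁ r₂ r₃ : SOp)
    (h : ∀ s t : ℝ, F s t - G s t = ((s ^ 2 : ℝ) : ℂ) • r₁ + ((s * t : ℝ) : ℂ) • r₂
      + ((t ^ 2 : ℝ) : ℂ) • r₃) : EqModQuadratic F G := by
  obtain ⟨R, hR, e⟩ := ((eqModQuadratic_monomial (i := (2, 0)) (by norm_num) r₁).add
    (eqModQuadratic_monomial (i := (1, 1)) (by norm_num) r₂)).add
    (eqModQuadratic_monomial (i := (0, 2)) (by norm_num) r₃)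
  refine ⟨R, hR, fun s t => ?_⟩
  rw [h, ← e]
  simp

theorem eqModQuadratic_comm_xHat_pHat (j k : Fin 2) : EqModQuadratic
    (fun s t => xHat s j * pHat t k - pHat t k * xHat s j)
    (fun _ _ => if j = k then I • 1 else 0) := by
  -- The only correction to the canonical relation comes from the product of the two deformation
  -- terms, namely `i θ θ̃ / 4` on the diagonal.
  refine eqModQuadratic_of_terms 0 (if j = k then (I / 4) • 1 else 0) 0 fun s t => ?_
  fin_cases j <;> fin_cases k <;>
  · simp only [Fin.zero_eta, Fin.mk_one, xHat, pHat, Matrix.cons_val_zero, Matrix.cons_val_one, mul_add,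
      add_mul, mul_sub, sub_mul, smul_mul_assoc, mul_smul_comm, p_mul_x_self,
      p_mul_x_of_ne (zero_ne_one : (0 : Fin 2) ≠ 1), p_mul_x_of_ne (one_ne_zero : (1 : Fin 2) ≠ 0),
      x_mul_comm 1 0, p_mul_comm 1 0, if_true, zero_ne_one, one_ne_zero, if_false]
    match_scalars <;> ring

theorem eqModQuadratic_comm_xHat (j k : Fin 2) : EqModQuadratic
    (fun s _ => xHat s j * xHat s k - xHat s k * xHat s j)
    (fun s _ => (I * (s : ℂ) * eps j k) • 1) := by
  refine eqModQuadratic_of_terms 0 0 0 fun s t => ?_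
  fin_cases j <;> fin_cases k <;>
  · simp only [Fin.zero_eta, Fin.mk_one, xHat, eps, Matrix.cons_val_zero, Matrix.cons_val_one, mul_add,
      add_mul, mul_sub, sub_mul, smul_mul_assoc, mul_smul_comm, p_mul_x_self,
      p_mul_x_of_ne (zero_ne_one : (0 : Fin 2) ≠ 1), p_mul_x_of_ne (one_ne_zero : (1 : Fin 2) ≠ 0),
      x_mul_comm 1 0, p_mul_comm 1 0]
    match_scalars <;> ring

theorem eqModQuadratic_comm_pHat (j k : Fin 2) : EqModQuadratic
    (fun _ t => pHat t j * pHat t k - pHat t k * pHat t j)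
    (fun _ t => (I * (t : ℂ) * eps j k) • 1) := by
  refine eqModQuadratic_of_terms 0 0 0 fun s t => ?_
  fin_cases j <;> fin_cases k <;>
  · simp only [Fin.zero_eta, Fin.mk_one, pHat, eps, Matrix.cons_val_zero, Matrix.cons_val_one, mul_add,
      add_mul, mul_sub, sub_mul, smul_mul_assoc, mul_smul_comm, p_mul_x_self,
      p_mul_x_of_ne (zero_ne_one : (0 : Fin 2) ≠ 1), p_mul_x_of_ne (one_ne_zero : (1 : Fin 2) ≠ 0),
      x_mul_comm 1 0, p_mul_comm 1 0]
    match_scalars <;> ring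

theorem eqModQuadratic_hHat_hTrunc (A B : ℝ) : EqModQuadratic (hHat A B) (hTrunc A B) := by
  refine eqModQuadratic_of_terms ((1 / 8 : ℂ) • (p 0 * p 0 + p 1 * p 1)) 0
    ((1 / 8 : ℂ) • (x 0 * x 0 + x 1 * x 1)) fun s t => ?_
  simp only [hHat, hTrunc, xHat, pHat, Matrix.cons_val_zero, Matrix.cons_val_one, pow_two, mul_add,
    add_mul, mul_sub, sub_mul, smul_mul_assoc, mul_smul_comm,
    p_mul_x_of_ne (zero_ne_one : (0 : Fin 2) ≠ 1), p_mul_x_of_ne (one_ne_zero : (1 : Fin 2) ≠ 0)]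
  match_scalars <;> simp <;> ring

theorem eqModQuadratic_hHat_hNumber (A B : ℝ) : EqModQuadratic (hHat A B) (hNumber A B) := by
  -- Besides the squares of the deformation terms, the remainders contain what `N_j` produces
  -- through the dependence of `A_j`, `B_j` on `θ`, `θ̃`: quadratic scalars, and first-order terms
  -- multiplied by `(θ + θ̃) / 2`.
  refine eqModQuadratic_of_terms
    ((1 / 8 : ℂ) • (p 0 * p 0 + p 1 * p 1) - (B ^ 2 / 4 : ℂ) • 1 + (I * B / 4) • (p 0 + p 1))
    (-((A ^ 2 + B ^ 2) / 2 : ℂ) • 1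
      + (I / 4) • ((A : ℂ) • (x 0 + x 1) + (B : ℂ) • (p 0 + p 1)))
    ((1 / 8 : ℂ) • (x 0 * x 0 + x 1 * x 1) - (A ^ 2 / 4 : ℂ) • 1 + (I * A / 4) • (x 0 + x 1))
    fun s t => ?_
  simp only [hHat, hNumber, N, aS, bS, X, P, xHat, pHat, Matrix.cons_val_zero, Matrix.cons_val_one,
    pow_two, mul_add, add_mul, mul_sub, sub_mul, smul_add, smul_sub, smul_neg, mul_neg,
    smul_mul_assoc, mul_smul_comm, mul_one, one_mul, p_mul_x_self,
    p_mul_x_of_ne (zero_ne_one : (0 : Fin 2) ≠ 1), p_mul_x_of_ne (one_ne_zero : (1 : Fin 2) ≠ 0),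
    x_mul_comm 1 0, p_mul_comm 1 0]
  match_scalars <;> ring_nf <;> simp only [I_sq, I_pow_three, I_pow_four] <;> ring

/-! ### Ladder operators on Schwartz functions -/

/-- `A` extends the operator `S` on Schwartz functions. -/
def Acts (A : Hil →ₗ.[ℂ] Hil) (S : SOp) : Prop :=
  ∀ f : 𝓢(Plane, ℂ), (incl f, incl (S f)) ∈ A.graph

theorem Acts.ev_incl {A : Hil →ₗ.[ℂ] Hil} {S : SOp} (h : Acts A S) (f : 𝓢(Plane, ℂ)) :
    ev A (incl f) = incl (S f) := ev_of_mem_graph (h f)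

theorem Acts.stable {A : Hil →ₗ.[ℂ] Hil} {S : SOp} (h : Acts A S) : Stable A schwartzD := by
  refine ⟨?_, ?_⟩
  · rintro _ ⟨f, rfl⟩
    exact LinearPMap.mem_domain_of_mem_graph (h f)
  · rintro _ ⟨f, rfl⟩
    rw [h.ev_incl]
    exact incl_mem _

theorem acts_toPMap (S : SOp) : Acts (toPMap S) S := mem_graph_toPMap S

theorem FormalAdj.acts_adjoint {S S' : SOp} (h : FormalAdj S S') :
    Acts (toPMap S).adjoint S' := h.mem_graph_adjoint

/-- The double adjoint extends the operator. Since `c_g†` and `c_d†` are themselves taken as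
adjoints of partial maps, stability under their adjoints needs this. -/
theorem FormalAdj.acts_adjoint_adjoint {S S' : SOp} (h : FormalAdj S S') :
    Acts (toPMap S).adjoint.adjoint S := fun f => by
  have hd : Dense ((toPMap S).adjoint.domain : Set Hil) :=
    dense_schwartzD.mono h.acts_adjoint.stable.1
  rw [LinearPMap.adjoint_graph_eq_graph_adjoint hd, Submodule.mem_adjoint_iff]
  intro c d hcd
  rw [LinearPMap.adjoint_graph_eq_graph_adjoint (by exact dense_schwartzD),
    Submodule.mem_adjoint_iff] at hcd
  have h1 := congrArg conj (hcd _ _ (mem_graph_toPMap S f))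
  simp only [map_sub, inner_conj_symm, map_zero] at h1
  rw [sub_eq_zero] at h1 ⊢
  exact h1.symm

theorem isPseudoBosonic_of_acts {a b : Fin 2 → Hil →ₗ.[ℂ] Hil} {sa sb sa' sb' : Fin 2 → SOp}
    (ha : ∀ j, Acts (a j) (sa j)) (hb : ∀ j, Acts (b j) (sb j))
    (ha' : ∀ j, Acts (a j).adjoint (sa' j)) (hb' : ∀ j, Acts (b j).adjoint (sb' j))
    (hab : ∀ j k, sa j * sb k - sb k * sa j = if j = k then 1 else 0)
    (haa : ∀ j k, sa j * sa k = sa k * sa j) (hbb : ∀ j k, sb j * sb k = sb k * sb j) :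
    IsPseudoBosonic schwartzD a b where
  dense := dense_schwartzD
  stable_a j := (ha j).stable
  stable_b j := (hb j).stable
  stable_a_adjoint j := (ha' j).stable
  stable_b_adjoint j := (hb' j).stable
  comm_ab j k := by
    rintro _ ⟨f, rfl⟩
    rw [(ha j).ev_incl, (hb k).ev_incl, (ha j).ev_incl, (hb k).ev_incl, ← map_sub]
    have : sa j (sb k f) - sb k (sa j f) = (sa j * sb k - sb k * sa j) f := rfl
    rw [this, hab]
    split_ifs <;> simp
  comm_aa j k := by
    rintro _ ⟨f, rfl⟩
    rw [(ha j).ev_incl, (ha k).ev_incl, (ha j).ev_incl, (ha k).ev_incl, ← map_sub]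
    have : sa j (sa k f) - sa k (sa j f) = (sa j * sa k - sa k * sa j) f := rfl
    rw [this, haa j k, sub_self]
    simp
  comm_bb j k := by
    rintro _ ⟨f, rfl⟩
    rw [(hb j).ev_incl, (hb k).ev_incl, (hb j).ev_incl, (hb k).ev_incl, ← map_sub]
    have : sb j (sb k f) - sb k (sb j f) = (sb j * sb k - sb k * sb j) f := rfl
    rw [this, hbb j k, sub_self]
    simp

/-- The normalization constant of the ladder. -/
def ladderConst (n : ℕ × ℕ) : ℂ := (((Real.sqrt (n.1.factorial * n.2.factorial))⁻¹ : ℝ) : ℂ)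

theorem Acts.iterate_ev {A : Hil →ₗ.[ℂ] Hil} {S : SOp} (h : Acts A S) (n : ℕ)
    (f : 𝓢(Plane, ℂ)) : (ev A)^[n] (incl f) = incl ((S ^ n) f) := by
  induction n with
  | zero => simp
  | succ n ih =>
    rw [Function.iterate_succ_apply', ih, h.ev_incl, pow_succ']
    rfl

theorem ladder_incl {A : Fin 2 → Hil →ₗ.[ℂ] Hil} {S : Fin 2 → SOp} (h : ∀ j, Acts (A j) (S j))
    (f : 𝓢(Plane, ℂ)) (n : ℕ × ℕ) :
    ladder A (incl f) n = ladderConst n • incl ((S 0 ^ n.1) ((S 1 ^ n.2) f)) := by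
  rw [ladder, (h 1).iterate_ev, (h 0).iterate_ev]
  rfl

/-! ### The operators `c_g`, `c_d` -/

/-- The annihilation operators `c_g`, `c_d`. -/
def annS : Fin 2 → SOp :=
  ![(1 / 2 : ℂ) • (x 0 + I • p 0 + I • x 1 - p 1), (1 / 2 : ℂ) • (-(I • x 0) + p 0 - x 1 - I • p 1)]

/-- The creation operators `c_g†`, `c_d†`. -/
def creS : Fin 2 → SOp :=
  ![(1 / 2 : ℂ) • (x 0 - I • p 0 - I • x 1 - p 1), (1 / 2 : ℂ) • (I • x 0 + p 0 - x 1 + I • p 1)]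

theorem cgd_eq (j : Fin 2) : cgd j = toPMap (annS j) := by
  have h2 : ((1 / Real.sqrt 2 : ℝ) : ℂ) * ((1 / Real.sqrt 2 : ℝ) : ℂ) = 1 / 2 := by
    rw [← ofReal_mul, div_mul_div_comm, Real.mul_self_sqrt (by norm_num)]
    norm_num
  set r : ℂ := ((1 / Real.sqrt 2 : ℝ) : ℂ)
  have e0 : r • (cS 0 + I • cS 1) = annS 0 := by
    change r • (r • (x 0 + I • p 0) + I • r • (x 1 + I • p 1)) = _
    rw [smul_comm I r, ← smul_add, smul_smul, h2]
    change _ = (1 / 2 : ℂ) • (x 0 + I • p 0 + I • x 1 - p 1)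
    match_scalars <;> ring_nf
    norm_num
  have e1 : (-I * r) • (cS 0 - I • cS 1) = annS 1 := by
    change (-I * r) • (r • (x 0 + I • p 0) - I • r • (x 1 + I • p 1)) = _
    rw [smul_comm I r, ← smul_sub, smul_smul, mul_assoc, h2]
    change _ = (1 / 2 : ℂ) • (-(I • x 0) + p 0 - x 1 - I • p 1)
    match_scalars <;> ring_nf <;> norm_num [I_pow_three]
  fin_cases j
  · exact congrArg toPMap e0
  · exact congrArg toPMap e1

theorem formalAdj_annS (j : Fin 2) : FormalAdj (annS j) (creS j) := by
  have hx := formalAdj_x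
  have hp := formalAdj_p
  fin_cases j
  · have h := ((((hx 0).add ((hp 0).smul I)).add ((hx 1).smul I)).sub (hp 1)).smul (1 / 2)
    convert h using 1
    · rfl
    change (1 / 2 : ℂ) • (x 0 - I • p 0 - I • x 1 - p 1) = _
    simp only [conj_I, map_div₀, map_one, map_ofNat]
    module
  · have h := (((((hx 0).smul (-I)).add (hp 0)).sub (hx 1)).sub ((hp 1).smul I)).smul (1 / 2)
    convert h using 1
    · change (1 / 2 : ℂ) • (-(I • x 0) + p 0 - x 1 - I • p 1) = _
      module
    · change (1 / 2 : ℂ) • (I • x 0 + p 0 - x 1 + I • p 1) = _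
      simp only [conj_I, map_neg, map_div₀, map_one, map_ofNat]
      module

theorem annS_mul_creS (j k : Fin 2) :
    annS j * creS k - creS k * annS j = if j = k then 1 else 0 := by
  fin_cases j <;> fin_cases k <;>
  · simp only [Fin.zero_eta, Fin.mk_one, annS, creS, Matrix.cons_val_zero, Matrix.cons_val_one,
      mul_add, add_mul, mul_sub, sub_mul, smul_add, smul_sub, smul_neg, mul_neg, neg_mul,
      smul_mul_assoc, mul_smul_comm, p_mul_x_self,
      p_mul_x_of_ne (zero_ne_one : (0 : Fin 2) ≠ 1), p_mul_x_of_ne (one_ne_zero : (1 : Fin 2) ≠ 0),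
      x_mul_comm 1 0, p_mul_comm 1 0, if_true, zero_ne_one, one_ne_zero, if_false]
    match_scalars <;> ring_nf <;> simp only [I_sq] <;> ring

theorem annS_mul_comm (j k : Fin 2) : annS j * annS k = annS k * annS j := by
  fin_cases j <;> fin_cases k <;> first | rfl |
  · simp only [Fin.zero_eta, Fin.mk_one, annS, Matrix.cons_val_zero, Matrix.cons_val_one,
      mul_add, add_mul, mul_sub, sub_mul, smul_add, smul_sub, smul_neg, mul_neg, neg_mul,
      smul_mul_assoc, mul_smul_comm, p_mul_x_self,
      p_mul_x_of_ne (zero_ne_one : (0 : Fin 2) ≠ 1), p_mul_x_of_ne (one_ne_zero : (1 : Fin 2) ≠ 0),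
      x_mul_comm 1 0, p_mul_comm 1 0]
    match_scalars <;> ring_nf

theorem creS_mul_comm (j k : Fin 2) : creS j * creS k = creS k * creS j := by
  fin_cases j <;> fin_cases k <;> first | rfl |
  · simp only [Fin.zero_eta, Fin.mk_one, creS, Matrix.cons_val_zero, Matrix.cons_val_one,
      mul_add, add_mul, mul_sub, sub_mul, smul_add, smul_sub, smul_mul_assoc, mul_smul_comm, p_mul_x_self,
      p_mul_x_of_ne (zero_ne_one : (0 : Fin 2) ≠ 1), p_mul_x_of_ne (one_ne_zero : (1 : Fin 2) ≠ 0),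
      x_mul_comm 1 0, p_mul_comm 1 0]
    match_scalars <;> ring_nf

/-- The constants `k_j` are designed for this: the imaginary shifts of position and momentum combine
into one scalar added to each boson. -/
theorem aS_eq (A B s t : ℝ) (j : Fin 2) :
    aS A B s t j = annS j + (kc A B s t j / 2) • 1 := by
  fin_cases j <;>
  · simp only [Fin.zero_eta, Fin.mk_one, aS, X, P, annS, kc, Matrix.cons_val_zero,
      Matrix.cons_val_one]
    match_scalars <;> ring_nf
    simp only [I_sq]
    ring

/-- The conjugate shift enters with the opposite sign to that in `a_j†`, so that `b_j` and `a_j†`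
differ by `conj(k_j)`. -/
theorem bS_eq (A B s t : ℝ) (j : Fin 2) :
    bS A B s t j = creS j - (conj (kc A B s t j) / 2) • 1 := by
  fin_cases j <;>
  · simp only [Fin.zero_eta, Fin.mk_one, bS, X, P, creS, kc, Matrix.cons_val_zero,
      Matrix.cons_val_one, map_add, map_sub, map_mul, map_div₀, map_one, conj_ofReal, conj_I,
      map_ofNat]
    match_scalars <;> ring_nf
    simp only [I_sq]
    ring

theorem formalAdj_aS (A B s t : ℝ) (j : Fin 2) :
    FormalAdj (aS A B s t j) (creS j + (conj (kc A B s t j) / 2) • 1) := by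
  rw [aS_eq]
  convert (formalAdj_annS j).add (formalAdj_one.smul (kc A B s t j / 2)) using 3
  simp only [map_div₀, map_ofNat]

theorem formalAdj_bS (A B s t : ℝ) (j : Fin 2) :
    FormalAdj (bS A B s t j) (annS j - (kc A B s t j / 2) • 1) := by
  rw [bS_eq]
  convert (formalAdj_annS j).symm.sub (formalAdj_one.smul (conj (kc A B s t j) / 2)) using 3
  simp only [map_div₀, map_ofNat, conj_conj]

theorem isPseudoBosonic_ab (A B s t : ℝ) : IsPseudoBosonic schwartzD (a A B s t) (b A B s t) := by
  refine isPseudoBosonic_of_acts (fun j => acts_toPMap _) (fun j => acts_toPMap _)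
    (fun j => (formalAdj_aS A B s t j).acts_adjoint)
    (fun j => (formalAdj_bS A B s t j).acts_adjoint) (fun j k => ?_) (fun j k => ?_)
    (fun j k => ?_)
  · rw [← annS_mul_creS j k, aS_eq, bS_eq]
    simp only [mul_sub, add_mul, sub_mul, mul_add, smul_mul_assoc, mul_smul_comm, one_mul, mul_one]
    module
  · rw [aS_eq, aS_eq]
    simp only [add_mul, mul_add, smul_mul_assoc, mul_smul_comm, one_mul, mul_one,
      annS_mul_comm j k]
    module
  · rw [bS_eq, bS_eq]
    simp only [sub_mul, mul_sub, smul_mul_assoc, mul_smul_comm, one_mul, mul_one,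
      creS_mul_comm j k]
    module

theorem isPseudoBosonic_cgd : IsPseudoBosonic schwartzD cgd fun j => (cgd j).adjoint := by
  refine isPseudoBosonic_of_acts (sa := annS) (sb := creS) (sa' := creS) (sb' := annS)
    (fun j => ?_) (fun j => ?_) (fun j => ?_) (fun j => ?_) annS_mul_creS annS_mul_comm
    creS_mul_comm
  · rw [cgd_eq]; exact acts_toPMap _
  · rw [cgd_eq]; exact (formalAdj_annS j).acts_adjoint
  · rw [cgd_eq]; exact (formalAdj_annS j).acts_adjoint
  · simp only [cgd_eq]; exact (formalAdj_annS j).acts_adjoint_adjoint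

theorem acts_cgd_adjoint (j : Fin 2) : Acts (cgd j).adjoint (creS j) := by
  rw [cgd_eq]; exact (formalAdj_annS j).acts_adjoint

/-! ### Gaussians and the ladder operators -/

/-- Gaussians are coherent states, joint eigenvectors of the annihilation operators, by `p_gS`. -/
theorem annS_gS (j : Fin 2) (β : Fin 2 → ℂ) :
    annS j (gS β) = -((![β 0 + I * β 1, -I * β 0 - β 1] j) / 2) • gS β := by
  fin_cases j <;>
  · simp only [Fin.zero_eta, Fin.mk_one, annS, Matrix.cons_val_zero, Matrix.cons_val_one,
      smul_apply, add_apply, sub_apply, neg_apply, p_gS]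
    match_scalars <;> ring_nf <;> simp only [I_sq] <;> ring

/-- Together with `alpha_sub` this inverts the definition of `α`: the eigenvalue of `c_j` on the
Gaussian with parameter `α` is `-k_j/2`, exactly what `a_j` cancels, and with parameter `-α` it is
`k_j/2`, cancelled by `b_j†`. -/
theorem alpha_add (A B s t : ℝ) :
    alpha A B s t 0 + I * alpha A B s t 1 = kc A B s t 0 := by
  simp only [alpha, Matrix.cons_val_zero, Matrix.cons_val_one]
  field_simp
  ring

theorem alpha_sub (A B s t : ℝ) :
    -I * alpha A B s t 0 - alpha A B s t 1 = kc A B s t 1 := by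
  simp only [alpha, Matrix.cons_val_zero, Matrix.cons_val_one]
  field_simp
  ring_nf
  simp only [I_sq, I_pow_three]
  ring

theorem annS_gS_smul_alpha (A B s t : ℝ) (c : ℂ) (j : Fin 2) :
    annS j (gS (c • alpha A B s t)) = -(c * kc A B s t j / 2) • gS (c • alpha A B s t) := by
  rw [annS_gS]
  congr 2
  fin_cases j
  · simp only [Fin.zero_eta, Matrix.cons_val_zero, ← alpha_add, Pi.smul_apply, smul_eq_mul]
    ring
  · simp only [Fin.mk_one, Matrix.cons_val_one, Matrix.cons_val_fin_one, ← alpha_sub, Pi.smul_apply,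
      smul_eq_mul]
    ring

theorem annS_gS_zero (j : Fin 2) : annS j (gS 0) = 0 := by
  rw [annS_gS]
  fin_cases j <;> simp

theorem inner_gauss (β γ : Fin 2 → ℂ) : ⟪gauss β, gauss γ⟫_ℂ =
    Real.pi * cexp (((conj (β 0) + γ 0) ^ 2 + (conj (β 1) + γ 1) ^ 2) / 4) := by
  have h := GaussianFourier.integral_cexp_neg_mul_sum_add (b := 1) (ι := Fin 2) (by simp)
    (fun i => -(conj (β i) + γ i))
  rw [← incl_gS, ← incl_gS, inner_incl, ← (PiLp.volume_preserving_toLp (Fin 2)).integral_comp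
    (MeasurableEquiv.toLp 2 _).measurableEmbedding]
  simp only [Fin.sum_univ_two, Fintype.card_fin, Nat.cast_ofNat, div_one, neg_sq, mul_one, ne_eq,
    OfNat.ofNat_ne_zero, not_false_eq_true, div_self, cpow_one] at h
  rw [← h]
  refine integral_congr_ae (Filter.Eventually.of_forall fun v => ?_)
  simp only [gS_apply, gaussFun, ← exp_conj, ← Complex.exp_add]
  congr 1
  simp only [map_sub, map_add, map_mul, map_neg, map_div₀, map_one, map_ofNat, map_pow, conj_ofReal]
  ring

/-! ### The orthonormal basis `χ` -/

/-- This is the derivation rule for the commutator with `u`. At `n = 0` the truncated exponent `n -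
1` is harmless because its coefficient vanishes. -/
theorem mul_pow_of_comm_one {u v : SOp} (h : u * v - v * u = 1) (n : ℕ) :
    u * v ^ n = v ^ n * u + (n : ℂ) • v ^ (n - 1) := by
  induction n with
  | zero => simp
  | succ n ih =>
    have h' : u * v = v * u + 1 := by rw [← h]; abel
    rw [pow_succ', ← mul_assoc, h', add_mul, one_mul, mul_assoc, ih, mul_add, ← mul_assoc,
      mul_smul_comm, Nat.add_sub_cancel]
    rcases n with _ | n
    · simp
    · simp only [Nat.add_sub_cancel, ← pow_succ']
      push_cast
      module

theorem mul_pow_of_comm_zero {u v : SOp} (h : u * v - v * u = 0) (n : ℕ) :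
    u * v ^ n = v ^ n * u := (Commute.pow_right (sub_eq_zero.mp h) n)

/-- The unnormalized oscillator states. -/
def oscS (m n : ℕ) : 𝓢(Plane, ℂ) := (creS 0 ^ m) ((creS 1 ^ n) (gS 0))

theorem annS_zero_oscS (m n : ℕ) : annS 0 (oscS m n) = (m : ℂ) • oscS (m - 1) n := by
  have h0 : annS 0 * creS 0 ^ m = _ := mul_pow_of_comm_one (by simpa using annS_mul_creS 0 0) m
  have h1 : annS 0 * creS 1 ^ n = _ := mul_pow_of_comm_zero (by simpa using annS_mul_creS 0 1) n
  change (annS 0 * creS 0 ^ m) ((creS 1 ^ n) (gS 0)) = _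
  rw [h0, add_apply, smul_apply]
  have : (creS 0 ^ m * annS 0) ((creS 1 ^ n) (gS 0))
      = (creS 0 ^ m) ((annS 0 * creS 1 ^ n) (gS 0)) := rfl
  rw [this, h1, mul_apply_eq_comp, annS_gS_zero, map_zero, map_zero, zero_add]
  rfl

theorem annS_one_oscS (m n : ℕ) : annS 1 (oscS m n) = (n : ℂ) • oscS m (n - 1) := by
  have h0 : annS 1 * creS 0 ^ m = _ := mul_pow_of_comm_zero (by simpa using annS_mul_creS 1 0) m
  have h1 : annS 1 * creS 1 ^ n = _ := mul_pow_of_comm_one (by simpa using annS_mul_creS 1 1) n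
  change (annS 1 * creS 0 ^ m) ((creS 1 ^ n) (gS 0)) = _
  rw [h0]
  have : (creS 0 ^ m * annS 1) ((creS 1 ^ n) (gS 0))
      = (creS 0 ^ m) ((annS 1 * creS 1 ^ n) (gS 0)) := rfl
  rw [this, h1, add_apply, mul_apply_eq_comp, annS_gS_zero, map_zero, zero_add, smul_apply,
    map_smul]
  rfl

theorem creS_zero_oscS (m n : ℕ) : creS 0 (oscS m n) = oscS (m + 1) n := by
  rw [oscS, oscS, pow_succ']
  rfl

theorem creS_one_oscS (m n : ℕ) : creS 1 (oscS m n) = oscS m (n + 1) := by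
  have h : creS 1 * creS 0 ^ m = creS 0 ^ m * creS 1 :=
    mul_pow_of_comm_zero (sub_eq_zero.mpr (creS_mul_comm 1 0)) m
  change (creS 1 * creS 0 ^ m) ((creS 1 ^ n) (gS 0)) = _
  rw [h, oscS, pow_succ']
  rfl

/-- Moving one creation operator across the inner product lowers both indices. Iterating down to the
vacuum yields orthogonality and the factorials. -/
theorem inner_oscS_succ_left (m n m' n' : ℕ) :
    ⟪incl (oscS (m + 1) n), incl (oscS m' n')⟫_ℂ
      = m' * ⟪incl (oscS m n), incl (oscS (m' - 1) n')⟫_ℂ := by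
  rw [← creS_zero_oscS, (formalAdj_annS 0).symm, annS_zero_oscS, map_smul, inner_smul_right]

theorem inner_oscS_succ_right (m n m' n' : ℕ) :
    ⟪incl (oscS m (n + 1)), incl (oscS m' n')⟫_ℂ
      = n' * ⟪incl (oscS m n), incl (oscS m' (n' - 1))⟫_ℂ := by
  rw [← creS_one_oscS, (formalAdj_annS 1).symm, annS_one_oscS, map_smul, inner_smul_right]

theorem inner_oscS (m n m' n' : ℕ) : ⟪incl (oscS m n), incl (oscS m' n')⟫_ℂ
    = if (m, n) = (m', n') then (m.factorial * n.factorial * Real.pi : ℂ) else 0 := by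
  induction m generalizing m' with
  | succ m ih =>
    rw [inner_oscS_succ_left, ih]
    rcases m' with _ | m'
    · simp
    · simp only [Nat.add_sub_cancel, Prod.mk.injEq, Nat.add_right_cancel_iff]
      split_ifs with h
      · rw [h.1, Nat.factorial_succ]
        push_cast
        ring
      · simp
  | zero =>
    rcases m' with _ | m'
    · induction n generalizing n' with
      | succ n ih =>
        rw [inner_oscS_succ_right, ih]
        rcases n' with _ | n'
        · simp
        · simp only [Nat.add_sub_cancel, Prod.mk.injEq, Nat.add_right_cancel_iff]
          split_ifs with h
          · rw [h.2, Nat.factorial_succ]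
            push_cast
            ring
          · simp
      | zero =>
        rcases n' with _ | n'
        · have : oscS 0 0 = gS 0 := by simp [oscS]
          rw [this, incl_gS, inner_gauss]
          simp
        -- After exchanging the two sides, lowering the vacuum index gives the factor `0`.
        · rw [← inner_conj_symm, inner_oscS_succ_right]
          simp
    · rw [← inner_conj_symm, inner_oscS_succ_left]
      simp

theorem chi0_eq : chi0 = incl (((1 / Real.sqrt Real.pi : ℝ) : ℂ) • gS 0) := by
  rw [map_smul, incl_gS, chi0]

theorem chi_eq (n : ℕ × ℕ) :
    chi n = (ladderConst n * ((1 / Real.sqrt Real.pi : ℝ) : ℂ)) • incl (oscS n.1 n.2) := by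
  rw [chi, chi0_eq, ladder_incl acts_cgd_adjoint, map_smul, map_smul, map_smul, smul_smul]
  rfl

theorem ladderConst_ne_zero (n : ℕ × ℕ) : ladderConst n ≠ 0 := by
  rw [ladderConst, ofReal_ne_zero]
  have : (0 : ℝ) < n.1.factorial * n.2.factorial := by positivity
  positivity

theorem orthonormal_chi : Orthonormal ℂ chi := by
  rw [orthonormal_iff_ite]
  intro n m
  rw [chi_eq, chi_eq, inner_smul_left, inner_smul_right, inner_oscS]
  by_cases h : n = m
  · subst h
    simp only [if_true]
    have hf : (0 : ℝ) < n.1.factorial * n.2.factorial := by positivity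
    have h1 : Real.sqrt (n.1.factorial * n.2.factorial) ^ 2 = n.1.factorial * n.2.factorial :=
      Real.sq_sqrt hf.le
    have h2 : Real.sqrt Real.pi ^ 2 = Real.pi := Real.sq_sqrt Real.pi_pos.le
    simp only [ladderConst, map_mul, conj_ofReal]
    have h3 : Real.sqrt (n.1.factorial * n.2.factorial) ≠ 0 := (Real.sqrt_pos.mpr hf).ne'
    have h4 : Real.sqrt Real.pi ≠ 0 := (Real.sqrt_pos.mpr Real.pi_pos).ne'
    set r := Real.sqrt (n.1.factorial * n.2.factorial)
    set q := Real.sqrt Real.pi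
    clear_value r q
    have key : r⁻¹ * (1 / q) * (r⁻¹ * (1 / q) * (n.1.factorial * n.2.factorial * Real.pi)) = 1 := by
      rw [← h1, ← h2]
      field_simp
    exact_mod_cast congrArg ofReal key
  · have : (n.1, n.2) ≠ (m.1, m.2) := h
    simp [this]

theorem ev_cgd_chi0 (j : Fin 2) : ev (cgd j) chi0 = 0 := by
  rw [chi0_eq, cgd_eq, ev_toPMap, map_smul, annS_gS_zero, smul_zero, map_zero]

/-! ### Completeness -/

/-- The span of the oscillator states. -/
def oscSpan : Submodule ℂ 𝓢(Plane, ℂ) := Submodule.span ℂ (Set.range fun n : ℕ × ℕ => oscS n.1 n.2)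

theorem oscS_mem (m n : ℕ) : oscS m n ∈ oscSpan := Submodule.subset_span ⟨(m, n), rfl⟩

theorem oscSpan_le_comap_annS (j : Fin 2) {f : 𝓢(Plane, ℂ)} (hf : f ∈ oscSpan) :
    annS j f ∈ oscSpan := by
  have : oscSpan ≤ oscSpan.comap (annS j).toLinearMap := by
    refine Submodule.span_le.mpr ?_
    rintro _ ⟨⟨m, n⟩, rfl⟩
    change annS j (oscS m n) ∈ oscSpan
    fin_cases j
    · exact (annS_zero_oscS m n).symm ▸ Submodule.smul_mem _ _ (oscS_mem _ _)
    · exact (annS_one_oscS m n).symm ▸ Submodule.smul_mem _ _ (oscS_mem _ _)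
  exact this hf

theorem oscSpan_le_comap_creS (j : Fin 2) {f : 𝓢(Plane, ℂ)} (hf : f ∈ oscSpan) :
    creS j f ∈ oscSpan := by
  have : oscSpan ≤ oscSpan.comap (creS j).toLinearMap := by
    refine Submodule.span_le.mpr ?_
    rintro _ ⟨⟨m, n⟩, rfl⟩
    change creS j (oscS m n) ∈ oscSpan
    fin_cases j
    · exact (creS_zero_oscS m n).symm ▸ oscS_mem _ _
    · exact (creS_one_oscS m n).symm ▸ oscS_mem _ _
  exact this hf

/-- Solving for the coordinates shows that the span of the oscillator states is stable under
multiplication by them, hence contains every power of a linear form times the Gaussian. -/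
theorem x_eq_annS_creS (j : Fin 2) : x j = (1 / 2 : ℂ) •
    ![annS 0 + creS 0 + I • (annS 1 - creS 1), -(I • (annS 0 - creS 0)) - (annS 1 + creS 1)] j := by
  fin_cases j <;>
  · simp only [Fin.zero_eta, Fin.mk_one, annS, creS, Matrix.cons_val_zero, Matrix.cons_val_one,
      Matrix.cons_val_fin_one]
    match_scalars <;> ring_nf <;> simp only [I_sq] <;> ring

theorem x_mem_oscSpan (j : Fin 2) {f : 𝓢(Plane, ℂ)} (hf : f ∈ oscSpan) : x j f ∈ oscSpan := by
  have ha := fun j => oscSpan_le_comap_annS j hf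
  have hc := fun j => oscSpan_le_comap_creS j hf
  rw [x_eq_annS_creS]
  fin_cases j
  · exact Submodule.smul_mem _ _ (Submodule.add_mem _ (Submodule.add_mem _ (ha 0) (hc 0))
      (Submodule.smul_mem _ _ (Submodule.sub_mem _ (ha 1) (hc 1))))
  · exact Submodule.smul_mem _ _ (Submodule.sub_mem _ (Submodule.neg_mem _
      (Submodule.smul_mem _ _ (Submodule.sub_mem _ (ha 0) (hc 0))))
      (Submodule.add_mem _ (ha 1) (hc 1)))

/-- Multiplication by the linear form `β · x`. -/
def linS (β : Fin 2 → ℂ) : SOp := β 0 • x 0 + β 1 • x 1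

theorem linS_apply (β : Fin 2 → ℂ) (f : 𝓢(Plane, ℂ)) (v : Plane) :
    linS β f v = (β 0 * v 0 + β 1 * v 1) * f v := by
  simp only [linS, add_apply, smul_apply, x_apply, smul_eq_mul]
  ring

theorem linS_pow_apply (β : Fin 2 → ℂ) (f : 𝓢(Plane, ℂ)) (n : ℕ) (v : Plane) :
    (linS β ^ n) f v = (β 0 * v 0 + β 1 * v 1) ^ n * f v := by
  induction n with
  | zero => simp
  | succ n ih => rw [pow_succ', mul_apply_eq_comp, linS_apply, ih, pow_succ']; ring

theorem linS_pow_mem_oscSpan (β : Fin 2 → ℂ) (n : ℕ) : (linS β ^ n) (gS 0) ∈ oscSpan := by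
  induction n with
  | zero =>
    have : oscS 0 0 = gS 0 := by simp [oscS]
    simpa [this] using oscS_mem 0 0
  | succ n ih =>
    rw [pow_succ', mul_apply_eq_comp]
    exact Submodule.add_mem _ (Submodule.smul_mem _ _ (x_mem_oscSpan 0 ih))
      (Submodule.smul_mem _ _ (x_mem_oscSpan 1 ih))

theorem gaussFun_eq (β : Fin 2 → ℂ) (v : Plane) :
    gaussFun β v = cexp (-(β 0 * v 0 + β 1 * v 1)) * gaussFun 0 v := by
  rw [gaussFun, gaussFun, ← Complex.exp_add]
  congr 1
  simp
  ring

theorem memLp_exp_neg_sq_div_four :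
    MemLp (fun v : Plane => Real.exp (-(‖v‖ ^ 2 / 4))) 2 (volume : Measure Plane) := by
  have hc : Continuous fun v : Plane => Real.exp (-(‖v‖ ^ 2 / 4)) := by fun_prop
  rw [memLp_two_iff_integrable_sq hc.aestronglyMeasurable]
  have h := (GaussianFourier.integrable_cexp_neg_mul_sq_norm_add (b := 1 / 2) (by norm_num) 0
    (0 : Plane)).norm
  refine h.congr (Filter.Eventually.of_forall fun v => ?_)
  simp only [norm_exp, ← Real.exp_nat_mul]
  congr 1
  have : (-(1 / 2 : ℂ) * (‖v‖ : ℂ) ^ 2 + 0 * ((⟪(0 : Plane), v⟫_ℝ : ℝ) : ℂ))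
    = ((-(1 / 2) * ‖v‖ ^ 2 : ℝ) : ℂ) := by push_cast; ring
  rw [this, ofReal_re]
  push_cast
  ring

theorem memLp_exp_mul_gauss (c : ℝ) :
    MemLp (fun v : Plane => Real.exp (c * ‖v‖) * ‖gaussFun 0 v‖) 2 (volume : Measure Plane) := by
  obtain ⟨C, hC, h⟩ := exists_one_add_pow_mul_exp_le 0 c
  have hc : Continuous fun v : Plane => Real.exp (c * ‖v‖) * ‖gaussFun 0 v‖ := by
    unfold gaussFun; fun_prop
  refine memLp_exp_neg_sq_div_four.of_le_mul (c := C) hc.aestronglyMeasurable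
    (Filter.Eventually.of_forall fun v => ?_)
  have h1 := h ‖v‖ (norm_nonneg v)
  have h2 := norm_gaussFun_le 0 v
  rw [Real.norm_of_nonneg (by positivity), Real.norm_of_nonneg (by positivity)]
  refine le_trans ?_ h1
  rw [pow_zero, one_mul, sub_eq_add_neg, Real.exp_add]
  refine mul_le_mul_of_nonneg_left (h2.trans (Real.exp_le_exp.mpr ?_)) (Real.exp_pos _).le
  simp [linBound]

/-- Expand `exp(-β · v)` in its power series: every term, times the centred Gaussian, lies in the
span. Sum and integral may be exchanged because the series of absolute values is at most `exp(c
‖v‖)` times `|h|` and the Gaussian, a product of two `L²` functions. -/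
theorem inner_gauss_eq_zero_of_orthogonal {h : Hil}
    (hh : ∀ f ∈ oscSpan, ⟪h, incl f⟫_ℂ = 0) (β : Fin 2 → ℂ) : ⟪h, gauss β⟫_ℂ = 0 := by
  let F : ℕ → Plane → ℂ := fun n v =>
    ((n.factorial : ℂ)⁻¹ * (-1) ^ n) * (conj (h v) * (linS β ^ n) (gS 0) v)
  have hmeas : AEStronglyMeasurable (h : Plane → ℂ) volume := Lp.aestronglyMeasurable h
  have hlin : ∀ v : Plane, ‖β 0 * v 0 + β 1 * v 1‖ ≤ linBound β * ‖v‖ := norm_lin_le β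
  let bd : ℕ → Plane → ℝ := fun n v =>
    (linBound β * ‖v‖) ^ n / n.factorial * (‖h v‖ * ‖gaussFun 0 v‖)
  have hbs : ∀ v, HasSum (fun n => bd n v)
      (Real.exp (linBound β * ‖v‖) * (‖h v‖ * ‖gaussFun 0 v‖)) := fun v => by
    have := (NormedSpace.expSeries_div_hasSum_exp (linBound β * ‖v‖)).mul_right
      (‖h v‖ * ‖gaussFun 0 v‖)
    rwa [← Real.exp_eq_exp_ℝ] at this
  have hsum := hasSum_integral_of_dominated_convergence (μ := (volume : Measure Plane)) (F := F)
    (f := fun v => conj (h v) * gaussFun β v) bd (fun n => ?_) (fun n => ?_) ?_ ?_ ?_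
  · have e1 : ∀ n, ∫ v, F n v = 0 := fun n => by
      have h0 := hh _ (linS_pow_mem_oscSpan β n)
      rw [L2.inner_def] at h0
      change ∫ v, ((n.factorial : ℂ)⁻¹ * (-1) ^ n) * (conj (h v) * (linS β ^ n) (gS 0) v) = 0
      rw [integral_const_mul, ← mul_zero ((n.factorial : ℂ)⁻¹ * (-1) ^ n), ← h0]
      congr 1
      refine integral_congr_ae ?_
      filter_upwards [coeFn_incl ((linS β ^ n) (gS 0))] with v hv
      rw [hv]
      simp [mul_comm]
    simp only [e1] at hsum
    rw [L2.inner_def, ← hsum.unique hasSum_zero]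
    refine integral_congr_ae ?_
    filter_upwards [(memLp_gaussFun β).coeFn_toLp] with v hv
    rw [gauss, hv]
    simp [mul_comm]
  · exact ((continuous_conj.comp_aestronglyMeasurable hmeas).mul
      ((linS β ^ n) (gS 0)).continuous.aestronglyMeasurable).const_mul _
  · refine Filter.Eventually.of_forall fun v => ?_
    simp only [F, bd, linS_pow_apply, norm_mul, norm_inv, norm_pow, norm_neg, norm_one, one_pow,
      mul_one, RCLike.norm_conj, gS_apply, Complex.norm_natCast]
    have := pow_le_pow_left₀ (norm_nonneg _) (hlin v) n
    calc _ = ‖β 0 * v 0 + β 1 * v 1‖ ^ n * ((n.factorial : ℝ)⁻¹ * (‖h v‖ * ‖gaussFun 0 v‖)) := by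
          ring
      _ ≤ (linBound β * ‖v‖) ^ n * ((n.factorial : ℝ)⁻¹ * (‖h v‖ * ‖gaussFun 0 v‖)) :=
          mul_le_mul_of_nonneg_right this (by positivity)
      _ = _ := by ring
  · exact Filter.Eventually.of_forall fun v => (hbs v).summable
  · have := (Lp.memLp h).norm.integrable_mul (memLp_exp_mul_gauss (linBound β))
    refine this.congr (Filter.Eventually.of_forall fun v => ?_)
    simp only [(hbs v).tsum_eq, Pi.mul_apply]
    ring
  · refine Filter.Eventually.of_forall fun v => ?_
    have := (NormedSpace.expSeries_div_hasSum_exp (-(β 0 * (v 0 : ℂ) + β 1 * (v 1 : ℂ)))).mul_left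
      (conj (h v) * gaussFun 0 v)
    rw [← Complex.exp_eq_exp_ℂ] at this
    rw [gaussFun_eq β, mul_left_comm (conj (h v)), mul_comm (cexp _)]
    have e : (fun n => F n v) = fun n => conj (h v) * gaussFun 0 v *
        ((-(β 0 * (v 0 : ℂ) + β 1 * (v 1 : ℂ))) ^ n / n.factorial) := by
      funext n
      simp only [F, linS_pow_apply, gS_apply]
      rw [neg_pow (β 0 * (v 0 : ℂ) + β 1 * (v 1 : ℂ)) n]
      ring
    rw [e]
    exact this

/-- Each test function is the Fourier transform of a Schwartz function. Exchanging the transform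
between the two factors shows that `k` integrates to zero against it. -/
theorem ae_eq_zero_of_fourier_eq_zero {k : Plane → ℂ} (hk : Integrable k)
    (h : ∀ ξ, VectorFourier.fourierIntegral Real.fourierChar volume (innerₗ Plane) k ξ = 0) :
    k =ᵐ[volume] 0 := by
  refine ae_eq_zero_of_integral_contDiff_smul_eq_zero hk.locallyIntegrable fun g hg hgc => ?_
  have hc : HasCompactSupport fun v => (g v : ℂ) := hgc.comp_left (g := ((↑) : ℝ → ℂ)) rfl
  have hd : ContDiff ℝ ((⊤ : ℕ∞) : WithTop ℕ∞) fun v => (g v : ℂ) := ofRealCLM.contDiff.comp hg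
  let G : 𝓢(Plane, ℂ) := hc.toSchwartzMap hd
  have hG : FourierTransform.fourier (FourierTransformInv.fourierInv G) = G :=
    FourierTransform.fourier_fourierInv_eq G
  have := VectorFourier.integral_fourierIntegral_smul_eq_flip (L := innerₗ Plane)
    (μ := volume) (ν := volume) Real.continuous_fourierChar continuous_inner
    hk (FourierTransformInv.fourierInv G).integrable
  simp only [h, zero_smul, integral_zero] at this
  rw [this]
  refine integral_congr_ae (Filter.Eventually.of_forall fun v => ?_)
  have e : VectorFourier.fourierIntegral Real.fourierChar volume (innerₗ Plane).flip
      (FourierTransformInv.fourierInv G) v = G v := by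
    conv_rhs => rw [← hG]
    rw [flip_innerₗ]
    rfl
  simp only [e]
  change (g v) • k v = k v • (g v : ℂ)
  rw [Complex.real_smul, smul_eq_mul, mul_comm]

theorem eq_zero_of_orthogonal_oscSpan {h : Hil} (hh : ∀ f ∈ oscSpan, ⟪h, incl f⟫_ℂ = 0) :
    h = 0 := by
  let k : Plane → ℂ := fun v => conj (h v) * gaussFun 0 v
  have hk : Integrable k := by
    refine MemLp.integrable_mul (p := 2) (q := 2) ?_ (memLp_gaussFun 0)
    exact (Lp.memLp h).star
  have hz := ae_eq_zero_of_fourier_eq_zero hk fun ξ => by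
    -- For the purely imaginary parameter `β = 2πiξ` the Gaussian is the centred one times the
    -- Fourier character at `ξ`.
    have h0 := inner_gauss_eq_zero_of_orthogonal hh
      ![2 * Real.pi * I * ξ 0, 2 * Real.pi * I * ξ 1]
    rw [L2.inner_def] at h0
    rw [VectorFourier.fourierIntegral, ← h0]
    refine integral_congr_ae ?_
    filter_upwards [(memLp_gaussFun ![2 * Real.pi * I * ξ 0, 2 * Real.pi * I * ξ 1]).coeFn_toLp]
      with v hv
    rw [gauss, hv, gaussFun_eq]
    simp only [Circle.smul_def, Real.fourierChar_apply, innerₗ_apply_apply, smul_eq_mul, k,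
      RCLike.inner_apply, PiLp.inner_apply, Fin.sum_univ_two, Matrix.cons_val_zero,
      Matrix.cons_val_one, conj_trivial]
    have : ((2 * Real.pi * -(ξ 0 * v 0 + ξ 1 * v 1) : ℝ) : ℂ) * I
      = -(2 * Real.pi * I * ξ 0 * v 0 + 2 * Real.pi * I * ξ 1 * v 1) := by
      push_cast; ring
    rw [this]
    ring
  refine Lp.ext ?_
  filter_upwards [hz, Lp.coeFn_zero ℂ 2 (volume : Measure Plane)] with v h1 h2
  rw [h2]
  have : gaussFun 0 v ≠ 0 := Complex.exp_ne_zero _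
  simpa [k, this] using h1

theorem topologicalClosure_span_chi :
    (Submodule.span ℂ (Set.range chi)).topologicalClosure = ⊤ := by
  rw [Submodule.topologicalClosure_eq_top_iff, Submodule.eq_bot_iff]
  intro h hh
  refine eq_zero_of_orthogonal_oscSpan fun f hf => ?_
  have hle : oscSpan ≤ (Submodule.span ℂ (Set.range chi)).comap incl := by
    refine Submodule.span_le.mpr ?_
    rintro _ ⟨n, rfl⟩
    change incl (oscS n.1 n.2) ∈ Submodule.span ℂ (Set.range chi)
    have hne : ladderConst n * ((1 / Real.sqrt Real.pi : ℝ) : ℂ) ≠ 0 := by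
      refine mul_ne_zero (ladderConst_ne_zero n) (ofReal_ne_zero.mpr ?_)
      have := Real.pi_pos
      positivity
    have : incl (oscS n.1 n.2) = (ladderConst n * ((1 / Real.sqrt Real.pi : ℝ) : ℂ))⁻¹ • chi n := by
      rw [chi_eq, smul_smul, inv_mul_cancel₀ hne, one_smul]
    rw [this]
    exact Submodule.smul_mem _ _ (Submodule.subset_span ⟨n, rfl⟩)
  have := (Submodule.mem_orthogonal _ _).mp hh _ (hle hf)
  rw [← inner_conj_symm, this, map_zero]

/-! ### The exponent and its spectral representation -/

/-- The operator `-(Re β · x + Im β · p)`. -/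
def expS (β : Fin 2 → ℂ) : SOp :=
  -(((β 0).re : ℂ) • x 0 + ((β 1).re : ℂ) • x 1 + ((β 0).im : ℂ) • p 0 + ((β 1).im : ℂ) • p 1)

theorem Acts.apply_eq {A : Hil →ₗ.[ℂ] Hil} {S : SOp} (h : Acts A S) (f : 𝓢(Plane, ℂ))
    (hf : incl f ∈ A.domain) : A ⟨incl f, hf⟩ = incl (S f) :=
  A.mem_graph_snd_inj (A.mem_graph ⟨incl f, hf⟩) (h f) rfl

/-- Written in positions and momenta the exponent has real coefficients, the real and imaginary
parts of `α`. This is the form in which it can be diagonalized and applied to Gaussians. -/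
theorem expS_alpha (A B s t : ℝ) : (-(1 / 2) : ℂ) • (kc A B s t 0 • creS 0 + kc A B s t 1 • creS 1
    + conj (kc A B s t 0) • annS 0 + conj (kc A B s t 1) • annS 1) = expS (alpha A B s t) := by
  rw [← alpha_add, ← alpha_sub, expS]
  set β := alpha A B s t
  have h0 := (re_add_im (β 0)).symm
  have h1 := (re_add_im (β 1)).symm
  set u0 : ℝ := (β 0).re
  set u1 : ℝ := (β 1).re
  set w0 : ℝ := (β 0).im
  set w1 : ℝ := (β 1).im
  rw [h0, h1]
  simp only [map_add, map_sub, map_mul, map_neg, conj_I, conj_ofReal, annS, creS,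
    Matrix.cons_val_zero, Matrix.cons_val_one]
  match_scalars <;> ring_nf <;> simp only [I_sq] <;> ring

theorem exponent_eq (A B s t : ℝ) : exponent A B s t = toPMap (expS (alpha A B s t)) := by
  have hc := fun j => (cgd_eq j).symm ▸ acts_toPMap (annS j)
  refine LinearPMap.ext ?_ ?_
  · change ((((cgd 0).adjoint.domain ⊓ (cgd 1).adjoint.domain) ⊓ (cgd 0).domain) ⊓ (cgd 1).domain)
      = schwartzD
    rw [cgd_eq 0, cgd_eq 1, toPMap_domain, toPMap_domain]
    refine le_antisymm inf_le_right (le_inf (le_inf (le_inf ?_ ?_) le_rfl) le_rfl)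
    · exact (formalAdj_annS 0).stable_adjoint.1
    · exact (formalAdj_annS 1).stable_adjoint.1
  · intro v hf hg
    have hv : v ∈ schwartzD := hg
    obtain ⟨f, rfl⟩ := hv
    refine Eq.trans ?_ (toPMap_apply (expS (alpha A B s t)) f hg).symm
    rw [← expS_alpha]
    obtain ⟨⟨⟨h1, h2⟩, h3⟩, h4⟩ := hf
    change (-(1 / 2) : ℂ) • (kc A B s t 0 • (cgd 0).adjoint ⟨incl f, h1⟩
      + kc A B s t 1 • (cgd 1).adjoint ⟨incl f, h2⟩ + conj (kc A B s t 0) • cgd 0 ⟨incl f, h3⟩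
      + conj (kc A B s t 1) • cgd 1 ⟨incl f, h4⟩) = _
    rw [(acts_cgd_adjoint 0).apply_eq, (acts_cgd_adjoint 1).apply_eq, (hc 0).apply_eq,
      (hc 1).apply_eq]
    simp only [smul_apply, add_apply, map_smul, map_add]

theorem hasTemperateGrowth_inner (l : Plane) :
    Function.HasTemperateGrowth fun v : Plane => ⟪l, v⟫_ℝ :=
  (innerSL ℝ l).hasTemperateGrowth

/-- The resolvent function of a real linear form. -/
def resFun (l : Plane) (v : Plane) : ℂ := ((⟪l, v⟫_ℝ : ℝ) + I)⁻¹

theorem ofReal_add_I_ne_zero (r : ℝ) : (r : ℂ) + I ≠ 0 := fun h => by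
  simpa using congrArg im h

/-- Rationalizing, `(r + i)⁻¹ = (r - i)(1 + r²)⁻¹`. Multiplication by the resolvent function
therefore preserves Schwartz functions, which is the key to the core property. -/
theorem hasTemperateGrowth_resFun (l : Plane) : Function.HasTemperateGrowth (resFun l) := by
  have h1 := (Function.hasTemperateGrowth_one_add_norm_sq_rpow ℝ (-1)).comp
    (hasTemperateGrowth_inner l)
  have h2 := Function.Complex.hasTemperateGrowth_ofReal.comp h1
  have h3 := (Function.Complex.hasTemperateGrowth_ofReal.comp (hasTemperateGrowth_inner l)).sub
    (Function.HasTemperateGrowth.const I)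
  have h4 : resFun l = ((ofReal ∘ fun v => ⟪l, v⟫_ℝ) - fun _ => I) *
      (ofReal ∘ (fun x : ℝ => (1 + ‖x‖ ^ 2) ^ (-1 : ℝ)) ∘ fun v => ⟪l, v⟫_ℝ) := ?_
  · rw [h4]
    exact h3.mul h2
  funext v
  simp only [resFun, Pi.mul_apply, Pi.sub_apply, Function.comp_apply]
  set r := ⟪l, v⟫_ℝ
  have e : (((1 + ‖r‖ ^ 2) ^ (-1 : ℝ) : ℝ) : ℂ) = (((r : ℂ) + I) * ((r : ℂ) - I))⁻¹ := by
    rw [Real.rpow_neg_one, ofReal_inv]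
    congr 1
    push_cast [Real.norm_eq_abs]
    rw [← ofReal_pow, sq_abs]
    push_cast
    ring_nf
    simp
    ring
  have hne : (r : ℂ) - I ≠ 0 := fun h => by simpa using congrArg im h
  rw [e, mul_inv]
  field_simp

theorem continuous_resFun (l : Plane) : Continuous (resFun l) :=
  (hasTemperateGrowth_resFun l).1.continuous

theorem norm_resFun_le (l v : Plane) : ‖resFun l v‖ ≤ 1 := by
  rw [resFun, norm_inv]
  refine inv_le_one_of_one_le₀ ?_
  have := abs_im_le_norm (((⟪l, v⟫_ℝ : ℝ) : ℂ) + I)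
  simpa using this

theorem incl_smulLeftCLM {m : Plane → ℂ} (hm : Function.HasTemperateGrowth m) {C : ℝ}
    (hC : ∀ v, ‖m v‖ ≤ C) (f : 𝓢(Plane, ℂ)) :
    incl (SchwartzMap.smulLeftCLM ℂ m f) = mulOp m hm.1.continuous.measurable C hC (incl f) := by
  refine Lp.ext ?_
  filter_upwards [coeFn_incl (SchwartzMap.smulLeftCLM ℂ m f), coeFn_incl f,
    coeFn_mulOp hm.1.continuous.measurable hC (incl f)] with v h1 h2 h3
  rw [h1, h3, h2, SchwartzMap.smulLeftCLM_apply_apply hm, smul_eq_mul]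

/-- Schwartz functions are a core for an operator which a unitary that preserves the Schwartz space
turns into multiplication by a real linear form. -/
theorem isMultiplication_closure {K : SOp} {U : Hil ≃ₗᵢ[ℂ] Hil} {V W : 𝓢(Plane, ℂ) → 𝓢(Plane, ℂ)}
    {l : Plane} (hU : ∀ f, U (incl f) = incl (V f)) (hVW : ∀ f, V (W f) = f)
    (hK : ∀ f v, V (K f) v = ((⟪l, v⟫_ℝ : ℝ) : ℂ) * V f v) :
    IsMultiplication U (fun v => ⟪l, v⟫_ℝ) (toPMap K).closure := by
  have hg : Measurable fun v : Plane => ⟪l, v⟫_ℝ := (hasTemperateGrowth_inner l).1.continuous.measurable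
  obtain ⟨M, hM⟩ := exists_isMultiplication U (fun v : Plane => ⟪l, v⟫_ℝ)
  have hle : (toPMap K).graph ≤ M.graph := by
    rintro ⟨c, d⟩ hcd
    obtain ⟨f, rfl⟩ : c ∈ schwartzD := LinearPMap.mem_domain_of_mem_graph hcd
    obtain rfl : d = incl (K f) := (toPMap K).mem_graph_snd_inj hcd (mem_graph_toPMap K f) rfl
    rw [hM, hU, hU]
    filter_upwards [coeFn_incl (V f), coeFn_incl (V (K f))] with v h1 h2
    rw [h1, h2, hK]
  have hMc : IsClosed (M.graph : Set (Hil × Hil)) := (hM.isSelfAdjoint hg).isClosed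
  have hgraph : (toPMap K).graph.topologicalClosure = M.graph := by
    refine le_antisymm (Submodule.topologicalClosure_minimal _ hle hMc) ?_
    rintro ⟨h, k⟩ hhk
    rw [hM] at hhk
    let R : Hil →L[ℂ] Hil := mulOp (resFun l) (continuous_resFun l).measurable 1 (norm_resFun_le l)
    have hR : ∀ f, incl (SchwartzMap.smulLeftCLM ℂ (resFun l) f) = R (incl f) :=
      incl_smulLeftCLM (hasTemperateGrowth_resFun l) (norm_resFun_le l)
    -- With `M` the full multiplication operator, `Φ` parametrizes its graph by `w = (l + i) U h`:
    -- then `R w = U h` and `w - i R w = l · U h`. The map is continuous and sends Schwartz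
    -- functions into the graph of `K`, so density of Schwartz functions gives density of that
    -- graph.
    let Φ : Hil → Hil × Hil := fun w => (U.symm (R w), U.symm (w - I • R w))
    have hΦ : Continuous Φ := by fun_prop
    have hmem : U k + I • U h ∈ closure (schwartzD : Set Hil) := dense_schwartzD _
    have key := map_mem_closure hΦ hmem (t := ((toPMap K).graph : Set (Hil × Hil))) ?_
    · have hRw : R (U k + I • U h) = U h := by
        refine Lp.ext ?_
        filter_upwards [coeFn_mulOp (continuous_resFun l).measurable (norm_resFun_le l)
          (U k + I • U h), Lp.coeFn_add (U k) (I • U h), Lp.coeFn_smul I (U h), hhk]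
          with v h1 h2 h3 h4
        rw [h1, h2, Pi.add_apply, h3, Pi.smul_apply, h4, smul_eq_mul, ← add_mul, resFun,
          inv_mul_cancel_left₀ (ofReal_add_I_ne_zero _)]
      simp only [Φ, hRw, add_sub_cancel_right, LinearIsometryEquiv.symm_apply_apply] at key
      exact key
    · rintro _ ⟨f, rfl⟩
      set q := SchwartzMap.smulLeftCLM ℂ (resFun l) f with hq
      have e1 : U.symm (R (incl f)) = incl (W q) := by
        rw [← hR, LinearIsometryEquiv.symm_apply_eq, hU, hVW]
      have e2 : U.symm (incl f - I • R (incl f)) = incl (K (W q)) := by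
        rw [← hR, LinearIsometryEquiv.symm_apply_eq, hU, ← map_smul, ← map_sub]
        congr 1
        ext v
        rw [hK, hVW, ← hq]
        simp only [sub_apply, smul_apply, hq,
          SchwartzMap.smulLeftCLM_apply_apply (hasTemperateGrowth_resFun l), smul_eq_mul, resFun]
        field_simp [ofReal_add_I_ne_zero ⟪l, v⟫_ℝ]
        ring
      change (U.symm (R (incl f)), U.symm (incl f - I • R (incl f))) ∈ (toPMap K).graph
      rw [e1, e2]
      exact mem_graph_toPMap K (W q)
  have hcl : (toPMap K).IsClosable := ⟨M, hgraph⟩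
  intro h k
  rw [← hcl.graph_closure_eq_closure_graph, hgraph]
  exact hM h k

/-- Multiplication by a unimodular function, as a unitary operator. -/
def phaseUnitary (S : Plane → ℝ) (hS : Measurable S) : Hil ≃ₗᵢ[ℂ] Hil :=
  have hm : ∀ T : Plane → ℝ, Measurable T → Measurable fun v => cexp (T v * I) := fun T hT => by
    fun_prop
  have hb : ∀ (T : Plane → ℝ) v, ‖cexp (T v * I)‖ ≤ 1 := fun T v => (norm_exp_ofReal_mul_I _).le
  have hinv : ∀ (T T' : Plane → ℝ) (hT : Measurable T) (hT' : Measurable T'),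
      (∀ v, T v + T' v = 0) → ∀ f : Hil, mulOp (fun v => cexp (T v * I)) (hm T hT) 1 (hb T)
        (mulOp (fun v => cexp (T' v * I)) (hm T' hT') 1 (hb T') f) = f := fun T T' hT hT' h f => by
    refine Lp.ext ?_
    filter_upwards [coeFn_mulOp (hm T hT) (hb T) (mulOp (fun v => cexp (T' v * I)) (hm T' hT') 1
      (hb T') f), coeFn_mulOp (hm T' hT') (hb T') f] with v h1 h2
    rw [h1, h2, ← mul_assoc, ← Complex.exp_add, ← add_mul, ← ofReal_add, h]
    simp
  { toFun := mulOp (fun v => cexp (S v * I)) (hm S hS) 1 (hb S)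
    invFun := mulOp (fun v => cexp (((-S v : ℝ) : ℂ) * I)) (hm (fun v => -S v) hS.neg) 1
      (hb fun v => -S v)
    map_add' := map_add _
    map_smul' := map_smul _
    left_inv := hinv (fun v => -S v) S hS.neg hS fun v => by simp
    right_inv := hinv S (fun v => -S v) hS hS.neg fun v => by simp
    norm_map' := fun f => by
      refine le_antisymm ?_ ?_
      · refine Lp.norm_le_norm_of_ae_le ?_
        filter_upwards [coeFn_mulOp (hm S hS) (hb S) f] with v h1
        change ‖(mulOp (fun v => cexp (S v * I)) (hm S hS) 1 (hb S) f : Plane → ℂ) v‖ ≤ _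
        rw [h1, norm_mul, norm_exp_ofReal_mul_I, one_mul]
      · refine Lp.norm_le_norm_of_ae_le ?_
        filter_upwards [coeFn_mulOp (hm S hS) (hb S) f] with v h1
        change _ ≤ ‖(mulOp (fun v => cexp (S v * I)) (hm S hS) 1 (hb S) f : Plane → ℂ) v‖
        rw [h1, norm_mul, norm_exp_ofReal_mul_I, one_mul] }

theorem phaseUnitary_incl {S : Plane → ℝ} (hS : Function.HasTemperateGrowth S)
    (f : 𝓢(Plane, ℂ)) : phaseUnitary S hS.1.continuous.measurable (incl f)
      = incl (SchwartzMap.smulLeftCLM ℂ (fun v => cexp (S v * I)) f) :=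
  (incl_smulLeftCLM (hasTemperateGrowth_cexp_mul_I hS)
    (fun v => (norm_exp_ofReal_mul_I (S v)).le) f).symm

theorem inner_plane (u v : Plane) : ⟪u, v⟫_ℝ = u 0 * v 0 + u 1 * v 1 := by
  simp [PiLp.inner_apply, Fin.sum_univ_two, mul_comm]

theorem expS_apply (β : Fin 2 → ℂ) (f : 𝓢(Plane, ℂ)) (v : Plane) :
    expS β f v = -((⟪(!₂[(β 0).re, (β 1).re] : Plane), v⟫_ℝ : ℝ) : ℂ) * f v
      + I * fderiv ℝ f v (!₂[(β 0).im, (β 1).im] : Plane) := by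
  have e : (!₂[(β 0).im, (β 1).im] : Plane) = (β 0).im • EuclideanSpace.single 0 (1 : ℝ)
      + (β 1).im • EuclideanSpace.single 1 (1 : ℝ) := by
    ext j
    fin_cases j <;> simp
  rw [e, map_add, map_smul, map_smul, inner_plane]
  simp only [expS, neg_apply, add_apply, smul_apply, x_apply, p_apply, smul_eq_mul,
    Complex.real_smul]
  simp
  ring

-- With `u = Re β` and `w = Im β` the operator is `-⟨u, v⟩ + i ∂_w`. If `w = 0` it is already a
-- multiplication. Otherwise a phase `exp(iS)` with `∂_w S = ⟨u, v⟩` conjugates it to `i ∂_w`, which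
-- the Fourier transform turns into multiplication by `-2π⟨w, ξ⟩`.
open FourierTransform LineDeriv in
theorem exists_isMultiplication_expS (β : Fin 2 → ℂ) : ∃ (U : Hil ≃ₗᵢ[ℂ] Hil) (l : Plane),
    IsMultiplication U (fun v => ⟪l, v⟫_ℝ) (toPMap (expS β)).closure := by
  set u : Plane := !₂[(β 0).re, (β 1).re] with hu
  set w : Plane := !₂[(β 0).im, (β 1).im] with hw
  by_cases h0 : w = 0
  · refine ⟨LinearIsometryEquiv.refl ℂ Hil, -u, isMultiplication_closure (V := id) (W := id)
      (fun f => rfl) (fun f => rfl) fun f v => ?_⟩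
    simp only [id]
    rw [expS_apply, ← hu, ← hw, h0, map_zero, mul_zero, add_zero, inner_neg_left, ofReal_neg]
  · have hww : ⟪w, w⟫_ℝ ≠ 0 := inner_self_ne_zero.mpr h0
    -- The first term has `w`-derivative `⟨u, v⟩` plus an unwanted multiple of `⟨w, v⟩`, which the
    -- second term removes.
    let S : Plane → ℝ := fun v =>
      (⟪w, w⟫_ℝ)⁻¹ * (⟪u, v⟫_ℝ * ⟪w, v⟫_ℝ) - (⟪u, w⟫_ℝ / (2 * ⟪w, w⟫_ℝ ^ 2)) * ⟪w, v⟫_ℝ ^ 2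
    have hS : Function.HasTemperateGrowth S :=
      ((Function.HasTemperateGrowth.const _).mul
        ((hasTemperateGrowth_inner u).mul (hasTemperateGrowth_inner w))).sub
      ((Function.HasTemperateGrowth.const _).mul ((hasTemperateGrowth_inner w).pow 2))
    have hSd : ∀ v, ∃ L : Plane →L[ℝ] ℝ, HasFDerivAt S L v ∧ L w = ⟪u, v⟫_ℝ := fun v => by
      have h1 := fun z : Plane => (innerSL ℝ z).hasFDerivAt (x := v)
      refine ⟨_, (((h1 u).mul (h1 w)).const_mul _).sub (((h1 w).pow 2).const_mul _), ?_⟩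
      simp only [sub_apply, smul_apply, add_apply, innerSL_apply_apply, smul_eq_mul]
      simp
      field_simp
      ring
    have hm := hasTemperateGrowth_cexp_mul_I hS
    have hm' := hasTemperateGrowth_cexp_mul_I hS.neg
    refine ⟨(phaseUnitary S hS.1.continuous.measurable).trans (Lp.fourierTransformₗᵢ Plane ℂ),
      (-(2 * Real.pi)) • w, isMultiplication_closure
      (V := fun f => 𝓕 (SchwartzMap.smulLeftCLM ℂ (fun v => cexp (S v * I)) f))
      (W := fun f => SchwartzMap.smulLeftCLM ℂ (fun v => cexp ((-S) v * I)) (𝓕⁻ f))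
      (fun f => ?_) (fun f => ?_) fun f v => ?_⟩
    · rw [LinearIsometryEquiv.trans_apply, phaseUnitary_incl hS]
      exact SchwartzMap.toLp_fourier_eq _
    · have : SchwartzMap.smulLeftCLM ℂ (fun v => cexp (S v * I))
          (SchwartzMap.smulLeftCLM ℂ (fun v => cexp ((-S) v * I)) (𝓕⁻ f)) = 𝓕⁻ f := by
        ext v
        rw [SchwartzMap.smulLeftCLM_apply_apply hm, SchwartzMap.smulLeftCLM_apply_apply hm',
          smul_eq_mul, smul_eq_mul, ← mul_assoc, ← Complex.exp_add]
        simp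
      rw [this, fourier_fourierInv_eq]
    · set q := SchwartzMap.smulLeftCLM ℂ (fun v => cexp (S v * I)) f with hq
      have hqv : (q : Plane → ℂ) = fun v => cexp (S v * I) * f v := by
        funext v
        rw [hq, SchwartzMap.smulLeftCLM_apply_apply hm, smul_eq_mul]
      have e : SchwartzMap.smulLeftCLM ℂ (fun v => cexp (S v * I)) (expS β f) = I • ∂_{w} q := by
        ext v
        obtain ⟨L, hL, hLw⟩ := hSd v
        have hd := (((ofRealCLM.hasFDerivAt.comp v hL).mul_const I).cexp).mul (f.hasFDerivAt v)
        rw [SchwartzMap.smulLeftCLM_apply_apply hm, expS_apply, ← hu, ← hw, smul_apply,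
          SchwartzMap.lineDerivOp_apply_eq_fderiv, hqv]
        erw [hd.fderiv]
        simp only [Function.comp_apply, ofRealCLM_apply, add_apply, smul_apply, smul_eq_mul,
          ContinuousLinearMap.comp_apply, hLw]
        ring_nf
        simp
        ring
      have hin : Function.HasTemperateGrowth fun v : Plane => ⟪v, w⟫_ℝ :=
        Function.hasTemperateGrowth_inner_left w
      rw [e, fourier_smul, SchwartzMap.fourier_lineDerivOp_eq, smul_apply, smul_apply,
        SchwartzMap.smulLeftCLM_apply_apply hin, inner_smul_left, real_inner_comm]
      simp only [smul_eq_mul, Complex.real_smul]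
      simp
      ring_nf
      simp

/-! ### Solutions of the evolution equation generated by the exponent -/

theorem norm_exp_sub_one_sub_id_le_mul_exp (z : ℂ) :
    ‖cexp z - 1 - z‖ ≤ ‖z‖ ^ 2 * Real.exp ‖z‖ := by
  have := Complex.norm_exp_sub_sum_le_norm_mul_exp z 2
  simpa [Finset.sum_range_succ, sub_sub] using this

theorem linBound_nonneg (β : Fin 2 → ℂ) : 0 ≤ linBound β := by unfold linBound; positivity

theorem gaussFun_add_smul (γ β : Fin 2 → ℂ) (h : ℂ) (v : Plane) :
    gaussFun (γ + h • β) v = cexp (-h * (β 0 * v 0 + β 1 * v 1)) * gaussFun γ v := by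
  rw [gaussFun, gaussFun, ← Complex.exp_add]
  congr 1
  simp only [Pi.add_apply, Pi.smul_apply, smul_eq_mul]
  ring

/-- The pointwise derivative in `τ` also holds in `L²`: for `|h| < 1` the second-order remainder is
at most a constant times `h² exp(-‖v‖²/4)`, since the Gaussian absorbs both the polynomial weight
and `exp(linBound β ‖v‖)`. -/
theorem hasDerivAt_incl_gS {D : SOp} {q : Plane → ℂ} (hD : ∀ f v, D f v = q v * f v) {k : ℕ}
    (hq : ∀ v, ‖q v‖ ≤ (1 + ‖v‖) ^ k) (γ β : Fin 2 → ℂ) (τ : ℝ) :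
    HasDerivAt (fun τ : ℝ => incl (D (gS (γ + (τ : ℂ) • β))))
      (incl (D (-linS β (gS (γ + (τ : ℂ) • β))))) τ := by
  set δ := γ + (τ : ℂ) • β with hδ
  obtain ⟨C, hC, hbd⟩ := exists_one_add_pow_mul_exp_le (k + 2) (linBound δ + linBound β)
  have hβ := linBound_nonneg β
  rw [hasDerivAt_iff_isLittleO_nhds_zero]
  refine Asymptotics.IsBigO.trans_isLittleO (g := fun h : ℝ => h ^ 2) ?_ ?_
  · refine Asymptotics.IsBigO.of_bound
      (linBound β ^ 2 * C * ‖memLp_exp_neg_sq_div_four.toLp _‖) ?_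
    have hs : ∀ᶠ h : ℝ in nhds 0, |h| < 1 := by
      have := (continuous_abs (G := ℝ)).tendsto 0
      rw [abs_zero] at this
      exact this.eventually_lt_const one_pos
    filter_upwards [hs] with h hh
    have e : incl (D (gS (γ + ((τ + h : ℝ) : ℂ) • β))) - incl (D (gS δ))
        - h • incl (D (-linS β (gS δ)))
        = incl (D (gS (γ + ((τ + h : ℝ) : ℂ) • β)) - D (gS δ) - (h : ℂ) • D (-linS β (gS δ))) := by
      rw [map_sub, map_sub, map_smul]
      rfl
    rw [e]
    calc _ ≤ (linBound β ^ 2 * C * h ^ 2) * ‖memLp_exp_neg_sq_div_four.toLp _‖ := by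
          refine Lp.norm_le_mul_norm_of_ae_le_mul ?_
          filter_upwards [coeFn_incl (D (gS (γ + ((τ + h : ℝ) : ℂ) • β)) - D (gS δ)
            - (h : ℂ) • D (-linS β (gS δ))), memLp_exp_neg_sq_div_four.coeFn_toLp] with v h1 h2
          rw [h1, h2, Real.norm_of_nonneg (Real.exp_pos _).le]
          have ed : γ + ((τ + h : ℝ) : ℂ) • β = δ + (h : ℂ) • β := by
            rw [hδ, ofReal_add, add_smul, add_assoc]
          set z := β 0 * (v 0 : ℂ) + β 1 * (v 1 : ℂ) with hz
          have hzle : ‖z‖ ≤ linBound β * ‖v‖ := norm_lin_le β v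
          have hval : (D (gS (γ + ((τ + h : ℝ) : ℂ) • β)) - D (gS δ)
              - (h : ℂ) • D (-linS β (gS δ))) v
              = q v * gaussFun δ v * (cexp (-h * z) - 1 - (-h * z)) := by
            simp only [sub_apply, smul_apply, hD, neg_apply, linS_apply, gS_apply, ed,
              gaussFun_add_smul, smul_eq_mul]
            ring
          rw [hval, norm_mul, norm_mul]
          have hhz : ‖-(h : ℂ) * z‖ = |h| * ‖z‖ := by
            rw [norm_mul, norm_neg, norm_real, Real.norm_eq_abs]
          have b1 : ‖cexp (-h * z) - 1 - (-h * z)‖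
              ≤ h ^ 2 * ((linBound β * ‖v‖) ^ 2 * Real.exp (linBound β * ‖v‖)) := by
            refine (norm_exp_sub_one_sub_id_le_mul_exp _).trans ?_
            rw [hhz, mul_pow, sq_abs, mul_assoc]
            refine mul_le_mul_of_nonneg_left (mul_le_mul (pow_le_pow_left₀ (norm_nonneg _) hzle 2)
              (Real.exp_le_exp.mpr ?_) (Real.exp_pos _).le (by positivity)) (sq_nonneg h)
            exact (mul_le_of_le_one_left (norm_nonneg _) hh.le).trans hzle
          have b2 := hbd ‖v‖ (norm_nonneg v)
          calc ‖q v‖ * ‖gaussFun δ v‖ * ‖cexp (-h * z) - 1 - (-h * z)‖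
              ≤ (1 + ‖v‖) ^ k * Real.exp (linBound δ * ‖v‖ - ‖v‖ ^ 2 / 2) *
                (h ^ 2 * ((linBound β * ‖v‖) ^ 2 * Real.exp (linBound β * ‖v‖))) := by
                gcongr
                · exact hq v
                · exact norm_gaussFun_le δ v
            _ = linBound β ^ 2 * h ^ 2 * ((1 + ‖v‖) ^ k * ‖v‖ ^ 2 *
                Real.exp ((linBound δ + linBound β) * ‖v‖ - ‖v‖ ^ 2 / 2)) := by
                have : (linBound δ + linBound β) * ‖v‖ - ‖v‖ ^ 2 / 2
                  = (linBound δ * ‖v‖ - ‖v‖ ^ 2 / 2) + linBound β * ‖v‖ := by ring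
                rw [this, Real.exp_add]
                ring
            _ ≤ linBound β ^ 2 * h ^ 2 * ((1 + ‖v‖) ^ k * (1 + ‖v‖) ^ 2 *
                Real.exp ((linBound δ + linBound β) * ‖v‖ - ‖v‖ ^ 2 / 2)) := by
                gcongr
                linarith
            _ ≤ linBound β ^ 2 * h ^ 2 * (C * Real.exp (-(‖v‖ ^ 2 / 4))) := by
                rw [← pow_add]
                exact mul_le_mul_of_nonneg_left b2 (by positivity)
            _ = _ := by ring
      _ = _ := by
          rw [Real.norm_of_nonneg (sq_nonneg h)]
          ring
  · have := Asymptotics.isLittleO_pow_id (𝕜 := ℝ) (n := 2) (by norm_num)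
    simpa using this

/-- The complex bilinear pairing of `Im β` with `δ`. -/
def imDot (β δ : Fin 2 → ℂ) : ℂ := ((β 0).im : ℂ) * δ 0 + ((β 1).im : ℂ) * δ 1

/-- The solution `exp(-i(τ Im β·γ + τ² Im β·β/2)) exp(-½ x² - (γ + τ β)·x)` of `f' = expS β f`. -/
def gaussCurve (β γ : Fin 2 → ℂ) (τ : ℝ) : 𝓢(Plane, ℂ) :=
  cexp (-I * (τ * imDot β γ + τ ^ 2 / 2 * imDot β β)) • gS (γ + (τ : ℂ) • β)

/-- The first term moves the Gaussian parameter in the direction `β`. The second is a scalar, whose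
integral along `δ = γ + τ β` is the exponent of the prefactor in `gaussCurve`. -/
theorem expS_gS (β δ : Fin 2 → ℂ) :
    expS β (gS δ) = -linS β (gS δ) - (I * imDot β δ) • gS δ := by
  simp only [expS, linS, neg_apply, add_apply, smul_apply, p_gS, imDot]
  rw [show β 0 • x 0 (gS δ) = (((β 0).re : ℂ) + (β 0).im * I) • x 0 (gS δ) by rw [re_add_im],
    show β 1 • x 1 (gS δ) = (((β 1).re : ℂ) + (β 1).im * I) • x 1 (gS δ) by rw [re_add_im]]
  module

theorem p_gaussCurve (j : Fin 2) (β γ : Fin 2 → ℂ) (τ : ℝ) : p j (gaussCurve β γ τ)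
    = I • (x j (gaussCurve β γ τ) + (γ j + τ * β j) • gaussCurve β γ τ) := by
  simp only [gaussCurve, map_smul, p_gS, Pi.add_apply, Pi.smul_apply, smul_eq_mul]
  module

/-- `D` may be applied to the curve `f` before taking its derivative. -/
def Good (β : Fin 2 → ℂ) (f : ℝ → 𝓢(Plane, ℂ)) (D : SOp) : Prop :=
  ∀ τ, HasDerivAt (fun τ => incl (D (f τ))) (incl (D (expS β (f τ)))) τ

theorem Good.add {β : Fin 2 → ℂ} {f : ℝ → 𝓢(Plane, ℂ)} {D E : SOp} (hD : Good β f D)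
    (hE : Good β f E) : Good β f (D + E) := fun τ => by
  simpa using! (hD τ).add (hE τ)

theorem Good.smul {β : Fin 2 → ℂ} {f : ℝ → 𝓢(Plane, ℂ)} {D : SOp} (c : ℂ) (hD : Good β f D) :
    Good β f (c • D) := fun τ => by
  simpa using! (hD τ).const_smul c

theorem good_zero (β : Fin 2 → ℂ) (f : ℝ → 𝓢(Plane, ℂ)) : Good β f 0 := fun τ => by
  simpa using! hasDerivAt_const τ (0 : Hil)

theorem good_gaussCurve_mul (β γ : Fin 2 → ℂ) {D : SOp} {q : Plane → ℂ}
    (hD : ∀ f v, D f v = q v * f v) {k : ℕ} (hq : ∀ v, ‖q v‖ ≤ (1 + ‖v‖) ^ k) :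
    Good β (gaussCurve β γ) D := fun τ => by
  have h1 := hasDerivAt_incl_gS hD hq γ β τ
  have h2 : HasDerivAt (fun τ : ℝ => cexp (-I * (τ * imDot β γ + τ ^ 2 / 2 * imDot β β)))
      (cexp (-I * (τ * imDot β γ + τ ^ 2 / 2 * imDot β β))
        * (-I * (imDot β γ + τ * imDot β β))) τ := by
    refine HasDerivAt.cexp (HasDerivAt.const_mul _ ?_)
    have hid : HasDerivAt (fun τ : ℝ => (τ : ℂ)) 1 τ := HasDerivAt.ofReal_comp (hasDerivAt_id τ)
    have := (hid.mul_const (imDot β γ)).add (((hid.pow 2).div_const 2).mul_const (imDot β β))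
    convert! this using 1
    simp
  have h3 := h2.smul h1
  convert! h3 using 1
  · simp only [gaussCurve, map_smul]
    rfl
  · have : imDot β (γ + (τ : ℂ) • β) = imDot β γ + τ * imDot β β := by
      simp only [imDot, Pi.add_apply, Pi.smul_apply, smul_eq_mul]
      ring
    simp only [gaussCurve, map_smul, expS_gS, this, map_sub]
    module

theorem p_mul_expS (j : Fin 2) (β : Fin 2 → ℂ) :
    p j * expS β = expS β * p j + (I * (β j).re) • 1 := by
  fin_cases j <;>
  · simp only [Fin.zero_eta, Fin.mk_one, expS, mul_neg, neg_mul, mul_add, add_mul, smul_mul_assoc,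
      mul_smul_comm, p_mul_x_self, p_mul_x_of_ne (zero_ne_one : (0 : Fin 2) ≠ 1),
      p_mul_x_of_ne (one_ne_zero : (1 : Fin 2) ≠ 0), p_mul_comm 1 0]
    module

theorem expS_mul_x (j : Fin 2) (β : Fin 2 → ℂ) :
    expS β * x j = x j * expS β + (I * (β j).im) • 1 := by
  fin_cases j <;>
  · simp only [Fin.zero_eta, Fin.mk_one, expS, mul_neg, neg_mul, mul_add, add_mul, smul_mul_assoc,
      mul_smul_comm, p_mul_x_self, p_mul_x_of_ne (zero_ne_one : (0 : Fin 2) ≠ 1),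
      p_mul_x_of_ne (one_ne_zero : (1 : Fin 2) ≠ 0), x_mul_comm 1 0]
    module

/-- Along a Gaussian curve `p_j` can be traded for `x_j` and a scalar affine in `τ`. The derivative
`β_j` of that scalar is matched by the commutators of `expS β` with `p_j` and `x_j`, which supply
`Re β_j` and `Im β_j`. -/
theorem Good.mul_p {β γ : Fin 2 → ℂ} {D : SOp} (j : Fin 2) (hD : Good β (gaussCurve β γ) D)
    (hDx : Good β (gaussCurve β γ) (D * x j)) : Good β (gaussCurve β γ) (D * p j) := fun τ => by
  have hid : HasDerivAt (fun τ : ℝ => γ j + (τ : ℂ) * β j) (β j) τ := by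
    have : HasDerivAt (fun τ : ℝ => (τ : ℂ)) 1 τ := HasDerivAt.ofReal_comp (hasDerivAt_id τ)
    simpa using (this.mul_const (β j)).const_add (γ j)
  have h := ((hDx τ).add (hid.smul (hD τ))).const_smul I
  convert! h using 1
  · funext τ
    simp only [mul_apply_eq_comp, p_gaussCurve, map_smul, map_add]
    rfl
  · set f := gaussCurve β γ τ with hf
    have e1 : p j (expS β f) = expS β (p j f) + (I * (β j).re) • f :=
      congrArg (fun S : SOp => S f) (p_mul_expS j β)
    have e2 : expS β (x j f) = x j (expS β f) + (I * (β j).im) • f :=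
      congrArg (fun S : SOp => S f) (expS_mul_x j β)
    simp only [mul_apply_eq_comp]
    rw [e1, hf, p_gaussCurve, ← hf]
    simp only [map_smul, map_add, e2]
    rw [show β j • incl (D f) = (((β j).re : ℂ) + (β j).im * I) • incl (D f) by rw [re_add_im]]
    module

/-- The operators `D` such that all `D x₁ᵐ x₂ⁿ` may be applied to Gaussian solutions. -/
def goodOps (β γ : Fin 2 → ℂ) : Submodule ℂ SOp where
  carrier := {D | ∀ m n : ℕ, Good β (gaussCurve β γ) (D * (x 0 ^ m * x 1 ^ n))}
  zero_mem' := fun m n => by rw [zero_mul]; exact good_zero _ _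
  add_mem' := fun hD hE m n => by rw [add_mul]; exact (hD m n).add (hE m n)
  smul_mem' := fun c D hD m n => by rw [smul_mul_assoc]; exact (hD m n).smul c

theorem x_pow_mul_x_pow_apply (m n : ℕ) (f : 𝓢(Plane, ℂ)) (v : Plane) :
    (x 0 ^ m * x 1 ^ n) f v = ((v 0 : ℂ) ^ m * (v 1 : ℂ) ^ n) * f v := by
  have h : ∀ (j : Fin 2) (m : ℕ) (f : 𝓢(Plane, ℂ)), (x j ^ m) f v = (v j : ℂ) ^ m * f v := by
    intro j m f
    induction m with
    | zero => simp
    | succ m ih => rw [pow_succ', mul_apply_eq_comp, x_apply, ih, pow_succ']; ring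
  rw [mul_apply_eq_comp, h, h, mul_assoc]

theorem one_mem_goodOps (β γ : Fin 2 → ℂ) : 1 ∈ goodOps β γ := fun m n => by
  rw [one_mul]
  refine good_gaussCurve_mul β γ (x_pow_mul_x_pow_apply m n) (k := m + n) fun v => ?_
  have h : ∀ j, ‖(v j : ℂ)‖ ≤ 1 + ‖v‖ := fun j => by
    have := PiLp.norm_apply_le v j
    rw [norm_real]
    linarith
  rw [norm_mul, norm_pow, norm_pow, pow_add]
  gcongr
  exacts [h 0, h 1]

theorem mul_x_mem_goodOps {β γ : Fin 2 → ℂ} {D : SOp} (hD : D ∈ goodOps β γ) (j : Fin 2) :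
    D * x j ∈ goodOps β γ := fun m n => by
  fin_cases j
  · have := hD (m + 1) n
    rw [pow_succ', mul_assoc (x 0)] at this
    rwa [mul_assoc]
  · have := hD m (n + 1)
    have e : x 0 ^ m * x 1 = x 1 * x 0 ^ m := (Commute.pow_left (x_mul_comm 0 1) m)
    rw [pow_succ', ← mul_assoc (x 0 ^ m), e, mul_assoc (x 1)] at this
    rwa [mul_assoc]

/-- The momentum must be brought to the right of the monomial, next to the Gaussian, before
`Good.mul_p` applies. The commutator only lowers a power of a coordinate, so it stays among the
monomials built into `goodOps`. -/
theorem mul_p_mem_goodOps {β γ : Fin 2 → ℂ} {D : SOp} (hD : D ∈ goodOps β γ) (j : Fin 2) :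
    D * p j ∈ goodOps β γ := by
  suffices h : D * (I • p j) ∈ goodOps β γ by
    have := (goodOps β γ).smul_mem (-I) h
    rw [mul_smul_comm, smul_smul] at this
    simpa using this
  -- The operator `i p_j` is the plain partial derivative, whose commutator with `x_j` is exactly
  -- `1`, as `mul_pow_of_comm_one` requires.
  have hself : ∀ j, (I • p j) * x j - x j * (I • p j) = 1 := fun j => by
    rw [smul_mul_assoc, mul_smul_comm, p_mul_x_self, smul_sub, smul_smul]
    simp
  have hne : ∀ j k, j ≠ k → (I • p j) * x k - x k * (I • p j) = 0 := fun j k h => by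
    rw [smul_mul_assoc, mul_smul_comm, p_mul_x_of_ne h, sub_self]
  have hright : ∀ m n, Good β (gaussCurve β γ) (D * (x 0 ^ m * x 1 ^ n) * (I • p j)) := by
    intro m n
    rw [mul_smul_comm]
    refine Good.smul I (Good.mul_p j (hD m n) ?_)
    fin_cases j
    · have := hD (m + 1) n
      have e : x 1 ^ n * x 0 = x 0 * x 1 ^ n := (Commute.pow_left (x_mul_comm 1 0) n)
      have e' : D * (x 0 ^ m * x 1 ^ n) * x 0 = D * (x 0 ^ (m + 1) * x 1 ^ n) := by
        rw [mul_assoc, mul_assoc, e, pow_succ, mul_assoc]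
      change Good β (gaussCurve β γ) (D * (x 0 ^ m * x 1 ^ n) * x 0)
      rwa [e']
    · have := hD m (n + 1)
      rw [pow_succ, ← mul_assoc (x 0 ^ m), ← mul_assoc] at this
      exact this
  intro m n
  fin_cases j
  · have e0 := mul_pow_of_comm_one (hself 0) m
    have e1 := mul_pow_of_comm_zero (hne 0 1 (by decide)) n
    have e : D * (I • p 0) * (x 0 ^ m * x 1 ^ n)
        = D * (x 0 ^ m * x 1 ^ n) * (I • p 0) + (m : ℂ) • (D * (x 0 ^ (m - 1) * x 1 ^ n)) := by
      rw [mul_assoc, ← mul_assoc (I • p 0), e0, add_mul, mul_assoc (x 0 ^ m), e1, mul_add,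
        smul_mul_assoc, mul_assoc D, mul_assoc (x 0 ^ m)]
      simp only [mul_smul_comm]
    change Good β (gaussCurve β γ) (D * (I • p 0) * (x 0 ^ m * x 1 ^ n))
    rw [e]
    exact (hright m n).add ((hD _ _).smul _)
  · have e0 := mul_pow_of_comm_zero (hne 1 0 (by decide)) m
    have e1 := mul_pow_of_comm_one (hself 1) n
    have e : D * (I • p 1) * (x 0 ^ m * x 1 ^ n)
        = D * (x 0 ^ m * x 1 ^ n) * (I • p 1) + (n : ℂ) • (D * (x 0 ^ m * x 1 ^ (n - 1))) := by
      rw [mul_assoc, ← mul_assoc (I • p 1), e0, mul_assoc (x 0 ^ m), e1, mul_add, mul_add,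
        mul_assoc D, mul_assoc (x 0 ^ m)]
      simp only [mul_smul_comm]
    change Good β (gaussCurve β γ) (D * (I • p 1) * (x 0 ^ m * x 1 ^ n))
    rw [e]
    exact (hright m n).add ((hD _ _).smul _)

theorem mul_creS_mem_goodOps {β γ : Fin 2 → ℂ} {D : SOp} (hD : D ∈ goodOps β γ) (j : Fin 2) :
    D * creS j ∈ goodOps β γ := by
  have hx := mul_x_mem_goodOps hD
  have hp := mul_p_mem_goodOps hD
  fin_cases j
  · have : D * creS 0 = (1 / 2 : ℂ) • (D * x 0 - I • (D * p 0) - I • (D * x 1) - D * p 1) := by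
      simp only [creS, Matrix.cons_val_zero, mul_smul_comm, mul_sub]
    change D * creS 0 ∈ goodOps β γ
    rw [this]
    exact Submodule.smul_mem _ _ (Submodule.sub_mem _ (Submodule.sub_mem _ (Submodule.sub_mem _
      (hx 0) (Submodule.smul_mem _ _ (hp 0))) (Submodule.smul_mem _ _ (hx 1))) (hp 1))
  · have : D * creS 1 = (1 / 2 : ℂ) • (I • (D * x 0) + D * p 0 - D * x 1 + I • (D * p 1)) := by
      simp only [creS, Matrix.cons_val_one, Matrix.cons_val_fin_one, mul_smul_comm, mul_sub,
        mul_add]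
    change D * creS 1 ∈ goodOps β γ
    rw [this]
    exact Submodule.smul_mem _ _ (Submodule.add_mem _ (Submodule.sub_mem _ (Submodule.add_mem _
      (Submodule.smul_mem _ _ (hx 0)) (hp 0)) (hx 1)) (Submodule.smul_mem _ _ (hp 1)))

/-! ### The ladder of solutions -/

/-- The creation operators transported along the evolution. -/
def creCurve (A B s t : ℝ) (τ : ℝ) (j : Fin 2) : SOp :=
  creS j - ((τ : ℂ) * (conj (kc A B s t j) / 2)) • 1

/-- The exponent is linear in the bosons, so this commutator is a scalar and the transported
creation operator `creCurve` is affine in `τ`. -/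
theorem expS_mul_creS (A B s t : ℝ) (j : Fin 2) : expS (alpha A B s t) * creS j
    = creS j * expS (alpha A B s t) - (conj (kc A B s t j) / 2) • 1 := by
  have hac : ∀ i, annS i * creS j = creS j * annS i + if i = j then 1 else 0 := fun i => by
    rw [← annS_mul_creS i j]; abel
  rw [← expS_alpha]
  simp only [smul_mul_assoc, mul_smul_comm, add_mul, mul_add, hac, creS_mul_comm j]
  fin_cases j <;>
  · simp only [Fin.zero_eta, Fin.mk_one, if_true, zero_ne_one, one_ne_zero, if_false]
    module

/-- Differentiating the explicit `τ` in `creCurve` produces the commutator of `expS_mul_creS`, so a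
transported creation operator maps solutions to solutions. Quantifying over all of `goodOps`, which
is stable under right multiplication by `creS`, lets the argument be iterated. -/
theorem good_creCurve {A B s t : ℝ} {γ : Fin 2 → ℂ} {f : ℝ → 𝓢(Plane, ℂ)}
    (hf : ∀ D ∈ goodOps (alpha A B s t) γ, Good (alpha A B s t) f D) (j : Fin 2) :
    ∀ D ∈ goodOps (alpha A B s t) γ,
      Good (alpha A B s t) (fun τ => creCurve A B s t τ j (f τ)) D := by
  intro D hD τ
  set κ := conj (kc A B s t j) / 2 with hκ
  have hid : HasDerivAt (fun τ : ℝ => (τ : ℂ) * κ) κ τ := by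
    have : HasDerivAt (fun τ : ℝ => (τ : ℂ)) 1 τ := HasDerivAt.ofReal_comp (hasDerivAt_id τ)
    simpa using this.mul_const κ
  have h := (hf _ (mul_creS_mem_goodOps hD j) τ).sub (hid.smul (hf D hD τ))
  convert! h using 1
  · funext τ
    simp only [creCurve, sub_apply, smul_apply, one_apply_eq_self, map_sub, map_smul,
      mul_apply_eq_comp]
    rfl
  · have e : expS (alpha A B s t) (creS j (f τ))
        = creS j (expS (alpha A B s t) (f τ)) - κ • f τ :=
      congrArg (fun S : SOp => S (f τ)) (expS_mul_creS A B s t j)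
    simp only [creCurve, sub_apply, smul_apply, one_apply_eq_self, map_sub, map_smul,
      mul_apply_eq_comp, e]
    module

/-- The solutions that start at the unnormalized oscillator states. -/
def ladderCurve (A B s t : ℝ) (n : ℕ × ℕ) (τ : ℝ) : 𝓢(Plane, ℂ) :=
  (creCurve A B s t τ 0 ^ n.1) ((creCurve A B s t τ 1 ^ n.2) (gaussCurve (alpha A B s t) 0 τ))

theorem good_pow_creCurve {A B s t : ℝ} {γ : Fin 2 → ℂ} {f : ℝ → 𝓢(Plane, ℂ)}
    (hf : ∀ D ∈ goodOps (alpha A B s t) γ, Good (alpha A B s t) f D) (j : Fin 2) (n : ℕ) :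
    ∀ D ∈ goodOps (alpha A B s t) γ,
      Good (alpha A B s t) (fun τ => (creCurve A B s t τ j ^ n) (f τ)) D := by
  induction n with
  | zero => simpa using hf
  | succ n ih =>
    simp only [pow_succ']
    exact good_creCurve ih j

theorem hasDerivAt_ladderCurve (A B s t : ℝ) (n : ℕ × ℕ) (τ : ℝ) :
    HasDerivAt (fun τ => incl (ladderCurve A B s t n τ))
      (incl (expS (alpha A B s t) (ladderCurve A B s t n τ))) τ := by
  have h0 : ∀ D ∈ goodOps (alpha A B s t) 0,
      Good (alpha A B s t) (gaussCurve (alpha A B s t) 0) D := fun D hD => by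
    simpa using hD 0 0
  exact good_pow_creCurve (good_pow_creCurve h0 1 n.2) 0 n.1 1 (one_mem_goodOps _ _) τ

/-! ### Exponentials of self-adjoint operators -/

section Exponential

variable {H : Type*} [NormedAddCommGroup H] [InnerProductSpace ℂ H]
  {K T : H →ₗ.[ℂ] H}

theorem IsExp.isSelfAdjoint [CompleteSpace H] (h : IsExp K T) : IsSelfAdjoint T := by
  obtain ⟨X, _, μ, U, g, hg, -, hT⟩ := h
  exact hT.isSelfAdjoint (Real.measurable_exp.comp hg)

theorem IsExp.inner_symm (h : IsExp K T) {f f' k k' : H} (hf : (f, f') ∈ T.graph)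
    (hk : (k, k') ∈ T.graph) : ⟪f', k⟫_ℂ = ⟪f, k'⟫_ℂ := by
  obtain ⟨X, _, μ, U, g, -, -, hT⟩ := h
  rw [hT] at hf hk
  rw [← U.inner_map_map, ← U.inner_map_map f]
  refine inner_eq_of_ae ?_
  filter_upwards [hf, hk] with x h1 h2
  rw [h1, h2, map_mul, conj_ofReal]
  ring

theorem IsExp.ker_eq_bot (h : IsExp K T) : LinearMap.ker T.toFun = ⊥ := by
  obtain ⟨X, _, μ, U, g, -, -, hT⟩ := h
  rw [LinearMap.ker_eq_bot']
  intro f hf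
  have hz := T.mem_graph f
  rw [show T f = 0 from hf, hT] at hz
  have : U (f : H) = 0 := by
    refine Lp.ext ?_
    filter_upwards [hz, Lp.coeFn_zero ℂ 2 μ] with x h1 h2
    rw [map_zero, h2, Pi.zero_apply, eq_comm, mul_eq_zero, ofReal_eq_zero] at h1
    rw [h2, Pi.zero_apply]
    exact h1.resolve_left (Real.exp_ne_zero _)
  exact Subtype.ext (by simpa using this)

theorem IsExp.mem_graph_inverse (h : IsExp K T) {f f' : H} (hf : (f, f') ∈ T.graph) :
    (f', f) ∈ T.inverse.graph := by
  rw [LinearPMap.inverse_graph h.ker_eq_bot]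
  exact ⟨(f, f'), hf, rfl⟩

theorem exists_mem_graph_of_mem_inverse_domain {f : H}
    (hf : f ∈ T.inverse.domain) : ∃ f₀, (f₀, f) ∈ T.graph := by
  rw [LinearPMap.inverse_domain] at hf
  obtain ⟨y, rfl⟩ := hf
  exact ⟨y, T.mem_graph y⟩

/-- In the spectral representation a unit of time is multiplication by `exp g`. Membership in the
domain of `T` comes for free, since the value at time `τ + 1` is known to be in `H`. -/
theorem IsExp.mem_graph_of_hasDerivAt (h : IsExp K T) {f k : ℝ → H}
    (hf : ∀ τ, HasDerivAt f (k τ) τ) (hk : ∀ τ, (f τ, k τ) ∈ K.graph) (τ : ℝ) :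
    (f τ, f (τ + 1)) ∈ T.graph := by
  obtain ⟨X, _, μ, U, g, hg, hK, hT⟩ := h
  rw [hT]
  filter_upwards [hK.ae_eq_exp_of_hasDerivAt hg hf hk τ,
    hK.ae_eq_exp_of_hasDerivAt hg hf hk (τ + 1)] with x h1 h2
  rw [h1, h2, ← mul_assoc, ← ofReal_mul, ← Real.exp_add]
  congr 4
  ring

/-- Write `g = T g₀`. Then `⟨f, g⟩ = ⟨T f, g₀⟩`, and Parseval's identity for `e` has the
coefficients `⟨T f, e_n⟩ = ⟨f, φ_n⟩` and `⟨e_n, g₀⟩ = ⟨Ψ_n, g⟩`. The other expansion exchanges the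
roles of `f` and `g`. Density holds because every `e_n` lies in both domains. -/
theorem IsExp.isQuasiBases [CompleteSpace H] (h : IsExp K T) {ι : Type*} {e φ Ψ : ι → H} (he : Orthonormal ℂ e)
    (hspan : (Submodule.span ℂ (Set.range e)).topologicalClosure = ⊤)
    (hφ : ∀ n, (e n, φ n) ∈ T.graph) (hΨ : ∀ n, (Ψ n, e n) ∈ T.graph)
    (hφ' : ∀ n, φ n ∈ T.domain) (hΨ' : ∀ n, Ψ n ∈ T.inverse.domain) :
    IsQuasiBases (T.domain ⊓ T.inverse.domain) φ Ψ := by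
  let bas := HilbertBasis.mk he hspan.ge
  have hb : ∀ n, bas n = e n := fun n => by simp [bas]
  have hsum : ∀ f g, HasSum (fun n => ⟪f, e n⟫_ℂ * ⟪e n, g⟫_ℂ) ⟪f, g⟫_ℂ := fun f g => by
    simpa only [hb] using bas.hasSum_inner_mul_inner f g
  refine ⟨?_, fun n => ⟨hφ' n, ?_⟩, fun n => ⟨?_, hΨ' n⟩, ?_, ?_⟩
  · have hle : Submodule.span ℂ (Set.range e) ≤ T.domain ⊓ T.inverse.domain := by
      refine Submodule.span_le.mpr ?_
      rintro _ ⟨n, rfl⟩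
      exact ⟨LinearPMap.mem_domain_of_mem_graph (hφ n),
        LinearPMap.mem_domain_of_mem_graph (h.mem_graph_inverse (hΨ n))⟩
    exact (Submodule.dense_iff_topologicalClosure_eq_top.mpr hspan).mono hle
  · exact LinearPMap.mem_domain_of_mem_graph (h.mem_graph_inverse (hφ n))
  · exact LinearPMap.mem_domain_of_mem_graph (hΨ n)
  · rintro f ⟨hf, -⟩ g ⟨-, hg⟩
    obtain ⟨g₀, hg₀⟩ := exists_mem_graph_of_mem_inverse_domain hg
    have hf₁ := T.mem_graph ⟨f, hf⟩
    have := hsum (T ⟨f, hf⟩) g₀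
    rw [h.inner_symm hf₁ hg₀] at this
    refine this.congr_fun ?_
    intro n
    rw [h.inner_symm hf₁ (hφ n), h.inner_symm (hΨ n) hg₀]
  · rintro f ⟨-, hf⟩ g ⟨hg, -⟩
    obtain ⟨f₀, hf₀⟩ := exists_mem_graph_of_mem_inverse_domain hf
    have hg₁ := T.mem_graph ⟨g, hg⟩
    have := hsum f₀ (T ⟨g, hg⟩)
    rw [← h.inner_symm hf₀ hg₁] at this
    refine this.congr_fun ?_
    intro n
    rw [h.inner_symm hf₀ (hΨ n), h.inner_symm (hφ n) hg₁]

theorem IsQuasiBases.smul {ι : Type*} {G : Submodule ℂ H} {φ Ψ : ι → H}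
    (h : IsQuasiBases G φ Ψ) {c d : ℂ} (hcd : conj c * d = 1) :
    IsQuasiBases G (fun n => c • φ n) (fun n => d • Ψ n) := by
  have hdc : conj d * c = 1 := by simpa [mul_comm] using congrArg conj hcd
  refine ⟨h.dense, fun n => G.smul_mem c (h.mem_left n), fun n => G.smul_mem d (h.mem_right n),
    fun f hf g hg => ?_, fun f hf g hg => ?_⟩
  · refine (h.hasSum_left f hf g hg).congr_fun ?_
    intro n
    rw [inner_smul_left, inner_smul_right]
    linear_combination (⟪f, φ n⟫_ℂ * ⟪Ψ n, g⟫_ℂ) * hdc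
  · refine (h.hasSum_right f hf g hg).congr_fun ?_
    intro n
    rw [inner_smul_left, inner_smul_right]
    linear_combination (⟪f, Ψ n⟫_ℂ * ⟪φ n, g⟫_ℂ) * hcd

end Exponential

/-! ### The states as points of one curve -/

theorem mem_graph_closure_exponent (A B s t : ℝ) (f : 𝓢(Plane, ℂ)) :
    (incl f, incl (expS (alpha A B s t) f)) ∈ (exponent A B s t).closure.graph := by
  rw [exponent_eq]
  exact LinearPMap.le_graph_of_le (LinearPMap.le_closure _) (mem_graph_toPMap _ f)

/-- The solutions that start at the oscillator states `χ_n`. -/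
def stateCurve (A B s t : ℝ) (n : ℕ × ℕ) (τ : ℝ) : Hil :=
  (ladderConst n * ((1 / Real.sqrt Real.pi : ℝ) : ℂ)) • incl (ladderCurve A B s t n τ)

theorem IsExp.mem_graph_stateCurve {A B s t : ℝ} {T : Hil →ₗ.[ℂ] Hil}
    (h : IsExp (exponent A B s t).closure T) (n : ℕ × ℕ) (τ : ℝ) :
    (stateCurve A B s t n τ, stateCurve A B s t n (τ + 1)) ∈ T.graph :=
  T.graph.smul_mem _ (h.mem_graph_of_hasDerivAt (hasDerivAt_ladderCurve A B s t n)
    (fun _ => mem_graph_closure_exponent A B s t _) τ)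

theorem gaussCurve_zero (β γ : Fin 2 → ℂ) : gaussCurve β γ 0 = gS γ := by
  simp [gaussCurve]

theorem stateCurve_zero (A B s t : ℝ) (n : ℕ × ℕ) : stateCurve A B s t n 0 = chi n := by
  have : creCurve A B s t 0 = creS := by
    funext j
    simp [creCurve]
  rw [stateCurve, ladderCurve, gaussCurve_zero, this, chi_eq, oscS]

/-- The normalization constant of the vacua `T χ_{0,0}` and `T⁻¹ χ_{0,0}`. -/
def vacConst (A B s t : ℝ) : ℂ :=
  ((1 / Real.sqrt Real.pi : ℝ) : ℂ) *
    cexp (-I * (1 / 2 * imDot (alpha A B s t) (alpha A B s t)))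

theorem vacConst_ne_zero (A B s t : ℝ) : vacConst A B s t ≠ 0 := by
  refine mul_ne_zero ?_ (Complex.exp_ne_zero _)
  rw [ofReal_ne_zero]
  have := Real.pi_pos
  positivity

theorem phi0_eq (A B s t : ℝ) (M : ℂ) : phi0 A B s t M = incl (M • gS (alpha A B s t)) := by
  rw [phi0, map_smul, incl_gS]

theorem psi0_eq (A B s t : ℝ) (M : ℂ) : psi0 A B s t M = incl (M • gS (-alpha A B s t)) := by
  rw [psi0, map_smul, incl_gS]

theorem phi_eq_incl (A B s t : ℝ) (M : ℂ) (n : ℕ × ℕ) : phi A B s t M n = ladderConst n •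
    incl ((bS A B s t 0 ^ n.1) ((bS A B s t 1 ^ n.2) (M • gS (alpha A B s t)))) := by
  rw [phi, phi0_eq]
  exact ladder_incl (S := bS A B s t) (fun j => acts_toPMap _) _ n

theorem psi_eq_incl (A B s t : ℝ) (M : ℂ) (n : ℕ × ℕ) : psi A B s t M n = ladderConst n •
    incl (((creS 0 + (conj (kc A B s t 0) / 2) • 1) ^ n.1)
      (((creS 1 + (conj (kc A B s t 1) / 2) • 1) ^ n.2) (M • gS (-alpha A B s t)))) := by
  rw [psi, psi0_eq]
  exact ladder_incl (S := fun j => creS j + (conj (kc A B s t j) / 2) • 1)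
    (fun j => (formalAdj_aS A B s t j).acts_adjoint) _ n

theorem phi_eq (A B s t : ℝ) (M : ℂ) (n : ℕ × ℕ) :
    phi A B s t M n = (M / vacConst A B s t) • stateCurve A B s t n 1 := by
  have hc : creCurve A B s t 1 = bS A B s t := by
    funext j
    simp [creCurve, bS_eq]
  have hg : ((1 / Real.sqrt Real.pi : ℝ) : ℂ) • gaussCurve (alpha A B s t) 0 1
      = vacConst A B s t • gS (alpha A B s t) := by
    simp only [gaussCurve, vacConst, imDot, smul_smul]
    simp
  have hM : M • gS (alpha A B s t) = (M / vacConst A B s t) •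
      ((1 / Real.sqrt Real.pi : ℝ) : ℂ) • gaussCurve (alpha A B s t) 0 1 := by
    rw [hg, smul_smul, div_mul_cancel₀ _ (vacConst_ne_zero A B s t)]
  rw [phi_eq_incl, stateCurve, ladderCurve, hc, hM]
  simp only [map_smul, smul_smul]
  congr 1
  ring

/-- The constant is the same as in `phi_eq`: for a curve starting at `γ = 0` the prefactor depends
on `τ` only through `τ²`. -/
theorem psi_eq (A B s t : ℝ) (M : ℂ) (n : ℕ × ℕ) :
    psi A B s t M n = (M / vacConst A B s t) • stateCurve A B s t n (-1) := by
  have hc : ∀ j, creCurve A B s t (-1) j = creS j + (conj (kc A B s t j) / 2) • 1 := fun j => by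
    rw [creCurve, ofReal_neg, ofReal_one, neg_one_mul, neg_smul, sub_neg_eq_add]
  have hg : ((1 / Real.sqrt Real.pi : ℝ) : ℂ) • gaussCurve (alpha A B s t) 0 (-1)
      = vacConst A B s t • gS (-alpha A B s t) := by
    simp only [gaussCurve, vacConst, imDot, smul_smul]
    simp
  have hM : M • gS (-alpha A B s t) = (M / vacConst A B s t) •
      ((1 / Real.sqrt Real.pi : ℝ) : ℂ) • gaussCurve (alpha A B s t) 0 (-1) := by
    rw [hg, smul_smul, div_mul_cancel₀ _ (vacConst_ne_zero A B s t)]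
  rw [psi_eq_incl, stateCurve, ladderCurve, hc, hc, hM]
  simp only [map_smul, smul_smul]
  congr 1
  ring

theorem phi_zero (A B s t : ℝ) (M : ℂ) : phi A B s t M (0, 0) = phi0 A B s t M := by
  simp [phi, ladder]

theorem psi_zero (A B s t : ℝ) (M : ℂ) : psi A B s t M (0, 0) = psi0 A B s t M := by
  simp [psi, ladder]

/-- This is `⟨T χ_n, T⁻¹ χ_m⟩ = ⟨χ_n, χ_m⟩`, with `T` moved across by symmetry. -/
theorem IsExp.inner_stateCurve {A B s t : ℝ} {T : Hil →ₗ.[ℂ] Hil}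
    (h : IsExp (exponent A B s t).closure T) (n m : ℕ × ℕ) :
    ⟪stateCurve A B s t n 1, stateCurve A B s t m (-1)⟫_ℂ = if n = m then 1 else 0 := by
  have h1 := h.mem_graph_stateCurve n 0
  have h2 := h.mem_graph_stateCurve m (-1)
  rw [zero_add] at h1
  rw [neg_add_cancel] at h2
  rw [h.inner_symm h1 h2, stateCurve_zero, stateCurve_zero, orthonormal_iff_ite.mp orthonormal_chi]

theorem IsExp.inner_phi_psi {A B s t : ℝ} {T : Hil →ₗ.[ℂ] Hil}
    (h : IsExp (exponent A B s t).closure T) (M M' : ℂ) (n m : ℕ × ℕ) :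
    ⟪phi A B s t M n, psi A B s t M' m⟫_ℂ =
      conj (M / vacConst A B s t) * (M' / vacConst A B s t) * if n = m then 1 else 0 := by
  rw [phi_eq, psi_eq, inner_smul_left, inner_smul_right, h.inner_stateCurve, mul_assoc]

/-! ### Unboundedness -/

theorem norm_sq_gauss (β : Fin 2 → ℂ) :
    ‖gauss β‖ ^ 2 = Real.pi * Real.exp ((β 0).re ^ 2 + (β 1).re ^ 2) := by
  have h := inner_gauss β β
  rw [inner_self_eq_norm_sq_to_K] at h
  have e : ((conj (β 0) + β 0) ^ 2 + (conj (β 1) + β 1) ^ 2) / 4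
      = (((β 0).re ^ 2 + (β 1).re ^ 2 : ℝ) : ℂ) := by
    rw [add_comm (conj (β 0)), add_comm (conj (β 1)), add_conj, add_conj]
    push_cast
    ring
  rw [e, ← ofReal_exp] at h
  have h' : ((‖gauss β‖ ^ 2 : ℝ) : ℂ)
      = ((Real.pi * Real.exp ((β 0).re ^ 2 + (β 1).re ^ 2) : ℝ) : ℂ) := by
    rw [ofReal_mul, ← h]
    norm_cast
  exact ofReal_injective h'

theorem norm_sq_gaussCurve (β : Fin 2 → ℂ) (m τ : ℝ) :
    ‖incl (gaussCurve β ((m : ℂ) • β) τ)‖ ^ 2 =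
      Real.pi * Real.exp ((2 * m * τ + τ ^ 2) * ((β 0).im ^ 2 + (β 1).im ^ 2)
        + (m + τ) ^ 2 * ((β 0).re ^ 2 + (β 1).re ^ 2)) := by
  have e : (-I * (τ * imDot β ((m : ℂ) • β) + τ ^ 2 / 2 * imDot β β)).re
      = (m * τ + τ ^ 2 / 2) * ((β 0).im ^ 2 + (β 1).im ^ 2) := by
    have : -I * (τ * imDot β ((m : ℂ) • β) + τ ^ 2 / 2 * imDot β β)
        = ((m * τ + τ ^ 2 / 2 : ℝ) : ℂ) * (-I * imDot β β) := by
      simp only [imDot, Pi.smul_apply, smul_eq_mul]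
      push_cast
      ring
    rw [this, re_ofReal_mul]
    congr 1
    simp [imDot]
    ring
  rw [gaussCurve, map_smul, norm_smul, mul_pow, incl_gS, norm_sq_gauss, Complex.norm_exp, e,
    ← Real.exp_nat_mul, mul_left_comm, ← Real.exp_add]
  congr 2
  simp only [Pi.add_apply, Pi.smul_apply, smul_eq_mul, add_re, re_ofReal_mul]
  push_cast
  ring

theorem alpha_ne_zero {A B : ℝ} (h : (A, B) ≠ (0, 0)) (s t : ℝ) : alpha A B s t ≠ 0 := by
  intro h0
  apply h
  have e0 := alpha_add A B s t
  have e1 := alpha_sub A B s t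
  rw [h0] at e0 e1
  simp only [Pi.zero_apply, mul_zero, add_zero, sub_zero, kc, Matrix.cons_val_zero,
    Matrix.cons_val_one] at e0 e1
  have r0 := congrArg re e0
  have i0 := congrArg im e0
  have r1 := congrArg re e1
  have i1 := congrArg im e1
  simp at r0 i0 r1 i1
  have hA : A = 0 := by linarith
  have hB : B = 0 := by linarith
  rw [hA, hB]

/-- Applied to the Gaussian with parameter `m α`, `T` multiplies the squared norm by `exp((2m +
1)|α|²)`. This is unbounded in `m`, because `α` vanishes only when `A = B = 0`. -/
theorem IsExp.not_bounded {A B s t : ℝ} {T : Hil →ₗ.[ℂ] Hil}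
    (h : IsExp (exponent A B s t).closure T) (hAB : (A, B) ≠ (0, 0)) :
    ¬ ∃ C : ℝ, ∀ f : T.domain, ‖T f‖ ≤ C * ‖(f : Hil)‖ := by
  rintro ⟨C, hC⟩
  have hα := alpha_ne_zero hAB s t
  set β := alpha A B s t with hβ
  set R := (β 0).re ^ 2 + (β 1).re ^ 2 with hR
  set J := (β 0).im ^ 2 + (β 1).im ^ 2 with hJ
  have hpos : 0 < R + J := by
    by_contra hn
    apply hα
    have h1 := sq_nonneg (β 0).re
    have h2 := sq_nonneg (β 1).re
    have h3 := sq_nonneg (β 0).im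
    have h4 := sq_nonneg (β 1).im
    have z0 : β 0 = 0 := Complex.ext (pow_eq_zero_iff two_ne_zero |>.mp (by linarith))
      (pow_eq_zero_iff two_ne_zero |>.mp (by linarith))
    have z1 : β 1 = 0 := Complex.ext (pow_eq_zero_iff two_ne_zero |>.mp (by linarith))
      (pow_eq_zero_iff two_ne_zero |>.mp (by linarith))
    funext j
    fin_cases j
    exacts [z0, z1]
  have key : ∀ m : ℝ, Real.exp ((2 * m + 1) * (R + J)) ≤ C ^ 2 := by
    intro m
    have hd : ∀ τ, HasDerivAt (fun τ => incl (gaussCurve β ((m : ℂ) • β) τ))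
        (incl (expS β (gaussCurve β ((m : ℂ) • β) τ))) τ := fun τ => by
      simpa using one_mem_goodOps β ((m : ℂ) • β) 0 0 τ
    have hm := h.mem_graph_of_hasDerivAt hd (fun _ => mem_graph_closure_exponent A B s t _) 0
    rw [zero_add] at hm
    obtain ⟨y, hy1, hy2⟩ := (LinearPMap.mem_graph_iff _).mp hm
    have hb := hC y
    simp only at hy1 hy2
    rw [hy1, hy2] at hb
    have hsq := pow_le_pow_left₀ (norm_nonneg _) hb 2
    rw [mul_pow, norm_sq_gaussCurve, norm_sq_gaussCurve, ← hR, ← hJ] at hsq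
    have e : (2 * m * 1 + 1 ^ 2) * J + (m + 1) ^ 2 * R
        = (2 * m + 1) * (R + J) + ((2 * m * 0 + 0 ^ 2) * J + (m + 0) ^ 2 * R) := by ring
    rw [e, Real.exp_add, mul_left_comm] at hsq
    exact le_of_mul_le_mul_right hsq (by have := Real.pi_pos; positivity)
  -- For this `m` the exponent is `C² + (R + J)`, and `exp y ≥ y + 1` then exceeds `C²`.
  have := key (C ^ 2 / (2 * (R + J)))
  have h2 := Real.add_one_le_exp ((2 * (C ^ 2 / (2 * (R + J))) + 1) * (R + J))
  have h3 : (2 * (C ^ 2 / (2 * (R + J))) + 1) * (R + J) = C ^ 2 + (R + J) := by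
    field_simp
  rw [h3] at h2 this
  linarith

/-! ### The vacua -/

theorem ev_a_phi0 (A B s t : ℝ) (M : ℂ) (j : Fin 2) : ev (a A B s t j) (phi0 A B s t M) = 0 := by
  have h := annS_gS_smul_alpha A B s t 1 j
  rw [one_smul, one_mul] at h
  rw [phi0_eq, a, ev_toPMap, aS_eq, add_apply, map_smul, smul_apply, one_apply_eq_self, h,
    smul_comm, ← add_smul, neg_add_cancel, zero_smul, map_zero]

theorem ev_b_adjoint_psi0 (A B s t : ℝ) (M : ℂ) (j : Fin 2) :
    ev (b A B s t j).adjoint (psi0 A B s t M) = 0 := by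
  have h := annS_gS_smul_alpha A B s t (-1) j
  rw [neg_one_smul, neg_one_mul, neg_div, neg_neg] at h
  rw [psi0_eq, b, (formalAdj_bS A B s t j).ev_adjoint, sub_apply, map_smul, smul_apply,
    one_apply_eq_self, h, smul_comm, sub_self, map_zero]

theorem exists_ev_b_ne (A B s t : ℝ) (j : Fin 2) (hk : kc A B s t j ≠ 0) :
    ∃ f ∈ schwartzD, ev (b A B s t j) f ≠ ev (a A B s t j).adjoint f := by
  refine ⟨incl (gS 0), incl_mem _, fun h => ?_⟩
  rw [a, b, ev_toPMap, (formalAdj_aS A B s t j).ev_adjoint, bS_eq] at h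
  -- The two operators differ by the scalar `conj(k_j)`, so one nonzero value of the Gaussian
  -- suffices.
  have h1 := congrArg (fun f : 𝓢(Plane, ℂ) => f 0) (incl_injective h)
  simp only [sub_apply, add_apply, smul_apply, one_apply_eq_self, gS_apply, smul_eq_mul] at h1
  have hg : gaussFun 0 0 ≠ 0 := Complex.exp_ne_zero _
  have h2 : conj (kc A B s t j) * gaussFun 0 0 = 0 := by linear_combination -h1
  rcases mul_eq_zero.mp h2 with h3 | h3
  · exact hk (by simpa using h3)
  · exact hg h3

theorem exists_isExp_exponent (A B s t : ℝ) :
    IsSelfAdjoint (exponent A B s t).closure ∧ ∃ T, IsExp (exponent A B s t).closure T := by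
  obtain ⟨U, l, h⟩ := exists_isMultiplication_expS (alpha A B s t)
  have hm : Measurable fun v : Plane => ⟪l, v⟫_ℝ := by fun_prop
  rw [exponent_eq]
  obtain ⟨T, hT⟩ := exists_isMultiplication U fun v : Plane => Real.exp ⟪l, v⟫_ℝ
  exact ⟨h.isSelfAdjoint hm, T, Plane, inferInstance, volume, U, _, hm, h, hT⟩

end NCPB

end

theorem mainTheorem3 (A B : ℝ) :
    -- the model, up to terms of order at least two in `θ`, `θ̃`
    (∀ j k, NCPB.EqModQuadratic
        (fun s t => NCPB.xHat s j * NCPB.pHat t k - NCPB.pHat t k * NCPB.xHat s j)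
        (fun _ _ => if j = k then Complex.I • 1 else 0)) ∧
    (∀ j k, NCPB.EqModQuadratic
        (fun s _ => NCPB.xHat s j * NCPB.xHat s k - NCPB.xHat s k * NCPB.xHat s j)
        (fun s _ => (Complex.I * (s : ℂ) * NCPB.eps j k) • 1)) ∧
    (∀ j k, NCPB.EqModQuadratic
        (fun _ t => NCPB.pHat t j * NCPB.pHat t k - NCPB.pHat t k * NCPB.pHat t j)
        (fun _ t => (Complex.I * (t : ℂ) * NCPB.eps j k) • 1)) ∧
    NCPB.EqModQuadratic (NCPB.hHat A B) (NCPB.hTrunc A B) ∧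
    NCPB.EqModQuadratic (NCPB.hHat A B) (NCPB.hNumber A B) ∧
    -- the pseudo-bosonic structure
    ∀ s t : ℝ,
      NCPB.IsPseudoBosonic NCPB.schwartzD (NCPB.a A B s t) (NCPB.b A B s t) ∧
      (∀ j, NCPB.kc A B s t j ≠ 0 → ∃ f ∈ NCPB.schwartzD,
        NCPB.ev (NCPB.b A B s t j) f ≠ NCPB.ev (NCPB.a A B s t j).adjoint f) ∧
      (∀ M M' : ℂ,
        (∀ j, NCPB.ev (NCPB.a A B s t j) (NCPB.phi0 A B s t M) = 0) ∧
        (∀ j, NCPB.ev (NCPB.b A B s t j).adjoint (NCPB.psi0 A B s t M') = 0) ∧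
        ∀ n, NCPB.phi A B s t M n ∈ NCPB.schwartzD ∧ NCPB.psi A B s t M' n ∈ NCPB.schwartzD) ∧
      -- the orthonormal basis `χ`
      NCPB.IsPseudoBosonic NCPB.schwartzD NCPB.cgd (fun j => (NCPB.cgd j).adjoint) ∧
      NCPB.chi0 ∈ NCPB.schwartzD ∧ (∀ j, NCPB.ev (NCPB.cgd j) NCPB.chi0 = 0) ∧
      Orthonormal ℂ NCPB.chi ∧
      (Submodule.span ℂ (Set.range NCPB.chi)).topologicalClosure = ⊤ ∧
      -- the operator `T`
      IsSelfAdjoint (NCPB.exponent A B s t).closure ∧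
      (∃ T, NCPB.IsExp (NCPB.exponent A B s t).closure T) ∧
      ∀ T, NCPB.IsExp (NCPB.exponent A B s t).closure T →
        IsSelfAdjoint T ∧ LinearMap.ker T.toFun = ⊥ ∧
        ((A, B) ≠ (0, 0) → ¬ ∃ C : ℝ, ∀ f : T.domain, ‖T f‖ ≤ C * ‖(f : NCPB.Hil)‖) ∧
        (∀ n, NCPB.chi n ∈ T.domain ⊓ T.inverse.domain) ∧
        -- for a suitable choice of the normalization constants
        (∃ M M' : ℂ, inner ℂ (NCPB.phi0 A B s t M) (NCPB.psi0 A B s t M') = 1 ∧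
          ∀ n, NCPB.phi A B s t M n = NCPB.ev T (NCPB.chi n) ∧
            NCPB.psi A B s t M' n = NCPB.ev T.inverse (NCPB.chi n)) ∧
        -- for every choice of the normalization constants
        ∀ M M' : ℂ, inner ℂ (NCPB.phi0 A B s t M) (NCPB.psi0 A B s t M') = 1 →
          (∃ c : ℂ, c ≠ 0 ∧ ∀ n, NCPB.phi A B s t M n = c • NCPB.ev T (NCPB.chi n) ∧
            NCPB.psi A B s t M' n =
              ((starRingEnd ℂ) c)⁻¹ • NCPB.ev T.inverse (NCPB.chi n)) ∧
          (∀ n m, inner ℂ (NCPB.phi A B s t M n) (NCPB.psi A B s t M' m) =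
            if n = m then 1 else 0) ∧
          NCPB.IsQuasiBases (T.domain ⊓ T.inverse.domain)
            (NCPB.phi A B s t M) (NCPB.psi A B s t M') := by
  refine ⟨NCPB.eqModQuadratic_comm_xHat_pHat, NCPB.eqModQuadratic_comm_xHat,
    NCPB.eqModQuadratic_comm_pHat, NCPB.eqModQuadratic_hHat_hTrunc A B,
    NCPB.eqModQuadratic_hHat_hNumber A B, fun s t => ?_⟩
  obtain ⟨hsa, hex⟩ := NCPB.exists_isExp_exponent A B s t
  refine ⟨NCPB.isPseudoBosonic_ab A B s t, NCPB.exists_ev_b_ne A B s t, fun M M' =>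
    ⟨NCPB.ev_a_phi0 A B s t M, NCPB.ev_b_adjoint_psi0 A B s t M', fun n => ⟨?_, ?_⟩⟩,
    NCPB.isPseudoBosonic_cgd, ?_, NCPB.ev_cgd_chi0, NCPB.orthonormal_chi,
    NCPB.topologicalClosure_span_chi, hsa, hex, fun T hT => ?_⟩
  · rw [NCPB.phi_eq_incl]
    exact Submodule.smul_mem _ _ (NCPB.incl_mem _)
  · rw [NCPB.psi_eq_incl]
    exact Submodule.smul_mem _ _ (NCPB.incl_mem _)
  · rw [NCPB.chi0_eq]
    exact NCPB.incl_mem _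
  obtain ⟨v, hv⟩ : ∃ v, v = NCPB.vacConst A B s t := ⟨_, rfl⟩
  have hv0 : v ≠ 0 := hv ▸ NCPB.vacConst_ne_zero A B s t
  have hφ : ∀ n, (NCPB.chi n, NCPB.stateCurve A B s t n 1) ∈ T.graph := fun n => by
    simpa [NCPB.stateCurve_zero] using hT.mem_graph_stateCurve n 0
  have hΨ : ∀ n, (NCPB.stateCurve A B s t n (-1), NCPB.chi n) ∈ T.graph := fun n => by
    simpa [NCPB.stateCurve_zero] using hT.mem_graph_stateCurve n (-1)
  -- The curve exists for all times: going on to time `2` puts `φ_n` in the domain of `T`, and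
  -- starting from time `-2` puts `Ψ_n` in the range of `T`.
  have hφ' : ∀ n, NCPB.stateCurve A B s t n 1 ∈ T.domain := fun n =>
    LinearPMap.mem_domain_of_mem_graph (hT.mem_graph_stateCurve n 1)
  have hΨ' : ∀ n, NCPB.stateCurve A B s t n (-1) ∈ T.inverse.domain := fun n => by
    have := hT.mem_graph_inverse (hT.mem_graph_stateCurve n (-1 - 1))
    rw [sub_add_cancel] at this
    exact LinearPMap.mem_domain_of_mem_graph this
  have hTφ : ∀ n, NCPB.ev T (NCPB.chi n) = NCPB.stateCurve A B s t n 1 := fun n =>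
    NCPB.ev_of_mem_graph (hφ n)
  have hTΨ : ∀ n, NCPB.ev T.inverse (NCPB.chi n) = NCPB.stateCurve A B s t n (-1) := fun n =>
    NCPB.ev_of_mem_graph (hT.mem_graph_inverse (hΨ n))
  have hinner : ∀ M M' : ℂ, inner ℂ (NCPB.phi0 A B s t M) (NCPB.psi0 A B s t M')
      = (starRingEnd ℂ) (M / v) * (M' / v) := fun M M' => by
    rw [← NCPB.phi_zero, ← NCPB.psi_zero, hT.inner_phi_psi, if_pos rfl, mul_one, hv]
  refine ⟨hT.isSelfAdjoint, hT.ker_eq_bot, hT.not_bounded, fun n =>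
    ⟨LinearPMap.mem_domain_of_mem_graph (hφ n),
      LinearPMap.mem_domain_of_mem_graph (hT.mem_graph_inverse (hΨ n))⟩, ⟨v, v, ?_, fun n => ?_⟩,
    fun M M' hM => ?_⟩
  · rw [hinner, div_self hv0, map_one, one_mul]
  · rw [NCPB.phi_eq, NCPB.psi_eq, hTφ, hTΨ, ← hv, div_self hv0, one_smul, one_smul]
    exact ⟨rfl, rfl⟩
  · rw [hinner] at hM
    -- The normalization says `conj(M / v) * (M' / v) = 1`, so `c = M / v` is nonzero and `M' / v`
    -- is the inverse of its conjugate.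
    refine ⟨⟨M / v, ?_, fun n => ?_⟩, fun n m => ?_, ?_⟩
    · intro h0
      rw [h0, map_zero, zero_mul] at hM
      exact zero_ne_one hM
    · rw [hTφ, hTΨ, inv_eq_of_mul_eq_one_right hM, hv]
      exact ⟨NCPB.phi_eq A B s t M n, NCPB.psi_eq A B s t M' n⟩
    · rw [hT.inner_phi_psi, ← hv, hM, one_mul]
    · have := (hT.isQuasiBases NCPB.orthonormal_chi NCPB.topologicalClosure_span_chi hφ hΨ hφ'
        hΨ').smul hM
      have e1 : NCPB.phi A B s t M = fun n => (M / v) • NCPB.stateCurve A B s t n 1 :=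
        hv ▸ funext (NCPB.phi_eq A B s t M)
      have e2 : NCPB.psi A B s t M' = fun n => (M' / v) • NCPB.stateCurve A B s t n (-1) :=
        hv ▸ funext (NCPB.psi_eq A B s t M')
      rw [e1, e2]
      exact this
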